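/- For $t\ge 0$ and $m\in[-1,1]\setminus\{0\}$ the equation $$t^2M^3+t(2-t)M|M|+(1-2t)M-m=0$$ has exactly one real solution $M=M(t,m)$ with the same sign as $m$; set $M(t,0)=0$ and $$Z(t,m)=\frac{2M(t,m)}{t|M(t,m)|+1}.$$ Let $G(m,z)=\frac{m z|z|}{2}-\frac{z^2}{2}$. For every $T>0$, the function $Z$ is the unique (up to null sets) entropy solution on $[0,T]\times[-1,1]$ of $$\partial_t Z+\partial_m\big(G(m,Z)\big)=0,\qquad Z(0,m)=2m,$$ no boundary condition being imposed at $m=\pm1$. Here an entropy solution is a bounded measurable function $W$ on $(0,T)\times(-1,1)$ such that, for every smooth $\varphi$ with compact support in $[0,T)\times(-1,1)$, $$\int_0^T\!\!\int_{-1}^1\big(W\,\partial_t\varphi+G(m,W)\,\partial_m\varphi\big)\,dm\,dt+\int_{-1}^1 2m\,\varphi(0,m)\,dm=0,$$ and, for every such $\varphi\ge0$ and every $k\in\mathbb R$, $$\int_0^T\!\!\int_{-1}^1\Big(|W-k|\,\partial_t\varphi+\operatorname{sgn}(W-k)\big(G(m,W)-G(m,k)\big)\partial_m\varphi-\operatorname{sgn}(W-k)\,(\partial_mG)(m,k)\,\varphi\Big)dm\,dt+\int_{-1}^1|2m-k|\,\varphi(0,m)\,dm\ge0.$$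 Moreover, for every $t>1/2$ the function $Z$ has a shock at $m=0$: the one-sided limits $Z_\pm(t)=\lim_{m\to0^\pm}Z(t,m)$ exist and $Z_+(t)=-Z_-(t)>0$. At all other points of $[0,\infty)\times[-1,1]$ (that is, off $\{m=0,\ t>1/2\}$) the function $Z$ is continuous. -/

import Mathlib

open MeasureTheory Set Filter Topology
open scoped ContDiff

noncomputable section

namespace TwoState

/-- The open space-time domain `(0, T) × (-1, 1)`; points are written `(t, m)`. -/
def domain (T : ℝ) : Set (ℝ × ℝ) := Ioo 0 T ×ˢ Ioo (-1) 1

/-- Test functions on `[0, T) × (-1, 1)`: smooth, with compact support contained in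
`{t < T} × (-1, 1)`. They need not vanish at `t = 0`, but they vanish near `m = -1` and `m = 1`
(no boundary condition is imposed there). -/
structure IsTest (T : ℝ) (φ : ℝ × ℝ → ℝ) : Prop where
  smooth : ContDiff ℝ ∞ φ
  compact : HasCompactSupport φ
  support : tsupport φ ⊆ Iio T ×ˢ Ioo (-1) 1

/-- The partial derivative in the time variable. -/
def dt (φ : ℝ × ℝ → ℝ) (p : ℝ × ℝ) : ℝ := deriv (fun t => φ (t, p.2)) p.1

/-- The partial derivative in the space variable. -/
def dm (φ : ℝ × ℝ → ℝ) (p : ℝ × ℝ) : ℝ := deriv (fun m => φ (p.1, m)) p.2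

/-- Entropy admissible weak solutions, on `[0, T] × [-1, 1]`, of the scalar conservation law
`∂_t W + ∂_m (G (m, W)) = 0` with initial datum `W (0, m) = f m`: bounded measurable functions
which satisfy the equation and the initial condition in the weak sense, together with
Kruzhkov's entropy inequality
`∂_t |W - k| + ∂_m (sgn (W - k) (G (m, W) - G (m, k))) + sgn (W - k) (∂_m G) (m, k) ≤ 0`
(with initial datum `|f - k|`) for every real constant `k`. -/
structure IsEntropySolution (G : ℝ → ℝ → ℝ) (f : ℝ → ℝ) (T : ℝ) (W : ℝ → ℝ → ℝ) : Prop where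
  measurable : AEMeasurable (fun p : ℝ × ℝ => W p.1 p.2) (volume.restrict (domain T))
  bounded : ∃ C : ℝ, ∀ᵐ p ∂(volume.restrict (domain T)), |W p.1 p.2| ≤ C
  weak : ∀ φ : ℝ × ℝ → ℝ, IsTest T φ →
    (∫ p in domain T, (W p.1 p.2 * dt φ p + G p.2 (W p.1 p.2) * dm φ p))
      + ∫ m in Ioo (-1 : ℝ) 1, f m * φ (0, m) = 0
  entropy : ∀ k : ℝ, ∀ φ : ℝ × ℝ → ℝ, IsTest T φ → (∀ p, 0 ≤ φ p) →
    0 ≤ (∫ p in domain T,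
          (|W p.1 p.2 - k| * dt φ p
            + Real.sign (W p.1 p.2 - k) * (G p.2 (W p.1 p.2) - G p.2 k) * dm φ p
            - Real.sign (W p.1 p.2 - k) * deriv (fun m => G m k) p.2 * φ p))
        + ∫ m in Ioo (-1 : ℝ) 1, |f m - k| * φ (0, m)

/-- The flux `m z|z|/2 - z²/2`. -/
def flux (m z : ℝ) : ℝ := m * (z * |z| / 2) - z ^ 2 / 2

/-- The left-hand side of the consistency equation. -/
def cubic (M t m : ℝ) : ℝ :=
  t ^ 2 * M ^ 3 + t * (2 - t) * (M * |M|) + (1 - 2 * t) * M - m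

/-- `M` solves the consistency equation at `(t, m)` and has the sign of `m`. -/
def IsSignedRoot (t m M : ℝ) : Prop :=
  cubic M t m = 0 ∧ SignType.sign M = SignType.sign m

open Classical in
/-- `M (t, m)`: the solution of the consistency equation with the same sign as `m` if `m ≠ 0`,
and `0` if `m = 0`. -/
def rootM (t m : ℝ) : ℝ :=
  if m = 0 then 0 else Classical.epsilon (IsSignedRoot t m)

/-- `Z (t, m) = 2 M (t, m) / (t |M (t, m)| + 1)`. -/
def Zstar (t m : ℝ) : ℝ := 2 * rootM t m / (t * |rootM t m| + 1)

end TwoState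

end

noncomputable section

namespace TwoState

/-! ### The consistency equation -/

/-! The consistency equation is the method of characteristics. For `m > 0` it reads `(1 - M) (1 + t
M)² = 1 - m`. Solving `m' = -(1 - m) Z`, `Z' = -Z² / 2` from the point `(M, 2 M)` gives `Z = 2 M /
(1 + t M)` and `1 - m = (1 - M) (1 + t M)²`, so `M (t, m)` is the foot of the characteristic through
`(t, m)`. The case `m < 0` follows by oddness. The positive root is unique and nondegenerate, so `Z`
is smooth off `m = 0` and solves the equation there classically (`contDiffAt_Zstar`, `Zstar_pde`).
The characteristics of both sides run towards `m = 0`; after `t = 1/2` they arrive with nonzero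
values `±z` and form a standing shock.

Existence. Off `m = 0` the weak form and Kruzhkov's relation hold with equality (`weak_smooth`,
`entropy_smooth`). Cutting test functions off near `m = 0` and letting the cut-off shrink leaves the
difference of the two fluxes at `m = 0±` (`functional_eq_layer`). The flux at `m = 0` is `-z² / 2`.
It is even, so the states `-z` and `z` satisfy the Rankine–Hugoniot condition; it is concave, so a
jump upwards from `-z` to `z` dissipates entropy (`kflux_zero_left_le`).

Uniqueness. Doubling of variables is avoided because one of the two solutions is smooth off a line.
Spreading the level `k` around a smooth function `V` turns Kruzhkov's inequality for constants into
one for `V`, with the residual of `V` as source (`kruzhkov_smooth`). With `V = Z` away from `m = 0`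
and `m = ±1` the residual vanishes (`kruzhkov_bulk`). At `m = ±1` the flux is monotone and the
characteristics leave the interval, so the boundary terms have a good sign (`kflux_ends`). At `m =
0` the competitor `w` need not have traces. A second use of the inequality, with `V = y (t)` close
to the left trace of `Z` and a test function living in the layer, supplies the missing terms: on the
left side of the layer the fluxes cancel, on the right side the shock inequality gives the sign
(`kruzhkov_layer`, `comparison_at_scale`). What remains is `0 ≤ ∫∫ |w - Z| θ'(t)`; a decreasing `θ`
forces `w = Z` (`ae_eq_Zm_of_lt`). -/

theorem isSignedRoot_iff_of_pos {t m M : ℝ} (hm : 0 < m) :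
    IsSignedRoot t m M ↔ 0 < M ∧ (1 - M) * (1 + t * M) ^ 2 = 1 - m := by
  unfold IsSignedRoot cubic
  rw [sign_pos hm, sign_eq_one_iff]
  constructor
  · rintro ⟨h, hM⟩
    rw [abs_of_pos hM] at h
    exact ⟨hM, by linear_combination -h⟩
  · rintro ⟨hM, h⟩
    rw [abs_of_pos hM]
    exact ⟨by linear_combination -h, hM⟩

theorem cubic_neg (M t m : ℝ) : cubic (-M) t (-m) = -cubic M t m := by
  unfold cubic
  rw [abs_neg]
  ring

theorem isSignedRoot_neg_iff {t m M : ℝ} : IsSignedRoot t (-m) (-M) ↔ IsSignedRoot t m M := by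
  unfold IsSignedRoot
  rw [cubic_neg, Left.sign_neg, Left.sign_neg, neg_eq_zero, neg_inj]

/-- `m` lies in the range where the equation has exactly one positive root at time `t`. -/
def Adm (t m : ℝ) : Prop := -1 < t ∧ 0 < m ∧ m ≤ 1 ∧ (0 ≤ t ∨ m < 1)

/-- A root `M > 1` would make the left side negative, while `1 - m ≥ 0`. For `t < 0` the bounds `M <
1` and `t > -1` keep `1 + t M` positive. Times in `(-1, 0)` are carried along so that `Z` is smooth
in a full neighbourhood of the initial line. -/
theorem root_le_one {t m M : ℝ} (h : Adm t m) (hM : 0 < M)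
    (e : (1 - M) * (1 + t * M) ^ 2 = 1 - m) : M ≤ 1 ∧ 0 < 1 + t * M := by
  obtain ⟨h1, h2, h3, h4⟩ := h
  rcases le_or_gt 0 t with ht | ht
  · have hp : 0 < 1 + t * M := by positivity
    refine ⟨?_, hp⟩
    by_contra hc
    push Not at hc
    nlinarith [pow_pos hp 2]
  · have hm : m < 1 := h4.resolve_left (not_le.2 ht)
    have hM1 : M < 1 := by
      by_contra hc
      push Not at hc
      nlinarith [sq_nonneg (1 + t * M)]
    exact ⟨hM1.le, by nlinarith⟩

/-- The equation expresses `m` through `M`; strict monotonicity of that expression along positive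
roots is what gives uniqueness, by taking `m = m'`. -/
theorem root_strictMono {t m m' M M' : ℝ} (h : Adm t m) (hM : 0 < M) (h' : M < M')
    (e : (1 - M) * (1 + t * M) ^ 2 = 1 - m)
    (e' : (1 - M') * (1 + t * M') ^ 2 = 1 - m') : m < m' := by
  obtain ⟨hM1, hp⟩ := root_le_one h hM e
  obtain ⟨h1, h2, h3, h4⟩ := h
  rcases le_or_gt 0 t with ht | ht
  -- With `y = 1 + t M` the equation is `m = M q`, `q = y² - t y - t`. Since `m > 0`, `q > 0`, hence
  -- `y (y - t) > t ≥ 0` and `y > t`. Beyond that point `q` is nondecreasing, by `q' - q = (y' - y)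
  -- (y' + y - t)`.
  · have hg : m = M * ((1 + t * M) ^ 2 - t * (1 + t * M) - t) := by linear_combination e
    have hg' : m' = M' * ((1 + t * M') ^ 2 - t * (1 + t * M') - t) := by linear_combination e'
    have hpos : 0 < (1 + t * M) ^ 2 - t * (1 + t * M) - t := by
      by_contra hc
      push Not at hc
      nlinarith
    have hy : t < 1 + t * M := by
      by_contra hc
      push Not at hc
      nlinarith
    have hmono : (1 + t * M) ^ 2 - t * (1 + t * M) - t
        ≤ (1 + t * M') ^ 2 - t * (1 + t * M') - t := by
      have : 0 ≤ (t * (M' - M)) * (1 + t * M' + 1 + t * M - t) := by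
        apply mul_nonneg (mul_nonneg ht (by linarith))
        have : 0 ≤ t * M' := mul_nonneg ht (by linarith)
        linarith
      nlinarith
    rw [hg, hg']
    nlinarith
  · have hm : m < 1 := h4.resolve_left (not_le.2 ht)
    have hM1' : M < 1 := by
      by_contra hc
      push Not at hc
      nlinarith [sq_nonneg (1 + t * M)]
    -- For `t < 0` both factors `1 - M` and `(1 + t M)²` decrease while `M < 1`; for `M' ≥ 1` the
    -- left side is not even positive.
    rcases lt_or_ge M' 1 with hlt | hge
    · have hq : 0 < 1 + t * M' := by nlinarith
      have hqp : 1 + t * M' < 1 + t * M := by nlinarith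
      have : (1 + t * M') ^ 2 < (1 + t * M) ^ 2 := by nlinarith
      have : (1 - M') * (1 + t * M') ^ 2 < (1 - M) * (1 + t * M) ^ 2 :=
        mul_lt_mul'' (by linarith) this (by linarith) (by positivity)
      linarith
    · have : (1 - M') * (1 + t * M') ^ 2 ≤ 0 :=
        mul_nonpos_of_nonpos_of_nonneg (by linarith) (sq_nonneg _)
      have : 0 < (1 - M) * (1 + t * M) ^ 2 := mul_pos (by linarith) (by positivity)
      linarith

/-- Existence is the intermediate value theorem on `[0, 1]`, where `(1 - M) (1 + t M)²` goes from
`1` to `0`; uniqueness is strict monotonicity. -/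
theorem existsUnique_of_adm {t m : ℝ} (h : Adm t m) : ∃! M : ℝ, IsSignedRoot t m M := by
  have hm := h.2.1
  have hex : ∃ M : ℝ, IsSignedRoot t m M := by
    have hc : ContinuousOn (fun M : ℝ => (1 - M) * (1 + t * M) ^ 2) (Icc 0 1) := by fun_prop
    have := intermediate_value_Icc' (zero_le_one (α := ℝ)) hc
    obtain ⟨M, hM, e⟩ := this (show 1 - m ∈ _ from ⟨by simp; exact h.2.2.1, by simp; linarith⟩)
    refine ⟨M, (isSignedRoot_iff_of_pos hm).2 ⟨lt_of_le_of_ne hM.1 ?_, e⟩⟩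
    rintro rfl
    simp at e
    linarith
  obtain ⟨M, hM⟩ := hex
  refine ⟨M, hM, fun M' hM' => ?_⟩
  rw [isSignedRoot_iff_of_pos hm] at hM hM'
  rcases lt_trichotomy M' M with hlt | heq | hgt
  · exact absurd (root_strictMono h hM'.1 hlt hM'.2 hM.2) (lt_irrefl _)
  · exact heq
  · exact absurd (root_strictMono h hM.1 hgt hM.2 hM'.2) (lt_irrefl _)

theorem existsUnique_neg {t m : ℝ} (h : ∃! M : ℝ, IsSignedRoot t m M) :
    ∃! M : ℝ, IsSignedRoot t (-m) M := by
  obtain ⟨M, hM, hu⟩ := h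
  refine ⟨-M, isSignedRoot_neg_iff.2 hM, fun M' hM' => ?_⟩
  have : IsSignedRoot t m (-M') := by
    rw [← isSignedRoot_neg_iff, neg_neg]
    exact hM'
  rw [← hu _ this, neg_neg]

theorem existsUnique_isSignedRoot {t : ℝ} (ht : 0 ≤ t) {m : ℝ} (hm : m ∈ Icc (-1 : ℝ) 1)
    (hm0 : m ≠ 0) : ∃! M : ℝ, IsSignedRoot t m M := by
  rcases lt_or_gt_of_ne hm0 with h | h
  · have := existsUnique_neg (existsUnique_of_adm (t := t) (m := -m)
      ⟨by linarith, by linarith, by linarith [hm.1], Or.inl ht⟩)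
    rwa [neg_neg] at this
  · exact existsUnique_of_adm ⟨by linarith, h, hm.2, Or.inl ht⟩

theorem rootM_zero (t : ℝ) : rootM t 0 = 0 := by simp [rootM]

theorem rootM_spec {t m : ℝ} (hm : m ≠ 0) (h : ∃! M : ℝ, IsSignedRoot t m M) :
    IsSignedRoot t m (rootM t m) := by
  rw [rootM, if_neg hm]
  exact Classical.epsilon_spec h.exists

theorem rootM_eq {t m M : ℝ} (hm : m ≠ 0) (h : ∃! M : ℝ, IsSignedRoot t m M)
    (hM : IsSignedRoot t m M) : rootM t m = M :=
  h.unique (rootM_spec hm h) hM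

theorem rootM_spec_of_adm {t m : ℝ} (h : Adm t m) :
    0 < rootM t m ∧ (1 - rootM t m) * (1 + t * rootM t m) ^ 2 = 1 - m :=
  (isSignedRoot_iff_of_pos h.2.1).1 (rootM_spec h.2.1.ne' (existsUnique_of_adm h))

theorem rootM_eq_of_adm {t m M : ℝ} (h : Adm t m) (hM : 0 < M)
    (e : (1 - M) * (1 + t * M) ^ 2 = 1 - m) : rootM t m = M :=
  rootM_eq h.2.1.ne' (existsUnique_of_adm h) ((isSignedRoot_iff_of_pos h.2.1).2 ⟨hM, e⟩)

theorem rootM_neg_of_adm {t m : ℝ} (h : Adm t m) : rootM t (-m) = -rootM t m :=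
  rootM_eq (neg_ne_zero.2 h.2.1.ne') (existsUnique_neg (existsUnique_of_adm h))
    (isSignedRoot_neg_iff.2 (rootM_spec h.2.1.ne' (existsUnique_of_adm h)))

theorem Zstar_neg_of_adm {t m : ℝ} (h : Adm t m) : Zstar t (-m) = -Zstar t m := by
  rw [Zstar, Zstar, rootM_neg_of_adm h, abs_neg]
  ring

theorem Zstar_of_adm {t m : ℝ} (h : Adm t m) :
    Zstar t m = 2 * rootM t m / (t * rootM t m + 1) := by
  rw [Zstar, abs_of_pos (rootM_spec_of_adm h).1]

theorem Zstar_pos {t m : ℝ} (h : Adm t m) : 0 < Zstar t m := by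
  obtain ⟨h1, h2⟩ := rootM_spec_of_adm h
  rw [Zstar_of_adm h]
  have := (root_le_one h h1 h2).2
  exact div_pos (by linarith) (by linarith)

theorem Zstar_zero (t : ℝ) : Zstar t 0 = 0 := by simp [Zstar, rootM_zero]

theorem adm_of_nonneg {t m : ℝ} (ht : 0 ≤ t) (h0 : 0 < m) (h1 : m ≤ 1) : Adm t m :=
  ⟨by linarith, h0, h1, Or.inl ht⟩

theorem Zstar_neg {t m : ℝ} (ht : 0 ≤ t) (hm : m ∈ Icc (-1 : ℝ) 1) :
    Zstar t (-m) = -Zstar t m := by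
  rcases lt_trichotomy m 0 with h | h | h
  · have := Zstar_neg_of_adm (adm_of_nonneg ht (m := -m) (by linarith) (by linarith [hm.1]))
    rw [neg_neg] at this
    linarith
  · subst h
    simp [Zstar_zero]
  · exact Zstar_neg_of_adm (adm_of_nonneg ht h hm.2)

theorem abs_Zstar_le {t m : ℝ} (ht : 0 ≤ t) (hm : m ∈ Icc (-1 : ℝ) 1) : |Zstar t m| ≤ 2 := by
  have key : ∀ m : ℝ, 0 < m → m ≤ 1 → |Zstar t m| ≤ 2 := by
    intro m h0 h1
    have ha := adm_of_nonneg ht h0 h1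
    obtain ⟨e1, e2⟩ := rootM_spec_of_adm ha
    have h3 := (root_le_one ha e1 e2).1
    rw [abs_of_pos (Zstar_pos ha), Zstar_of_adm ha, div_le_iff₀ (by positivity)]
    nlinarith [mul_nonneg ht e1.le]
  rcases lt_trichotomy m 0 with h | h | h
  · have := key (-m) (by linarith) (by linarith [hm.1])
    rwa [Zstar_neg ht hm, abs_neg] at this
  · subst h
    simp [Zstar_zero]
  · exact key m h hm.2

theorem rootM_initial {m : ℝ} (hm : m ∈ Icc (-1 : ℝ) 1) : rootM 0 m = m := by
  rcases eq_or_ne m 0 with h | h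
  · rw [h, rootM_zero]
  · refine rootM_eq h (existsUnique_isSignedRoot le_rfl hm h) ⟨?_, rfl⟩
    simp [cubic]

theorem Zstar_initial {m : ℝ} (hm : m ∈ Icc (-1 : ℝ) 1) : Zstar 0 m = 2 * m := by
  simp [Zstar, rootM_initial hm]

/-! ### Continuity up to the boundary and one-sided limits -/

theorem rootM_mem {t m : ℝ} (ht : 0 ≤ t) (hm : m ∈ Icc (-1 : ℝ) 1) :
    cubic (rootM t m) t m = 0 ∧ rootM t m ∈ Icc (-1 : ℝ) 1 ∧ 0 ≤ rootM t m * m := by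
  have key : ∀ m : ℝ, 0 < m → m ≤ 1 →
      cubic (rootM t m) t m = 0 ∧ rootM t m ∈ Icc (-1 : ℝ) 1 ∧ 0 ≤ rootM t m * m := by
    intro m h0 h1
    have ha := adm_of_nonneg ht h0 h1
    obtain ⟨e1, e2⟩ := rootM_spec_of_adm ha
    have h3 := (root_le_one ha e1 e2).1
    exact ⟨(rootM_spec h0.ne' (existsUnique_of_adm ha)).1, ⟨by linarith, h3⟩, by positivity⟩
  rcases lt_trichotomy m 0 with h | h | h
  · have ha := adm_of_nonneg ht (m := -m) (by linarith) (by linarith [hm.1])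
    have := key (-m) (by linarith) (by linarith [hm.1])
    have h' := rootM_neg_of_adm ha
    rw [neg_neg] at h'
    have h2 : rootM t (-m) = -rootM t m := by rw [h', neg_neg]
    rw [h2, cubic_neg] at this
    obtain ⟨a, b, c⟩ := this
    exact ⟨by linarith, ⟨by linarith [b.2], by linarith [b.1]⟩, by linarith⟩
  · subst h
    simp [rootM_zero, cubic]
  · exact key m h hm.2

theorem continuous_cubic : Continuous fun q : ℝ × ℝ × ℝ => cubic q.1 q.2.1 q.2.2 := by
  unfold cubic
  fun_prop

/-- Up to `t = 1/2` the coefficient `1 - 2 t` is nonnegative, so the cofactor of `M` cannot vanish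
at a nonzero `M`. This is the threshold for the shock. -/
theorem eq_zero_of_cubic {t M : ℝ} (ht : 0 ≤ t) (ht' : t ≤ 1 / 2) (h : cubic M t 0 = 0) :
    M = 0 := by
  have h1 : M * (t ^ 2 * M ^ 2 + t * (2 - t) * |M| + (1 - 2 * t)) = 0 := by
    unfold cubic at h
    linear_combination h
  rcases mul_eq_zero.1 h1 with h0 | h0
  · exact h0
  · by_contra hne
    have hp : 0 < |M| := abs_pos.2 hne
    rcases eq_or_lt_of_le ht with rfl | htp
    · norm_num at h0
    · have : 0 < t * (2 - t) * |M| := mul_pos (mul_pos htp (by linarith)) hp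
      have : 0 ≤ t ^ 2 * M ^ 2 := by positivity
      linarith

/-- Compactness in place of estimates: the values stay in `[-1, 1]`, the equation and the sign
condition are closed, and they have a single solution at the limit point. At `m = 0` this uses `t ≤
1/2`. -/
theorem continuousOn_rootM : ContinuousOn (fun p : ℝ × ℝ => rootM p.1 p.2)
    {p : ℝ × ℝ | 0 ≤ p.1 ∧ p.2 ∈ Icc (-1 : ℝ) 1 ∧ ¬ (p.2 = 0 ∧ 1 / 2 < p.1)} := by
  rintro ⟨t, m⟩ ⟨ht, hm, hs⟩
  simp only at ht hm hs
  set S := {p : ℝ × ℝ | 0 ≤ p.1 ∧ p.2 ∈ Icc (-1 : ℝ) 1 ∧ ¬ (p.2 = 0 ∧ 1 / 2 < p.1)} with hS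
  refine isCompact_Icc.tendsto_nhds_of_unique_mapClusterPt (s := Icc (-1 : ℝ) 1) ?_ ?_
  · filter_upwards [self_mem_nhdsWithin] with p hp
    exact (rootM_mem hp.1 hp.2.1).2.1
  · intro y hy hcl
    -- Cluster points of the values are lifted to cluster points of the pairs (value, argument), so
    -- that closed conditions on the pairs pass to the limit.
    have hcl2 : MapClusterPt (y, (t, m)) (𝓝[S] (t, m)) (fun p : ℝ × ℝ => (rootM p.1 p.2, p)) := by
      have h2 : Tendsto (fun p : ℝ × ℝ => p) (𝓝[S] (t, m)) (𝓝 (t, m)) :=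
        tendsto_id.mono_left nhdsWithin_le_nhds
      rw [mapClusterPt_iff_frequently] at hcl ⊢
      intro s hs'
      rw [nhds_prod_eq] at hs'
      obtain ⟨u, hu, v, hv, huv⟩ := Filter.mem_prod_iff.1 hs'
      exact ((hcl u hu).and_eventually (h2 hv)).mono fun p hp => huv ⟨hp.1, hp.2⟩
    have hclosed : IsClosed {q : ℝ × ℝ × ℝ | cubic q.1 q.2.1 q.2.2 = 0 ∧ 0 ≤ q.1 * q.2.2} :=
      (isClosed_eq continuous_cubic continuous_const).inter
        (isClosed_le continuous_const (continuous_fst.mul (continuous_snd.comp continuous_snd)))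
    have hmem : (y, (t, m)) ∈ {q : ℝ × ℝ × ℝ | cubic q.1 q.2.1 q.2.2 = 0 ∧ 0 ≤ q.1 * q.2.2} := by
      by_contra hc
      rw [mapClusterPt_iff_frequently] at hcl2
      have := hcl2 _ (hclosed.isOpen_compl.mem_nhds hc)
      refine this (eventually_of_mem self_mem_nhdsWithin fun p hp => ?_)
      have h3 := rootM_mem hp.1 hp.2.1
      simp [h3.1, h3.2.2]
    obtain ⟨e1, e2⟩ := hmem
    simp only at e1 e2
    change y = rootM t m
    rcases eq_or_ne m 0 with rfl | hm0
    · rw [rootM_zero]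
      exact eq_zero_of_cubic ht (not_lt.1 fun h => hs ⟨rfl, h⟩) e1
    · refine (rootM_eq hm0 (existsUnique_isSignedRoot ht hm hm0) ⟨e1, ?_⟩).symm
      have hy0 : y ≠ 0 := by
        rintro rfl
        simp [cubic] at e1
        exact hm0 e1
      rcases lt_or_gt_of_ne hm0 with h | h
      · rw [sign_neg h, sign_neg]
        exact lt_of_le_of_ne (by nlinarith) hy0
      · rw [sign_pos h, sign_pos]
        exact lt_of_le_of_ne (by nlinarith) hy0.symm

theorem continuousOn_Zstar : ContinuousOn (fun p : ℝ × ℝ => Zstar p.1 p.2)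
    {p : ℝ × ℝ | 0 ≤ p.1 ∧ p.2 ∈ Icc (-1 : ℝ) 1 ∧ ¬ (p.2 = 0 ∧ 1 / 2 < p.1)} := by
  unfold Zstar
  refine (continuousOn_const.mul continuousOn_rootM).div
    ((continuousOn_fst.mul continuousOn_rootM.abs).add continuousOn_const) ?_
  rintro ⟨t, m⟩ ⟨ht, -⟩
  simp only at ht
  positivity

/-! ### The traces at `m = 0±` -/

/-- `1 + t M (t, 0+)`. -/
def edge (t : ℝ) : ℝ := max 1 ((t + √(t ^ 2 + 4 * t)) / 2)

/-- The trace `M (t, 0+)`. -/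
def rootPlus (t : ℝ) : ℝ := 1 - 1 / edge t ^ 2

/-- The trace `Z (t, 0+)`. -/
def Zplus (t : ℝ) : ℝ := 2 * rootPlus t / (t * rootPlus t + 1)

theorem one_le_edge (t : ℝ) : 1 ≤ edge t := le_max_left _ _

theorem continuous_edge : Continuous edge := by
  unfold edge
  fun_prop

theorem continuous_rootPlus : Continuous rootPlus := by
  unfold rootPlus
  refine continuous_const.sub (continuous_const.div (continuous_edge.pow 2) fun t => ?_)
  have := one_le_edge t
  positivity

theorem rootPlus_nonneg (t : ℝ) : 0 ≤ rootPlus t := by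
  have h := one_le_edge t
  rw [rootPlus, sub_nonneg, div_le_one (by positivity)]
  nlinarith

theorem rootPlus_le_one (t : ℝ) : rootPlus t ≤ 1 := by
  have h := one_le_edge t
  rw [rootPlus]
  have : 0 ≤ 1 / edge t ^ 2 := by positivity
  linarith

theorem continuousOn_Zplus : ContinuousOn Zplus (Ici 0) := by
  unfold Zplus
  refine (continuous_const.mul continuous_rootPlus).continuousOn.div
    ((continuous_id.mul continuous_rootPlus).add continuous_const).continuousOn fun t ht => ?_
  have := rootPlus_nonneg t
  have ht : 0 ≤ t := ht
  have h2 : 0 < t * rootPlus t + 1 := by positivity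
  exact h2.ne'

theorem Zplus_nonneg {t : ℝ} (ht : 0 ≤ t) : 0 ≤ Zplus t := by
  have := rootPlus_nonneg t
  unfold Zplus
  positivity

theorem Zplus_pos {t : ℝ} (ht : 1 / 2 < t) : 0 < Zplus t := by
  have h1 : 1 < edge t := by
    apply lt_max_of_lt_right
    have : 2 - t < √(t ^ 2 + 4 * t) := by
      rcases lt_or_ge t 2 with h | h
      · apply Real.lt_sqrt_of_sq_lt
        nlinarith
      · have : 0 < √(t ^ 2 + 4 * t) := Real.sqrt_pos.2 (by positivity)
        linarith
    linarith
  have h2 : 0 < rootPlus t := by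
    rw [rootPlus, sub_pos, div_lt_one (by positivity)]
    nlinarith
  unfold Zplus
  have : 0 < t := by linarith
  positivity

/-- A positive root satisfies `y² - t y - t > 0` with `y = 1 + t M ≥ 1`, so `y` lies beyond the
larger zero of this quadratic, hence beyond `edge t`; then `1 - M ≤ 1 / y²`. The bound keeps limits
as `m → 0+` away from the spurious root `0`. -/
theorem rootPlus_le_rootM {t m : ℝ} (ht : 0 ≤ t) (h0 : 0 < m) (h1 : m ≤ 1) :
    rootPlus t ≤ rootM t m := by
  have ha := adm_of_nonneg ht h0 h1
  obtain ⟨e1, e2⟩ := rootM_spec_of_adm ha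
  set M := rootM t m
  have hg : m = M * ((1 + t * M) ^ 2 - t * (1 + t * M) - t) := by linear_combination e2
  have hpos : 0 < (1 + t * M) ^ 2 - t * (1 + t * M) - t := by
    by_contra hc
    push Not at hc
    nlinarith
  have hs : √(t ^ 2 + 4 * t) ^ 2 = t ^ 2 + 4 * t := Real.sq_sqrt (by positivity)
  have hs0 := Real.sqrt_nonneg (t ^ 2 + 4 * t)
  have hy : edge t ≤ 1 + t * M := by
    refine max_le (by nlinarith) ?_
    by_contra hc
    push Not at hc
    have hst : t ≤ √(t ^ 2 + 4 * t) := Real.le_sqrt_of_sq_le (by linarith)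
    have hy1 : 1 ≤ 1 + t * M := by nlinarith
    nlinarith
  have hE := one_le_edge t
  have hM1 := (root_le_one ha e1 e2).1
  have hsq : edge t ^ 2 ≤ (1 + t * M) ^ 2 := by gcongr
  have : 1 - M ≤ 1 / edge t ^ 2 := by
    rw [le_div_iff₀ (by positivity)]
    calc (1 - M) * edge t ^ 2 ≤ (1 - M) * (1 + t * M) ^ 2 :=
          mul_le_mul_of_nonneg_left hsq (by linarith)
      _ ≤ 1 := by rw [e2]; linarith
  rw [rootPlus]
  linarith

theorem eq_rootPlus_of_cubic {t M : ℝ} (ht : 0 ≤ t) (hM : rootPlus t ≤ M)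
    (h : cubic M t 0 = 0) : M = rootPlus t := by
  have hM0 : 0 ≤ M := (rootPlus_nonneg t).trans hM
  have h1 : M * ((1 + t * M) ^ 2 - t * (1 + t * M) - t) = 0 := by
    unfold cubic at h
    rw [abs_of_nonneg hM0] at h
    linear_combination h
  have e2 : (1 - M) * (1 + t * M) ^ 2 = 1 := by linear_combination -h1
  rcases mul_eq_zero.1 h1 with h0 | h0
  · have := rootPlus_nonneg t
    linarith
  · have hs : √(t ^ 2 + 4 * t) ^ 2 = t ^ 2 + 4 * t := Real.sq_sqrt (by positivity)
    have hs0 := Real.sqrt_nonneg (t ^ 2 + 4 * t)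
    have hst : t ≤ √(t ^ 2 + 4 * t) := Real.le_sqrt_of_sq_le (by linarith)
    have hy1 : 1 ≤ 1 + t * M := by nlinarith
    have hy : edge t = 1 + t * M := by
      have : (t + √(t ^ 2 + 4 * t)) / 2 = 1 + t * M := by
        -- The quadratic is factored over its two zeros; the smaller one is at most `0` because `t ≤
        -- √(t² + 4 t)`, so `1 + t M ≥ 1` excludes it.
        have h2 : (1 + t * M - (t + √(t ^ 2 + 4 * t)) / 2)
            * (1 + t * M - (t - √(t ^ 2 + 4 * t)) / 2) = 0 := by
          nlinarith
        rcases mul_eq_zero.1 h2 with h3 | h3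
        · linarith
        · exfalso
          linarith
      rw [edge, this, max_eq_right hy1]
    rw [rootPlus, hy, eq_sub_iff_add_eq, ← eq_sub_iff_add_eq', div_eq_iff (by positivity), e2]

/-- Same compactness argument as for the continuity of `M`, now on `[rootPlus t, 1]`, where the
limit equation has a single root. -/
theorem tendsto_rootM_right {t : ℝ} (ht : 0 ≤ t) :
    Tendsto (fun m => rootM t m) (𝓝[>] 0) (𝓝 (rootPlus t)) := by
  have hev : ∀ᶠ m : ℝ in 𝓝[>] 0, 0 < m ∧ m ≤ 1 := by
    filter_upwards [Ioc_mem_nhdsGT (zero_lt_one (α := ℝ))] with m hm using hm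
  refine isCompact_Icc.tendsto_nhds_of_unique_mapClusterPt (s := Icc (rootPlus t) 1) ?_ ?_
  · filter_upwards [hev] with m hm
    exact ⟨rootPlus_le_rootM ht hm.1 hm.2, (rootM_mem ht ⟨by linarith, hm.2⟩).2.1.2⟩
  · intro y hy hcl
    refine eq_rootPlus_of_cubic ht hy.1 ?_
    have hcl2 : MapClusterPt (y, (0 : ℝ)) (𝓝[>] 0) (fun m : ℝ => (rootM t m, m)) := by
      have h2 : Tendsto (fun m : ℝ => m) (𝓝[>] 0) (𝓝 0) :=
        tendsto_id.mono_left nhdsWithin_le_nhds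
      rw [mapClusterPt_iff_frequently] at hcl ⊢
      intro s hs'
      rw [nhds_prod_eq] at hs'
      obtain ⟨u, hu, v, hv, huv⟩ := Filter.mem_prod_iff.1 hs'
      exact ((hcl u hu).and_eventually (h2 hv)).mono fun p hp => huv ⟨hp.1, hp.2⟩
    have hclosed : IsClosed {q : ℝ × ℝ | cubic q.1 t q.2 = 0} := by
      refine isClosed_eq ?_ continuous_const
      unfold cubic
      fun_prop
    by_contra hc
    rw [mapClusterPt_iff_frequently] at hcl2
    refine hcl2 _ (hclosed.isOpen_compl.mem_nhds hc) ?_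
    filter_upwards [hev] with m hm
    simp [(rootM_mem ht ⟨by linarith, hm.2⟩).1]

theorem tendsto_Zstar_right {t : ℝ} (ht : 0 ≤ t) :
    Tendsto (fun m => Zstar t m) (𝓝[>] 0) (𝓝 (Zplus t)) := by
  have h := tendsto_rootM_right ht
  have h0 := rootPlus_nonneg t
  unfold Zstar Zplus
  have := ((h.const_mul 2).div ((h.abs.const_mul t).add_const 1)) (by positivity)
  rwa [abs_of_nonneg h0] at this

theorem tendsto_Zstar_left {t : ℝ} (ht : 0 ≤ t) :
    Tendsto (fun m => Zstar t m) (𝓝[<] 0) (𝓝 (-Zplus t)) := by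
  have h1 : Tendsto (fun m : ℝ => -m) (𝓝[<] 0) (𝓝[>] 0) := by
    simpa using tendsto_neg_nhdsLT (a := (0 : ℝ))
  refine (((tendsto_Zstar_right ht).comp h1).neg).congr' ?_
  filter_upwards [Ioo_mem_nhdsLT (show (-1 : ℝ) < 0 by norm_num)] with m hm
  simp only [Function.comp]
  rw [Zstar_neg ht ⟨by linarith [hm.1], by linarith [hm.2]⟩, neg_neg]

/-! ### Smoothness of `Z` off `m = 0` and the differential equation -/

/-- The derivative of the flux in `z`. -/
def fluxZ (m z : ℝ) : ℝ := m * |z| - z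

theorem isOpen_adm : IsOpen {p : ℝ × ℝ | -1 < p.1 ∧ 0 < p.2 ∧ p.2 < 1} :=
  (isOpen_lt continuous_const continuous_fst).inter
    ((isOpen_lt continuous_const continuous_snd).inter
      (isOpen_lt continuous_snd continuous_const))

theorem adm_of_lt {t m : ℝ} (h : -1 < t ∧ 0 < m ∧ m < 1) : Adm t m :=
  ⟨h.1, h.2.1, h.2.2.le, Or.inr h.2.2⟩

/-- Up to the factor `-(1 + t M)` this is the derivative in `M` of the left side of the equation.
For `t ≥ 0`, the product with `y = 1 + t M` is the derivative of `M q`, that is `q + M t (2 y - t)`,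
where `q > 0` and `y > t`. For `t < 0` it is at least `1 + t`. -/
theorem root_nondegenerate {t m M : ℝ} (h : Adm t m) (hM : 0 < M)
    (e : (1 - M) * (1 + t * M) ^ 2 = 1 - m) : 0 < 1 - 2 * t + 3 * t * M := by
  obtain ⟨hM1, hp⟩ := root_le_one h hM e
  obtain ⟨h1, h2, h3, h4⟩ := h
  rcases le_or_gt 0 t with ht | ht
  · have hg : m = M * ((1 + t * M) ^ 2 - t * (1 + t * M) - t) := by linear_combination e
    have hpos : 0 < (1 + t * M) ^ 2 - t * (1 + t * M) - t := by
      by_contra hc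
      push Not at hc
      nlinarith
    have hy : t < 1 + t * M := by
      by_contra hc
      push Not at hc
      nlinarith
    have : 0 < (1 + t * M) * (1 - 2 * t + 3 * t * M) := by
      have h5 : 0 ≤ M * t * (2 * (1 + t * M) - t) := by
        apply mul_nonneg (mul_nonneg hM.le ht)
        linarith
      nlinarith
    exact pos_of_mul_pos_right this hp.le
  · nlinarith

/-- The implicit function theorem gives a smooth local solution. It stays positive near the point,
so uniqueness of the positive root identifies it with `rootM`. -/
theorem contDiffAt_rootM {t m : ℝ} (h : -1 < t ∧ 0 < m ∧ m < 1) :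
    ContDiffAt ℝ ∞ (fun p : ℝ × ℝ => rootM p.1 p.2) (t, m) := by
  have ha := adm_of_lt h
  obtain ⟨e1, e2⟩ := rootM_spec_of_adm ha
  set M := rootM t m with hMdef
  set F : (ℝ × ℝ) × ℝ → ℝ := fun q => (1 - q.2) * (1 + q.1.1 * q.2) ^ 2 - (1 - q.1.2) with hF
  have hsm : ContDiffAt ℝ ∞ F ((t, m), M) := by
    rw [hF]
    fun_prop
  have hn : (∞ : WithTop ℕ∞) ≠ 0 := by simp
  have hd : HasDerivAt (fun x : ℝ => F ((t, m), x))
      (-((1 + t * M) * (1 - 2 * t + 3 * t * M))) M := by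
    have h1 : HasDerivAt (fun x : ℝ => 1 - x) (-1) M := (hasDerivAt_id M).const_sub 1
    have h2 : HasDerivAt (fun x : ℝ => 1 + t * x) t M := by
      simpa using ((hasDerivAt_id M).const_mul t).const_add 1
    have h3 := (h1.mul (h2.pow 2)).sub_const (1 - m)
    convert! h3 using 1
    simp only [Pi.pow_apply]
    push_cast
    ring
  have hD := root_nondegenerate ha e1 e2
  have hp := (root_le_one ha e1 e2).2
  have hlin : fderiv ℝ F ((t, m), M) ∘L ContinuousLinearMap.inr ℝ (ℝ × ℝ) ℝ
      = ((ContinuousLinearEquiv.unitsEquivAut ℝ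
        (Units.mk0 (-((1 + t * M) * (1 - 2 * t + 3 * t * M)))
          (neg_ne_zero.2 (mul_pos hp hD).ne')) : ℝ ≃L[ℝ] ℝ) : ℝ →L[ℝ] ℝ) := by
    have h1 : HasFDerivAt F (fderiv ℝ F ((t, m), M)) ((t, m), M) :=
      (hsm.differentiableAt hn).hasFDerivAt
    have h2 : HasFDerivAt (fun x : ℝ => ((t, m), x)) (ContinuousLinearMap.inr ℝ (ℝ × ℝ) ℝ) M :=
      hasFDerivAt_prodMk_right _ _
    have h3 := (h1.comp M h2).hasDerivAt.unique hd
    ext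
    simpa using h3
  have hinv : (fderiv ℝ F ((t, m), M) ∘L
      ContinuousLinearMap.inr ℝ (ℝ × ℝ) ℝ).IsInvertible := ⟨_, hlin.symm⟩
  have hc := hsm.contDiffAt_implicitFunction hn hinv
  refine hc.congr_of_eventuallyEq ?_
  have h0 := hsm.implicitFunction_apply_self hn hinv
  have hev := hsm.eventually_apply_implicitFunction hn hinv
  have hpos : ∀ᶠ p in 𝓝 (t, m), 0 < hsm.implicitFunction hn hinv p := by
    refine hc.continuousAt.eventually (lt_mem_nhds ?_)
    rw [show hsm.implicitFunction hn hinv (t, m) = M from h0]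
    exact e1
  filter_upwards [hev, hpos, isOpen_adm.mem_nhds h] with p hp1 hp2 hp3
  refine rootM_eq_of_adm (adm_of_lt hp3) hp2 ?_
  have : F ((t, m), M) = 0 := by simp only [hF]; linarith
  rw [this] at hp1
  simp only [hF] at hp1
  linarith

theorem contDiffAt_Zstar_pos {t m : ℝ} (h : -1 < t ∧ 0 < m ∧ m < 1) :
    ContDiffAt ℝ ∞ (fun p : ℝ × ℝ => Zstar p.1 p.2) (t, m) := by
  have ha := adm_of_lt h
  obtain ⟨e1, e2⟩ := rootM_spec_of_adm ha
  have hp := (root_le_one ha e1 e2).2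
  have hM := contDiffAt_rootM h
  have : ContDiffAt ℝ ∞ (fun p : ℝ × ℝ => 2 * rootM p.1 p.2 / (p.1 * rootM p.1 p.2 + 1)) (t, m) :=
    (contDiffAt_const.mul hM).div ((contDiffAt_fst.mul hM).add contDiffAt_const)
      (by rw [add_comm]; exact hp.ne')
  refine this.congr_of_eventuallyEq ?_
  filter_upwards [isOpen_adm.mem_nhds h] with p hp
  exact Zstar_of_adm (adm_of_lt hp)

theorem eventually_Zstar_neg {t m : ℝ} (h : -1 < t ∧ -1 < m ∧ m < 0) :
    (fun p : ℝ × ℝ => Zstar p.1 p.2) =ᶠ[𝓝 (t, m)] fun p => -Zstar p.1 (-p.2) := by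
  have hop : IsOpen {p : ℝ × ℝ | -1 < p.1 ∧ -1 < p.2 ∧ p.2 < 0} :=
    (isOpen_lt continuous_const continuous_fst).inter
      ((isOpen_lt continuous_const continuous_snd).inter
        (isOpen_lt continuous_snd continuous_const))
  filter_upwards [hop.mem_nhds h] with p hp
  have := Zstar_neg_of_adm (adm_of_lt (t := p.1) (m := -p.2)
    ⟨hp.1, by linarith [hp.2.2], by linarith [hp.2.1]⟩)
  rw [neg_neg] at this
  exact this

theorem contDiffAt_Zstar_neg {t m : ℝ} (h : -1 < t ∧ -1 < m ∧ m < 0) :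
    ContDiffAt ℝ ∞ (fun p : ℝ × ℝ => Zstar p.1 p.2) (t, m) := by
  have h1 : ContDiffAt ℝ ∞ (fun p : ℝ × ℝ => Zstar p.1 p.2) (t, -m) :=
    contDiffAt_Zstar_pos ⟨h.1, by linarith [h.2.2], by linarith [h.2.1]⟩
  have h2 : ContDiffAt ℝ ∞ (fun p : ℝ × ℝ => (p.1, -p.2)) (t, m) := by fun_prop
  have h3 : ContDiffAt ℝ ∞ (fun p : ℝ × ℝ => Zstar p.1 (-p.2)) (t, m) :=
    ContDiffAt.comp (t, m) (g := fun p : ℝ × ℝ => Zstar p.1 p.2) h1 h2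
  exact h3.neg.congr_of_eventuallyEq (eventually_Zstar_neg h)

theorem contDiffAt_Zstar {t m : ℝ} (ht : -1 < t) (hm : m ≠ 0) (h1 : -1 < m) (h2 : m < 1) :
    ContDiffAt ℝ ∞ (fun p : ℝ × ℝ => Zstar p.1 p.2) (t, m) := by
  rcases lt_or_gt_of_ne hm with h | h
  · exact contDiffAt_Zstar_neg ⟨ht, h1, h⟩
  · exact contDiffAt_Zstar_pos ⟨ht, h, h2⟩

theorem hasDerivAt_fst {f : ℝ × ℝ → ℝ} {p : ℝ × ℝ} (h : DifferentiableAt ℝ f p) :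
    HasDerivAt (fun t => f (t, p.2)) (dt f p) p.1 := by
  have : DifferentiableAt ℝ (fun t => f (t, p.2)) p.1 := by
    apply DifferentiableAt.comp p.1 (g := f) (f := fun t => (t, p.2)) h
    fun_prop
  exact this.hasDerivAt

theorem hasDerivAt_snd {f : ℝ × ℝ → ℝ} {p : ℝ × ℝ} (h : DifferentiableAt ℝ f p) :
    HasDerivAt (fun m => f (p.1, m)) (dm f p) p.2 := by
  have : DifferentiableAt ℝ (fun m => f (p.1, m)) p.2 := by
    apply DifferentiableAt.comp p.2 (g := f) (f := fun m => (p.1, m)) h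
    fun_prop
  exact this.hasDerivAt

theorem hasDerivAt_Zstar_of_root {f : ℝ → ℝ} {a t : ℝ} {y : ℝ → ℝ} {b : ℝ}
    (hf : HasDerivAt f a t) (hy : HasDerivAt y b t) (h0 : 0 < y t * f t + 1) :
    HasDerivAt (fun s => 2 * f s / (y s * f s + 1))
      ((2 * a - 2 * f t ^ 2 * b) / (y t * f t + 1) ^ 2) t := by
  have := (hf.const_mul 2).div ((hy.mul hf).add_const 1) h0.ne'
  convert! this using 1
  simp only [Pi.mul_apply]
  ring

/-- Implicit differentiation gives `M_t` and `M_m` explicitly; the term `-2 M²` in the derivative of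
`Z` in time cancels `Z² / 2`, and the rest cancels through `1 - m = (1 - M) (1 + t M)²`. -/
theorem Zstar_pde_pos {t m : ℝ} (h : -1 < t ∧ 0 < m ∧ m < 1) :
    dt (fun p : ℝ × ℝ => Zstar p.1 p.2) (t, m) + Zstar t m ^ 2 / 2
      - (1 - m) * Zstar t m * dm (fun p : ℝ × ℝ => Zstar p.1 p.2) (t, m) = 0 := by
  have ha := adm_of_lt h
  obtain ⟨e1, e2⟩ := rootM_spec_of_adm ha
  have hp := (root_le_one ha e1 e2).2
  have hp' : 0 < t * rootM t m + 1 := by linarith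
  have hD := root_nondegenerate ha e1 e2
  have hn : (∞ : WithTop ℕ∞) ≠ 0 := by simp
  have hM := (contDiffAt_rootM h).differentiableAt hn
  have hMt := hasDerivAt_fst hM
  have hMm := hasDerivAt_snd hM
  set a := dt (fun p : ℝ × ℝ => rootM p.1 p.2) (t, m)
  set b := dm (fun p : ℝ × ℝ => rootM p.1 p.2) (t, m)
  simp only at hMt hMm
  have evt : ∀ᶠ s in 𝓝 t, -1 < s ∧ 0 < m ∧ m < 1 := by
    filter_upwards [lt_mem_nhds h.1] with s hs using ⟨hs, h.2⟩
  have evm : ∀ᶠ s in 𝓝 m, -1 < t ∧ 0 < s ∧ s < 1 := by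
    filter_upwards [lt_mem_nhds h.2.1, gt_mem_nhds h.2.2] with s hs hs' using ⟨h.1, hs, hs'⟩
  have hZt : dt (fun p : ℝ × ℝ => Zstar p.1 p.2) (t, m)
      = (2 * a - 2 * rootM t m ^ 2 * 1) / (t * rootM t m + 1) ^ 2 := by
    refine HasDerivAt.deriv (HasDerivAt.congr_of_eventuallyEq
      (hasDerivAt_Zstar_of_root hMt (hasDerivAt_id t) hp') ?_)
    filter_upwards [evt] with s hs using Zstar_of_adm (adm_of_lt hs)
  have hZm : dm (fun p : ℝ × ℝ => Zstar p.1 p.2) (t, m)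
      = (2 * b - 2 * rootM t m ^ 2 * 0) / (t * rootM t m + 1) ^ 2 := by
    refine HasDerivAt.deriv (HasDerivAt.congr_of_eventuallyEq
      (hasDerivAt_Zstar_of_root hMm (hasDerivAt_const m t) hp') ?_)
    filter_upwards [evm] with s hs using Zstar_of_adm (adm_of_lt hs)
  have eqt : -a * (1 + t * rootM t m) ^ 2
      + (1 - rootM t m) * (2 * (1 + t * rootM t m) * (rootM t m + t * a)) = 0 := by
    have h1 := (hMt.const_sub 1).mul ((((hasDerivAt_id t).mul hMt).const_add 1).pow 2)
    have h2 : HasDerivAt (fun s : ℝ => 1 - m) 0 t := hasDerivAt_const _ _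
    have h3 := h2.congr_of_eventuallyEq (f₁ := fun s => (1 - rootM s m) * (1 + s * rootM s m) ^ 2)
      (by filter_upwards [evt] with s hs using (rootM_spec_of_adm (adm_of_lt hs)).2)
    have h4 := h3.unique h1
    simp only [Pi.mul_apply, Pi.pow_apply, id] at h4
    rw [h4]
    push_cast
    ring
  have eqm : -b * (1 + t * rootM t m) ^ 2
      + (1 - rootM t m) * (2 * (1 + t * rootM t m) * (t * b)) = -1 := by
    have h1 := (hMm.const_sub 1).mul (((hMm.const_mul t).const_add 1).pow 2)
    have h2 : HasDerivAt (fun s : ℝ => 1 - s) (-1) m := (hasDerivAt_id m).const_sub 1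
    have h3 := h2.congr_of_eventuallyEq (f₁ := fun s => (1 - rootM t s) * (1 + t * rootM t s) ^ 2)
      (by filter_upwards [evm] with s hs using (rootM_spec_of_adm (adm_of_lt hs)).2)
    have h4 := h3.unique h1
    simp only [Pi.pow_apply] at h4
    rw [h4]
    push_cast
    ring
  rw [hZt, hZm, Zstar_of_adm ha, ← e2]
  set M := rootM t m
  have ha' : a = 2 * (1 - M) * M / (1 - 2 * t + 3 * t * M) := by
    rw [eq_div_iff hD.ne']
    have : (1 + t * M) * (a * (1 - 2 * t + 3 * t * M) - 2 * (1 - M) * M) = 0 := by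
      linear_combination -eqt
    linarith [(mul_eq_zero.1 this).resolve_left hp.ne']
  have hb' : b = 1 / ((1 + t * M) * (1 - 2 * t + 3 * t * M)) := by
    rw [eq_div_iff (mul_pos hp hD).ne']
    linear_combination -eqm
  rw [ha', hb']
  have h1 := hp.ne'
  have h2 := hp'.ne'
  have h3 := hD.ne'
  rw [show t * M + 1 = 1 + t * M by ring]
  -- The remaining identity is rational and holds with `D` and `y` treated as free variables.
  generalize 1 - 2 * t + 3 * t * M = D at *
  generalize 1 + t * M = y at *
  field_simp
  ring

theorem Zstar_pde {t m : ℝ} (ht : -1 < t) (hm : m ≠ 0) (h1 : -1 < m) (h2 : m < 1) :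
    dt (fun p : ℝ × ℝ => Zstar p.1 p.2) (t, m) + Zstar t m * |Zstar t m| / 2
      + fluxZ m (Zstar t m) * dm (fun p : ℝ × ℝ => Zstar p.1 p.2) (t, m) = 0 := by
  rcases lt_or_gt_of_ne hm with h | h
  · have hh : -1 < t ∧ 0 < -m ∧ -m < 1 := ⟨ht, by linarith, by linarith⟩
    have hz := Zstar_pde_pos hh
    have ha := adm_of_lt hh
    have hpos := Zstar_pos ha
    have hneg := Zstar_neg_of_adm ha
    rw [neg_neg] at hneg
    have hev := eventually_Zstar_neg ⟨ht, h1, h⟩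
    have hn : (∞ : WithTop ℕ∞) ≠ 0 := by simp
    have hdiff := (contDiffAt_Zstar_pos hh).differentiableAt hn
    have hT : dt (fun p : ℝ × ℝ => Zstar p.1 p.2) (t, m)
        = -dt (fun p : ℝ × ℝ => Zstar p.1 p.2) (t, -m) := by
      refine HasDerivAt.deriv (HasDerivAt.congr_of_eventuallyEq (hasDerivAt_fst hdiff).neg ?_)
      have hc : ContinuousAt (fun s : ℝ => (s, m)) t := by fun_prop
      exact hc.eventually hev
    have hM : dm (fun p : ℝ × ℝ => Zstar p.1 p.2) (t, m)
        = dm (fun p : ℝ × ℝ => Zstar p.1 p.2) (t, -m) := by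
      have hd := hasDerivAt_snd hdiff
      have hd2 := (HasDerivAt.scomp m hd (hasDerivAt_neg m)).neg
      rw [show -((-1 : ℝ) • dm (fun p : ℝ × ℝ => Zstar p.1 p.2) (t, -m))
        = dm (fun p : ℝ × ℝ => Zstar p.1 p.2) (t, -m) by simp] at hd2
      refine HasDerivAt.deriv (HasDerivAt.congr_of_eventuallyEq hd2 ?_)
      have hc : ContinuousAt (fun s : ℝ => (t, s)) m := by fun_prop
      exact hc.eventually hev
    rw [hT, hM, hneg, abs_neg, abs_of_pos hpos, fluxZ, abs_neg, abs_of_pos hpos]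
    linear_combination -hz
  · have hh : -1 < t ∧ 0 < m ∧ m < 1 := ⟨ht, h, h2⟩
    have hz := Zstar_pde_pos hh
    have hpos := Zstar_pos (adm_of_lt hh)
    rw [abs_of_pos hpos, fluxZ, abs_of_pos hpos]
    linear_combination hz

/-! ### The flux and Kruzhkov's entropy flux -/

/-- Kruzhkov's entropy flux. -/
def kflux (m w k : ℝ) : ℝ := Real.sign (w - k) * (flux m w - flux m k)

theorem kflux_comm (m w k : ℝ) : kflux m w k = kflux m k w := by
  unfold kflux
  rw [← neg_sub k w, Real.sign_neg]
  ring

theorem abs_sign_le (x : ℝ) : |Real.sign x| ≤ 1 := by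
  rcases Real.sign_apply_eq x with h | h | h <;> rw [h] <;> norm_num

theorem measurable_sign : Measurable Real.sign := by
  unfold Real.sign
  exact Measurable.ite measurableSet_Iio measurable_const
    (Measurable.ite measurableSet_Ioi measurable_const measurable_const)

theorem continuous_flux : Continuous fun q : ℝ × ℝ => flux q.1 q.2 := by
  unfold flux
  fun_prop

theorem measurable_kflux : Measurable fun q : ℝ × ℝ × ℝ => kflux q.1 q.2.1 q.2.2 := by
  unfold kflux flux
  refine Measurable.mul (measurable_sign.comp (by fun_prop)) (by fun_prop)

theorem abs_mul_abs_sub_le {w k B : ℝ} (hw : |w| ≤ B) (hk : |k| ≤ B) :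
    |(w * |w| - k * |k|)| ≤ 2 * B * |w - k| := by
  have e : w * |w| - k * |k| = (w - k) * |w| + k * (|w| - |k|) := by ring
  rw [e]
  have hB : 0 ≤ B := (abs_nonneg w).trans hw
  have h1 : abs ((w - k) * |w|) ≤ |w - k| * B := by
    rw [abs_mul, abs_abs]
    exact mul_le_mul_of_nonneg_left hw (abs_nonneg _)
  have h2 : abs (k * (|w| - |k|)) ≤ B * |w - k| := by
    rw [abs_mul]
    exact mul_le_mul hk (abs_abs_sub_abs_le w k) (abs_nonneg _) hB
  linarith [abs_add_le ((w - k) * |w|) (k * (|w| - |k|))]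

theorem abs_flux_sub_le {m w k B : ℝ} (hm : |m| ≤ 1) (hw : |w| ≤ B) (hk : |k| ≤ B) :
    |flux m w - flux m k| ≤ 2 * B * |w - k| := by
  have e : flux m w - flux m k = m * (w * |w| - k * |k|) / 2 - (w + k) * (w - k) / 2 := by
    unfold flux
    ring
  have h1 : |m * (w * |w| - k * |k|)| ≤ 1 * (2 * B * |w - k|) := by
    rw [abs_mul]
    exact mul_le_mul hm (abs_mul_abs_sub_le hw hk) (abs_nonneg _) zero_le_one
  have h2 : |(w + k) * (w - k)| ≤ (B + B) * |w - k| := by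
    rw [abs_mul]
    gcongr
    exact (abs_add_le _ _).trans (add_le_add hw hk)
  rw [e]
  rw [abs_le] at h1 h2 ⊢
  constructor <;> linarith [h1.1, h1.2, h2.1, h2.2]

theorem abs_kflux_le {m w k B : ℝ} (hm : |m| ≤ 1) (hw : |w| ≤ B) (hk : |k| ≤ B) :
    |kflux m w k| ≤ 2 * B * |w - k| := by
  rw [kflux, abs_mul]
  calc _ ≤ 1 * |flux m w - flux m k| := by
        gcongr
        exact abs_sign_le _
    _ ≤ _ := by rw [one_mul]; exact abs_flux_sub_le hm hw hk

theorem abs_kflux_le_sq {m w k B : ℝ} (hm : |m| ≤ 1) (hw : |w| ≤ B) (hk : |k| ≤ B) :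
    |kflux m w k| ≤ 4 * B ^ 2 := by
  refine (abs_kflux_le hm hw hk).trans ?_
  have hB : 0 ≤ B := (abs_nonneg _).trans hw
  have : |w - k| ≤ 2 * B := by
    rw [abs_le] at hw hk ⊢
    constructor <;> linarith [hw.1, hw.2, hk.1, hk.2]
  nlinarith

/-- The sign factor does no harm: if `w` lies between `k` and `k'`, both fluxes are controlled by
the distance to `w`, and the distances add up to `|k - k'|`; otherwise the two signs agree. -/
theorem abs_kflux_sub_le {m w k k' B : ℝ} (hm : |m| ≤ 1) (hw : |w| ≤ B) (hk : |k| ≤ B)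
    (hk' : |k'| ≤ B) : |kflux m w k - kflux m w k'| ≤ 2 * B * |k - k'| := by
  have hB : 0 ≤ B := (abs_nonneg _).trans hw
  have hmid : (k ≤ w ∧ w ≤ k') ∨ (k' ≤ w ∧ w ≤ k) →
      |kflux m w k - kflux m w k'| ≤ 2 * B * |k - k'| := by
    intro h
    calc |kflux m w k - kflux m w k'| ≤ |kflux m w k| + |kflux m w k'| := abs_sub _ _
      _ ≤ 2 * B * |w - k| + 2 * B * |w - k'| :=
        add_le_add (abs_kflux_le hm hw hk) (abs_kflux_le hm hw hk')
      _ = 2 * B * |k - k'| := by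
        rcases h with ⟨h1, h2⟩ | ⟨h1, h2⟩
        · rw [abs_of_nonneg (show 0 ≤ w - k by linarith),
            abs_of_nonpos (show w - k' ≤ 0 by linarith),
            abs_of_nonpos (show k - k' ≤ 0 by linarith)]
          ring
        · rw [abs_of_nonpos (show w - k ≤ 0 by linarith),
            abs_of_nonneg (show 0 ≤ w - k' by linarith),
            abs_of_nonneg (show 0 ≤ k - k' by linarith)]
          ring
  rcases le_or_gt k w with h1 | h1 <;> rcases le_or_gt k' w with h2 | h2
  · rcases eq_or_lt_of_le h1 with e1 | e1
    · exact hmid (Or.inr ⟨h2, e1.ge⟩)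
    rcases eq_or_lt_of_le h2 with e2 | e2
    · exact hmid (Or.inl ⟨h1, e2.ge⟩)
    rw [kflux, kflux, Real.sign_of_pos (by linarith), Real.sign_of_pos (by linarith)]
    rw [show 1 * (flux m w - flux m k) - 1 * (flux m w - flux m k')
      = -(flux m k - flux m k') by ring, abs_neg]
    exact abs_flux_sub_le hm hk hk'
  · exact hmid (Or.inl ⟨h1, h2.le⟩)
  · exact hmid (Or.inr ⟨h2, h1.le⟩)
  · rw [kflux, kflux, Real.sign_of_neg (by linarith), Real.sign_of_neg (by linarith)]
    rw [show -1 * (flux m w - flux m k) - -1 * (flux m w - flux m k')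
      = flux m k - flux m k' by ring]
    exact abs_flux_sub_le hm hk hk'

theorem abs_kflux_sub_le' {m m' w k B : ℝ} (hw : |w| ≤ B) (hk : |k| ≤ B) :
    |kflux m w k - kflux m' w k| ≤ B ^ 2 * |m - m'| := by
  have e : kflux m w k - kflux m' w k
      = Real.sign (w - k) * ((m - m') * (w * |w| / 2 - k * |k| / 2)) := by
    unfold kflux flux
    ring
  have hb : ∀ z : ℝ, |z| ≤ B → |(z * |z|)| ≤ B ^ 2 := by
    intro z hz
    rw [abs_mul, abs_abs, sq]
    exact mul_self_le_mul_self (abs_nonneg _) hz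
  have h3 : |w * |w| / 2 - k * |k| / 2| ≤ B ^ 2 := by
    have h1 := abs_le.1 (hb w hw)
    have h2 := abs_le.1 (hb k hk)
    rw [abs_le]
    constructor <;> linarith [h1.1, h1.2, h2.1, h2.2]
  rw [e, abs_mul, abs_mul]
  calc _ ≤ 1 * (|m - m'| * B ^ 2) := by
        gcongr
        exact abs_sign_le _
    _ = _ := by ring

/-- The entropy condition of the shock from `-z` to `z`. At `m = 0` the flux is `-z² / 2`, so both
sides have the same flux difference `(z² - w²) / 2`, multiplied by `sgn (w - z) ≤ sgn (w + z)`; the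
signs differ only for `|w| ≤ z`, where that difference is nonnegative. It serves both existence and
uniqueness. -/
theorem kflux_zero_left_le {w z : ℝ} (hz : 0 ≤ z) : kflux 0 w z ≤ kflux 0 w (-z) := by
  unfold kflux flux
  rcases lt_trichotomy w z with h | h | h <;> rcases lt_trichotomy w (-z) with h' | h' | h'
  all_goals
    first
      | rw [Real.sign_of_neg (show w - z < 0 by linarith)]
      | rw [Real.sign_of_pos (show 0 < w - z by linarith)]
      | rw [show w - z = 0 by linarith, Real.sign_zero]
    first
      | rw [Real.sign_of_neg (show w - -z < 0 by linarith)]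
      | rw [Real.sign_of_pos (show 0 < w - -z by linarith)]
      | rw [show w - -z = 0 by linarith, Real.sign_zero]
    nlinarith

/-- Equivalently, `z |z| + z²` and `z |z| - z²` are nondecreasing: the flux at `m = 1` is
nondecreasing and at `m = -1` nonincreasing. This outward transport is why no boundary condition is
needed. -/
theorem sq_sub_le_mul_abs {k w : ℝ} (h : k ≤ w) : |w ^ 2 - k ^ 2| ≤ w * |w| - k * |k| := by
  rw [abs_le]
  rcases le_total 0 k with h1 | h1 <;> rcases le_total 0 w with h2 | h2
  · rw [abs_of_nonneg h1, abs_of_nonneg h2]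
    constructor <;> nlinarith
  · rw [abs_of_nonneg h1, abs_of_nonpos h2]
    constructor <;> nlinarith
  · rw [abs_of_nonpos h1, abs_of_nonneg h2]
    constructor <;> nlinarith
  · rw [abs_of_nonpos h1, abs_of_nonpos h2]
    constructor <;> nlinarith

theorem kflux_one_nonneg (w k : ℝ) : 0 ≤ kflux 1 w k := by
  unfold kflux flux
  rcases lt_trichotomy w k with h | h | h
  · rw [Real.sign_of_neg (by linarith)]
    have := abs_le.1 (sq_sub_le_mul_abs h.le)
    linarith [this.1, this.2]
  · rw [h, sub_self, Real.sign_zero, zero_mul]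
  · rw [Real.sign_of_pos (by linarith)]
    have := abs_le.1 (sq_sub_le_mul_abs h.le)
    linarith [this.1, this.2]

theorem kflux_neg_one_nonpos (w k : ℝ) : kflux (-1) w k ≤ 0 := by
  unfold kflux flux
  rcases lt_trichotomy w k with h | h | h
  · rw [Real.sign_of_neg (by linarith)]
    have := abs_le.1 (sq_sub_le_mul_abs h.le)
    linarith [this.1, this.2]
  · rw [h, sub_self, Real.sign_zero, zero_mul]
  · rw [Real.sign_of_pos (by linarith)]
    have := abs_le.1 (sq_sub_le_mul_abs h.le)
    linarith [this.1, this.2]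

theorem hasDerivAt_mul_abs (z : ℝ) : HasDerivAt (fun z : ℝ => z * |z|) (2 * |z|) z := by
  rcases eq_or_ne z 0 with rfl | h
  · rw [hasDerivAt_iff_isLittleO_nhds_zero]
    simp only [zero_add, abs_zero, mul_zero, sub_zero, smul_zero]
    have h1 : (fun h : ℝ => |h|) =o[𝓝 0] fun _ => (1 : ℝ) := by
      rw [Asymptotics.isLittleO_one_iff]
      simpa using (continuous_abs.tendsto (0 : ℝ))
    simpa using (Asymptotics.isBigO_refl (fun h : ℝ => h) (𝓝 0)).mul_isLittleO h1
  · have := (hasDerivAt_id z).mul (hasDerivAt_abs h)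
    convert! this using 1
    rcases lt_or_gt_of_ne h with h | h
    · simp [abs_of_neg h, h]
      ring
    · simp [abs_of_pos h, h]
      ring

theorem hasDerivAt_flux (m z : ℝ) : HasDerivAt (fun z => flux m z) (fluxZ m z) z := by
  unfold flux fluxZ
  have := (((hasDerivAt_mul_abs z).div_const 2).const_mul m).sub
    (((hasDerivAt_id z).pow 2).div_const 2)
  convert! this using 1
  simp

theorem hasDerivAt_flux_left (m k : ℝ) : HasDerivAt (fun m => flux m k) (k * |k| / 2) m := by
  unfold flux
  simpa using ((hasDerivAt_id m).mul_const (k * |k| / 2)).sub_const (k ^ 2 / 2)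

theorem deriv_flux_left (m k : ℝ) : deriv (fun m => flux m k) m = k * |k| / 2 :=
  (hasDerivAt_flux_left m k).deriv

/-! ### Cut-off functions -/

/-- A smooth transition from `0` on `x ≤ 1` to `1` on `x ≥ 2`. -/
def kap (x : ℝ) : ℝ := Real.smoothTransition (x - 1)

theorem contDiff_kap : ContDiff ℝ ∞ kap := by
  unfold kap
  exact Real.smoothTransition.contDiff.comp (contDiff_id.sub contDiff_const)

theorem kap_of_le {x : ℝ} (h : x ≤ 1) : kap x = 0 :=
  Real.smoothTransition.zero_of_nonpos (by linarith)

theorem kap_of_ge {x : ℝ} (h : 2 ≤ x) : kap x = 1 :=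
  Real.smoothTransition.one_of_one_le (by linarith)

theorem kap_nonneg (x : ℝ) : 0 ≤ kap x := Real.smoothTransition.nonneg _

theorem kap_le_one (x : ℝ) : kap x ≤ 1 := Real.smoothTransition.le_one _

theorem monotone_kap : Monotone kap := fun _ _ h =>
  Real.smoothTransition.monotone (sub_le_sub_right h 1)

theorem hasDerivAt_kap (x : ℝ) : HasDerivAt kap (deriv kap x) x :=
  ((contDiff_kap.differentiable (by simp)) x).hasDerivAt

theorem continuous_deriv_kap : Continuous (deriv kap) :=
  contDiff_kap.continuous_deriv (by simp)

theorem deriv_kap_nonneg (x : ℝ) : 0 ≤ deriv kap x := monotone_kap.deriv_nonneg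

theorem deriv_kap_of_lt {x : ℝ} (h : x < 1) : deriv kap x = 0 := by
  have : kap =ᶠ[𝓝 x] fun _ => (0 : ℝ) := by
    filter_upwards [gt_mem_nhds h] with y hy using kap_of_le hy.le
  rw [this.deriv_eq, deriv_const]

theorem deriv_kap_of_gt {x : ℝ} (h : 2 < x) : deriv kap x = 0 := by
  have : kap =ᶠ[𝓝 x] fun _ => (1 : ℝ) := by
    filter_upwards [lt_mem_nhds h] with y hy using kap_of_ge hy.le
  rw [this.deriv_eq, deriv_const]

theorem deriv_kap_of_notMem {x : ℝ} (h : x ∉ Icc (1 : ℝ) 2) : deriv kap x = 0 := by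
  rcases lt_or_ge x 1 with h1 | h1
  · exact deriv_kap_of_lt h1
  · exact deriv_kap_of_gt (lt_of_not_ge fun h2 => h ⟨h1, h2⟩)

theorem exists_deriv_kap_le : ∃ K : ℝ, 0 < K ∧ ∀ x, deriv kap x ≤ K := by
  obtain ⟨K, hK⟩ := isCompact_Icc.exists_bound_of_continuousOn (s := Icc (1 : ℝ) 2)
    continuous_deriv_kap.continuousOn
  refine ⟨|K| + 1, by positivity, fun x => ?_⟩
  by_cases hx : x ∈ Icc (1 : ℝ) 2
  · have := (le_abs_self _).trans (hK x hx)
    linarith [le_abs_self K]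
  · rw [deriv_kap_of_notMem hx]
    positivity

theorem hasDerivAt_kap_div (c d m : ℝ) :
    HasDerivAt (fun m => kap (c * m / d)) (deriv kap (c * m / d) * (c / d)) m := by
  have h1 : HasDerivAt (fun m : ℝ => c * m / d) (c / d) m := by
    simpa using ((hasDerivAt_id m).const_mul c).div_const d
  exact (hasDerivAt_kap _).comp m h1

/-- The sum of the two one-sided cut-off functions, vanishing for `|m| ≤ d`. -/
def off (d m : ℝ) : ℝ := kap (1 * m / d) + kap (-1 * m / d)

theorem contDiff_off (d : ℝ) : ContDiff ℝ ∞ (off d) := by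
  unfold off
  exact (contDiff_kap.comp ((contDiff_const.mul contDiff_id).div_const d)).add
    (contDiff_kap.comp ((contDiff_const.mul contDiff_id).div_const d))

theorem hasDerivAt_off (d m : ℝ) : HasDerivAt (off d)
    (deriv kap (1 * m / d) * (1 / d) + deriv kap (-1 * m / d) * (-1 / d)) m :=
  (hasDerivAt_kap_div 1 d m).add (hasDerivAt_kap_div (-1) d m)

theorem off_of_le {d m : ℝ} (hd : 0 < d) (h : |m| ≤ d) : off d m = 0 := by
  have := abs_le.1 h
  rw [off, kap_of_le, kap_of_le, add_zero]
  · rw [div_le_one hd]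
    linarith
  · rw [div_le_one hd]
    linarith

theorem off_of_ge {d m : ℝ} (hd : 0 < d) (h : 2 * d ≤ |m|) : off d m = 1 := by
  rcases le_total 0 m with h1 | h1
  · rw [abs_of_nonneg h1] at h
    rw [off, kap_of_ge, kap_of_le, add_zero]
    · rw [div_le_one hd]
      linarith
    · rw [le_div_iff₀ hd]
      linarith
  · rw [abs_of_nonpos h1] at h
    rw [off, kap_of_le, kap_of_ge, zero_add]
    · rw [le_div_iff₀ hd]
      linarith
    · rw [div_le_one hd]
      linarith

theorem off_mem {d : ℝ} (hd : 0 < d) (m : ℝ) : off d m ∈ Icc (0 : ℝ) 1 := by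
  rcases le_total 0 m with h1 | h1
  · have : kap (-1 * m / d) = 0 := kap_of_le (by rw [div_le_one hd]; linarith)
    rw [off, this, add_zero]
    exact ⟨kap_nonneg _, kap_le_one _⟩
  · have : kap (1 * m / d) = 0 := kap_of_le (by rw [div_le_one hd]; linarith)
    rw [off, this, zero_add]
    exact ⟨kap_nonneg _, kap_le_one _⟩

theorem tendsto_off {m : ℝ} (hm : m ≠ 0) : Tendsto (fun d => off d m) (𝓝[>] 0) (𝓝 1) := by
  refine tendsto_const_nhds.congr' ?_
  have : 0 < |m| / 2 := by positivity
  filter_upwards [Ioc_mem_nhdsGT this] with d hd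
  exact (off_of_ge hd.1 (by linarith [hd.2])).symm

/-! ### Partial derivatives and Green's formula -/

theorem dt_eq_fderiv {f : ℝ × ℝ → ℝ} {p : ℝ × ℝ} (h : DifferentiableAt ℝ f p) :
    dt f p = fderiv ℝ f p (1, 0) := by
  have h1 : HasFDerivAt (fun t : ℝ => (t, p.2)) (ContinuousLinearMap.inl ℝ ℝ ℝ) p.1 :=
    hasFDerivAt_prodMk_left _ _
  rw [dt]
  have h2 := (HasFDerivAt.comp p.1 (g := f) (f := fun t : ℝ => (t, p.2))
    h.hasFDerivAt h1).hasDerivAt.deriv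
  simpa [Function.comp_def] using h2

theorem dm_eq_fderiv {f : ℝ × ℝ → ℝ} {p : ℝ × ℝ} (h : DifferentiableAt ℝ f p) :
    dm f p = fderiv ℝ f p (0, 1) := by
  have h1 : HasFDerivAt (fun t : ℝ => (p.1, t)) (ContinuousLinearMap.inr ℝ ℝ ℝ) p.2 :=
    hasFDerivAt_prodMk_right _ _
  rw [dm]
  have h2 := (HasFDerivAt.comp p.2 (g := f) (f := fun t : ℝ => (p.1, t))
    h.hasFDerivAt h1).hasDerivAt.deriv
  simpa [Function.comp_def] using h2

theorem continuous_dt {f : ℝ × ℝ → ℝ} (h : ContDiff ℝ 1 f) : Continuous (dt f) := by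
  have e : dt f = fun p => fderiv ℝ f p (1, 0) :=
    funext fun p => dt_eq_fderiv (h.differentiable one_ne_zero p)
  rw [e]
  exact (h.continuous_fderiv one_ne_zero).clm_apply continuous_const

theorem continuous_dm {f : ℝ × ℝ → ℝ} (h : ContDiff ℝ 1 f) : Continuous (dm f) := by
  have e : dm f = fun p => fderiv ℝ f p (0, 1) :=
    funext fun p => dm_eq_fderiv (h.differentiable one_ne_zero p)
  rw [e]
  exact (h.continuous_fderiv one_ne_zero).clm_apply continuous_const

theorem dt_eq_zero_of_notMem {f : ℝ × ℝ → ℝ} {p : ℝ × ℝ} (h : p ∉ tsupport f) : dt f p = 0 := by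
  have h1 : f =ᶠ[𝓝 p] 0 := notMem_tsupport_iff_eventuallyEq.1 h
  have hc : ContinuousAt (fun s : ℝ => (s, p.2)) p.1 := by fun_prop
  have h2 : (fun t => f (t, p.2)) =ᶠ[𝓝 p.1] fun _ => 0 := hc.eventually h1
  rw [dt, h2.deriv_eq, deriv_const]

theorem dm_eq_zero_of_notMem {f : ℝ × ℝ → ℝ} {p : ℝ × ℝ} (h : p ∉ tsupport f) : dm f p = 0 := by
  have h1 : f =ᶠ[𝓝 p] 0 := notMem_tsupport_iff_eventuallyEq.1 h
  have hc : ContinuousAt (fun s : ℝ => (p.1, s)) p.2 := by fun_prop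
  have h2 : (fun t => f (p.1, t)) =ᶠ[𝓝 p.2] fun _ => 0 := hc.eventually h1
  rw [dm, h2.deriv_eq, deriv_const]

theorem exists_abs_le_of_hasCompactSupport {f : ℝ × ℝ → ℝ} (hf : Continuous f)
    (hc : HasCompactSupport f) : ∃ C : ℝ, 0 ≤ C ∧ ∀ p, |f p| ≤ C := by
  obtain ⟨C, hC⟩ := hc.exists_bound_of_continuous hf
  exact ⟨C, (norm_nonneg _).trans (hC (0, 0)), hC⟩

theorem hasCompactSupport_dt {f : ℝ × ℝ → ℝ} (hc : HasCompactSupport f) :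
    HasCompactSupport (dt f) :=
  HasCompactSupport.intro hc fun _ hp => dt_eq_zero_of_notMem hp

theorem hasCompactSupport_dm {f : ℝ × ℝ → ℝ} (hc : HasCompactSupport f) :
    HasCompactSupport (dm f) :=
  HasCompactSupport.intro hc fun _ hp => dm_eq_zero_of_notMem hp

theorem measurableSet_domain (T : ℝ) : MeasurableSet (domain T) :=
  measurableSet_Ioo.prod measurableSet_Ioo

theorem domain_subset (T : ℝ) : domain T ⊆ Icc 0 T ×ˢ Icc (-1) 1 :=
  prod_mono Ioo_subset_Icc_self Ioo_subset_Icc_self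

instance isFiniteMeasure_domain (T : ℝ) :
    IsFiniteMeasure ((volume : Measure (ℝ × ℝ)).restrict (domain T)) := by
  refine ⟨?_⟩
  rw [Measure.restrict_apply_univ]
  exact (measure_mono (domain_subset T)).trans_lt
    (isCompact_Icc.prod isCompact_Icc).measure_lt_top

theorem integrableOn_domain_of_continuous {f : ℝ × ℝ → ℝ} (hf : Continuous f) (T : ℝ) :
    IntegrableOn f (domain T) :=
  (hf.continuousOn.integrableOn_compact (isCompact_Icc.prod isCompact_Icc)).mono_set
    (domain_subset T)

theorem integrableOn_domain_of_bdd {f : ℝ × ℝ → ℝ} {T C : ℝ} (hf : Measurable f)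
    (hC : ∀ p ∈ domain T, |f p| ≤ C) : IntegrableOn f (domain T) :=
  Integrable.of_bound hf.aestronglyMeasurable C
    ((ae_restrict_iff' (measurableSet_domain T)).2 (ae_of_all _ hC))

theorem setIntegral_domain {f : ℝ × ℝ → ℝ} {T : ℝ} (hf : IntegrableOn f (domain T)) :
    ∫ p in domain T, f p = ∫ t in Ioo 0 T, ∫ m in Ioo (-1 : ℝ) 1, f (t, m) :=
  setIntegral_prod f hf

theorem setIntegral_domain_symm {f : ℝ × ℝ → ℝ} {T : ℝ} (hf : IntegrableOn f (domain T)) :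
    ∫ p in domain T, f p = ∫ m in Ioo (-1 : ℝ) 1, ∫ t in Ioo 0 T, f (t, m) := by
  rw [setIntegral_domain hf]
  refine integral_integral_swap (f := fun t m => f (t, m)) ?_
  rw [Measure.prod_restrict]
  exact hf

/-- The fundamental theorem of calculus in each variable. The supports avoid `t = T` and `m = ±1`,
so only the face `t = 0` contributes. -/
theorem green {Ψ₁ Ψ₂ : ℝ × ℝ → ℝ} {T : ℝ} (hT : 0 < T) (h₁ : ContDiff ℝ 1 Ψ₁)
    (h₂ : ContDiff ℝ 1 Ψ₂) (s₁ : tsupport Ψ₁ ⊆ Iio T ×ˢ Ioo (-1) 1)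
    (s₂ : tsupport Ψ₂ ⊆ Iio T ×ˢ Ioo (-1) 1) :
    (∫ p in domain T, (dt Ψ₁ p + dm Ψ₂ p)) + ∫ m in Ioo (-1 : ℝ) 1, Ψ₁ (0, m) = 0 := by
  have c₁ := continuous_dt h₁
  have c₂ := continuous_dm h₂
  have z₁ : ∀ m, Ψ₁ (T, m) = 0 := fun m =>
    image_eq_zero_of_notMem_tsupport fun h => lt_irrefl T (s₁ h).1
  have z₂ : ∀ t, Ψ₂ (t, 1) = 0 := fun m =>
    image_eq_zero_of_notMem_tsupport fun h => lt_irrefl (1 : ℝ) (s₂ h).2.2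
  have z₃ : ∀ t, Ψ₂ (t, -1) = 0 := fun m =>
    image_eq_zero_of_notMem_tsupport fun h => lt_irrefl (-1 : ℝ) (s₂ h).2.1
  have i₁ : ∀ m, ∫ t in Ioo 0 T, dt Ψ₁ (t, m) = -Ψ₁ (0, m) := by
    intro m
    rw [← integral_Ioc_eq_integral_Ioo, ← intervalIntegral.integral_of_le hT.le,
      intervalIntegral.integral_eq_sub_of_hasDerivAt (f := fun t => Ψ₁ (t, m)), z₁, zero_sub]
    · intro t _
      exact hasDerivAt_fst (p := (t, m)) (h₁.differentiable one_ne_zero _)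
    · exact (c₁.comp (by fun_prop)).intervalIntegrable _ _
  have i₂ : ∀ t, ∫ m in Ioo (-1 : ℝ) 1, dm Ψ₂ (t, m) = 0 := by
    intro t
    rw [← integral_Ioc_eq_integral_Ioo, ← intervalIntegral.integral_of_le (by norm_num),
      intervalIntegral.integral_eq_sub_of_hasDerivAt (f := fun m => Ψ₂ (t, m)), z₂, z₃, sub_zero]
    · intro m _
      exact hasDerivAt_snd (p := (t, m)) (h₂.differentiable one_ne_zero _)
    · exact (c₂.comp (by fun_prop)).intervalIntegrable _ _
  rw [integral_add (integrableOn_domain_of_continuous c₁ T)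
    (integrableOn_domain_of_continuous c₂ T),
    setIntegral_domain_symm (integrableOn_domain_of_continuous c₁ T),
    setIntegral_domain (integrableOn_domain_of_continuous c₂ T)]
  simp only [i₁, i₂, integral_zero, add_zero, integral_neg]
  ring

/-- Makes products of a test function with `Z` globally smooth although `Z` is smooth only off `m =
0`. -/
theorem contDiff_of_tsupport {f : ℝ × ℝ → ℝ} {n : WithTop ℕ∞}
    (h : ∀ p ∈ tsupport f, ContDiffAt ℝ n f p) : ContDiff ℝ n f := by
  rw [contDiff_iff_contDiffAt]
  intro p
  by_cases hp : p ∈ tsupport f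
  · exact h p hp
  · exact contDiffAt_const.congr_of_eventuallyEq (notMem_tsupport_iff_eventuallyEq.1 hp)

theorem IsTest.mul {T : ℝ} {φ ψ : ℝ × ℝ → ℝ} (h : IsTest T φ) (hψ : ContDiff ℝ ∞ ψ) :
    IsTest T fun p => φ p * ψ p :=
  ⟨h.smooth.mul hψ, h.compact.mul_right, (tsupport_mul_subset_left).trans h.support⟩

theorem IsTest.differentiableAt {T : ℝ} {φ : ℝ × ℝ → ℝ} (h : IsTest T φ) (p : ℝ × ℝ) :
    DifferentiableAt ℝ φ p := h.smooth.differentiable (by simp) p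

theorem IsTest.contDiff_one {T : ℝ} {φ : ℝ × ℝ → ℝ} (h : IsTest T φ) : ContDiff ℝ 1 φ :=
  h.smooth.of_le (by exact_mod_cast le_top)

theorem dt_mul {f g : ℝ × ℝ → ℝ} {p : ℝ × ℝ} (hf : DifferentiableAt ℝ f p)
    (hg : DifferentiableAt ℝ g p) :
    dt (fun p => f p * g p) p = dt f p * g p + f p * dt g p :=
  ((hasDerivAt_fst hf).mul (hasDerivAt_fst hg)).deriv

theorem dm_mul {f g : ℝ × ℝ → ℝ} {p : ℝ × ℝ} (hf : DifferentiableAt ℝ f p)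
    (hg : DifferentiableAt ℝ g p) :
    dm (fun p => f p * g p) p = dm f p * g p + f p * dm g p :=
  ((hasDerivAt_snd hf).mul (hasDerivAt_snd hg)).deriv

/-! ### Concentration at `m = 0` -/

/-- The substitution `m = c d y` turns the thin layer into the fixed strip `1 ≤ y ≤ 2`, where
dominated convergence applies. The mass of `deriv kap` is left unevaluated because only its sign is
used later. The value `c = ±1` selects the side of `m = 0`. -/
theorem tendsto_layer {Q : ℝ → ℝ → ℝ} {Q₀ : ℝ → ℝ} {T C c : ℝ} (hc : |c| = 1)
    (hm : Measurable fun p : ℝ × ℝ => Q p.1 p.2) (hC : ∀ t m, |Q t m| ≤ C)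
    (hQ : ∀ t ∈ Ioo 0 T, Tendsto (fun h => Q t (c * h)) (𝓝[>] 0) (𝓝 (Q₀ t))) :
    Tendsto (fun d => ∫ p in domain T, Q p.1 p.2 * (deriv kap (c * p.2 / d) * (1 / d))) (𝓝[>] 0)
      (𝓝 ((∫ t in Ioo 0 T, Q₀ t) * ∫ y in Icc (1 : ℝ) 2, deriv kap y)) := by
  have hcc : c * c = 1 := by rw [← abs_mul_abs_self, hc, one_mul]
  obtain ⟨K, hK0, hK⟩ := exists_deriv_kap_le
  have key : Tendsto (fun d : ℝ => ∫ p in Ioo 0 T ×ˢ Icc (1 : ℝ) 2,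
      Q p.1 (c * (d * p.2)) * deriv kap p.2) (𝓝[>] 0)
      (𝓝 (∫ p in Ioo 0 T ×ˢ Icc (1 : ℝ) 2, Q₀ p.1 * deriv kap p.2)) := by
    have hfin : IsFiniteMeasure ((volume : Measure (ℝ × ℝ)).restrict
        (Ioo 0 T ×ˢ Icc (1 : ℝ) 2)) := by
      refine ⟨?_⟩
      rw [Measure.restrict_apply_univ]
      exact (measure_mono (prod_mono Ioo_subset_Icc_self subset_rfl)).trans_lt
        (isCompact_Icc.prod isCompact_Icc).measure_lt_top
    refine tendsto_integral_filter_of_dominated_convergence (fun _ => C * K) ?_ ?_ ?_ ?_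
    · refine Eventually.of_forall fun d => Measurable.aestronglyMeasurable ?_
      refine Measurable.mul ?_ (continuous_deriv_kap.measurable.comp measurable_snd)
      exact hm.comp (g := fun p : ℝ × ℝ => Q p.1 p.2)
        (f := fun p : ℝ × ℝ => (p.1, c * (d * p.2))) (by fun_prop)
    · refine Eventually.of_forall fun d => ae_of_all _ fun p => ?_
      rw [Real.norm_eq_abs, abs_mul, abs_of_nonneg (deriv_kap_nonneg _)]
      exact mul_le_mul (hC _ _) (hK _) (deriv_kap_nonneg _) ((abs_nonneg _).trans (hC 0 0))
    · exact integrable_const _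
    · refine (ae_restrict_iff' (measurableSet_Ioo.prod measurableSet_Icc)).2
        (ae_of_all _ fun p hp => ?_)
      refine Tendsto.mul_const _ ((hQ p.1 hp.1).comp ?_)
      refine tendsto_nhdsWithin_iff.2 ⟨?_, ?_⟩
      · have : Tendsto (fun d : ℝ => d * p.2) (𝓝 0) (𝓝 (0 * p.2)) :=
          tendsto_id.mul_const _
        rw [zero_mul] at this
        exact this.mono_left nhdsWithin_le_nhds
      · filter_upwards [self_mem_nhdsWithin] with d hd
        have h1 : (1 : ℝ) ≤ p.2 := hp.2.1
        have h2 : (0 : ℝ) < d := hd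
        exact mul_pos h2 (by linarith)
  have e1 : (∫ p in Ioo 0 T ×ˢ Icc (1 : ℝ) 2, Q₀ p.1 * deriv kap p.2)
      = (∫ t in Ioo 0 T, Q₀ t) * ∫ y in Icc (1 : ℝ) 2, deriv kap y :=
    setIntegral_prod_mul _ _ _ _
  rw [e1] at key
  refine key.congr' ?_
  filter_upwards [Ioo_mem_nhdsGT (show (0 : ℝ) < 1 / 2 by norm_num)] with d hd
  have hd0 : 0 < d := hd.1
  have hme : Measurable fun p : ℝ × ℝ => Q p.1 p.2 * (deriv kap (c * p.2 / d) * (1 / d)) := by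
    refine hm.mul (Measurable.mul_const ?_ _)
    exact continuous_deriv_kap.measurable.comp (by fun_prop)
  have hme2 : Measurable fun p : ℝ × ℝ => Q p.1 (c * (d * p.2)) * deriv kap p.2 := by
    refine Measurable.mul ?_ (continuous_deriv_kap.measurable.comp measurable_snd)
    exact hm.comp (g := fun p : ℝ × ℝ => Q p.1 p.2)
      (f := fun p : ℝ × ℝ => (p.1, c * (d * p.2))) (by fun_prop)
  rw [setIntegral_domain (integrableOn_domain_of_bdd (C := C * (K * (1 / d))) hme ?_)]
  · rw [Measure.volume_eq_prod, setIntegral_prod]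
    · refine integral_congr_ae (ae_of_all _ fun t => ?_)
      simp only
      -- As `d < 1/2`, the support `d ≤ c m ≤ 2 d` lies inside `(-1, 1)`, so both integrals may be
      -- taken over the whole line before rescaling.
      have s1 : ∀ m, m ∉ Ioo (-1 : ℝ) 1 → Q t m * (deriv kap (c * m / d) * (1 / d)) = 0 := by
        intro m hmem
        rw [deriv_kap_of_notMem, zero_mul, mul_zero]
        rintro ⟨h1, h2⟩
        rw [le_div_iff₀ hd0] at h1
        rw [div_le_iff₀ hd0] at h2
        apply hmem
        have : |m| < 1 := by
          have h3 : |c * m| = |m| := by rw [abs_mul, hc, one_mul]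
          rw [← h3, abs_lt]
          constructor <;> linarith [hd.2]
        exact abs_lt.1 this
      have s2 : ∀ y, y ∉ Icc (1 : ℝ) 2 → Q t (c * (d * y)) * deriv kap y = 0 := by
        intro y hy
        rw [deriv_kap_of_notMem hy, mul_zero]
      rw [setIntegral_eq_integral_of_forall_compl_eq_zero s1,
        setIntegral_eq_integral_of_forall_compl_eq_zero s2]
      have := Measure.integral_comp_mul_left
        (fun m => Q t m * (deriv kap (c * m / d) * (1 / d))) (c * d)
      have hcd : |(c * d)⁻¹| = d⁻¹ := by
        rw [abs_inv, abs_mul, hc, one_mul, abs_of_pos hd0]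
      rw [hcd, smul_eq_mul] at this
      have h5 : ∀ y, Q t (c * d * y) * (deriv kap (c * (c * d * y) / d) * (1 / d))
          = d⁻¹ * (Q t (c * (d * y)) * deriv kap y) := by
        intro y
        have : c * (c * d * y) / d = y := by
          rw [show c * (c * d * y) = (c * c) * (y * d) by ring, hcc, one_mul,
            mul_div_cancel_right₀ _ hd0.ne']
        rw [this, mul_assoc c d y]
        ring
      simp only [h5] at this
      rw [integral_const_mul] at this
      exact mul_left_cancel₀ (inv_ne_zero hd0.ne') this
    · refine Measure.integrableOn_of_bounded (M := C * K) ?_ hme2.aestronglyMeasurable ?_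
      · exact ((measure_mono (prod_mono Ioo_subset_Icc_self subset_rfl)).trans_lt
          (isCompact_Icc.prod isCompact_Icc).measure_lt_top).ne
      · refine ae_of_all _ fun p => ?_
        rw [Real.norm_eq_abs, abs_mul, abs_of_nonneg (deriv_kap_nonneg _)]
        exact mul_le_mul (hC _ _) (hK _) (deriv_kap_nonneg _) ((abs_nonneg _).trans (hC 0 0))
  · intro p _
    have h0 : 0 ≤ deriv kap (c * p.2 / d) * (1 / d) := mul_nonneg (deriv_kap_nonneg _) (by positivity)
    rw [abs_mul, abs_of_nonneg h0]
    refine mul_le_mul (hC _ _) ?_ h0 ((abs_nonneg _).trans (hC 0 0))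
    gcongr
    exact hK _

/-! ### Removing the cut-off at `m = 0` -/

/-- A smooth function of time, `1` for `t ≥ 0` and `0` for `t ≤ -1/2`. -/
def past (t : ℝ) : ℝ := kap (2 * t + 2)

theorem contDiff_past : ContDiff ℝ ∞ past := by
  unfold past
  exact contDiff_kap.comp ((contDiff_const.mul contDiff_id).add contDiff_const)

theorem past_of_nonneg {t : ℝ} (h : 0 ≤ t) : past t = 1 := kap_of_ge (by linarith)

theorem past_of_le {t : ℝ} (h : t ≤ -1 / 2) : past t = 0 := kap_of_le (by linarith)

theorem past_mem (t : ℝ) : past t ∈ Icc (0 : ℝ) 1 := ⟨kap_nonneg _, kap_le_one _⟩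

/-- The product of a cut-off in the past and a function of space. -/
def weight (g : ℝ → ℝ) (p : ℝ × ℝ) : ℝ := past p.1 * g p.2

theorem contDiff_weight {g : ℝ → ℝ} (hg : ContDiff ℝ ∞ g) : ContDiff ℝ ∞ (weight g) := by
  unfold weight
  exact (contDiff_past.comp contDiff_fst).mul (hg.comp contDiff_snd)

theorem weight_of_nonneg (g : ℝ → ℝ) {p : ℝ × ℝ} (hp : 0 ≤ p.1) : weight g p = g p.2 := by
  rw [weight, past_of_nonneg hp, one_mul]

theorem dt_weight (g : ℝ → ℝ) {p : ℝ × ℝ} (hp : 0 < p.1) : dt (weight g) p = 0 := by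
  have h : (fun t => weight g (t, p.2)) =ᶠ[𝓝 p.1] fun _ => g p.2 := by
    filter_upwards [lt_mem_nhds hp] with t ht
    exact weight_of_nonneg g (p := (t, p.2)) ht.le
  rw [dt, h.deriv_eq, deriv_const]

theorem dm_weight {g : ℝ → ℝ} {g' : ℝ} {p : ℝ × ℝ} (hp : 0 < p.1) (hg : HasDerivAt g g' p.2) :
    dm (weight g) p = g' := by
  have h : (fun m => weight g (p.1, m)) = g := by
    funext m
    exact weight_of_nonneg g (p := (p.1, m)) hp.le
  rw [dm, h, hg.deriv]

theorem dt_mul_weight {φ : ℝ × ℝ → ℝ} {g : ℝ → ℝ} (hg : ContDiff ℝ ∞ g) {p : ℝ × ℝ}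
    (hφ : DifferentiableAt ℝ φ p) (hp : 0 < p.1) :
    dt (fun p => φ p * weight g p) p = dt φ p * g p.2 := by
  rw [dt_mul hφ ((contDiff_weight hg).differentiable (by simp) p), dt_weight g hp,
    weight_of_nonneg g hp.le, mul_zero, add_zero]

theorem dm_mul_weight {φ : ℝ × ℝ → ℝ} {g : ℝ → ℝ} (hg : ContDiff ℝ ∞ g) {g' : ℝ} {p : ℝ × ℝ}
    (hφ : DifferentiableAt ℝ φ p) (hp : 0 < p.1) (hg' : HasDerivAt g g' p.2) :
    dm (fun p => φ p * weight g p) p = dm φ p * g p.2 + φ p * g' := by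
  rw [dm_mul hφ ((contDiff_weight hg).differentiable (by simp) p), dm_weight hp hg',
    weight_of_nonneg g hp.le]

/-- The bound `t ≥ -1/2` keeps cut-off test functions inside the region `t > -1` where `Z` is
smooth. -/
theorem tsupport_weight_subset {g : ℝ → ℝ} {s : Set ℝ} (hs : IsClosed s)
    (hg : ∀ m, m ∉ s → g m = 0) : tsupport (weight g) ⊆ Ici (-1 / 2) ×ˢ s := by
  refine closure_minimal ?_ (isClosed_Ici.prod hs)
  intro p hp
  refine ⟨?_, ?_⟩
  · by_contra hc
    have hc : p.1 < -1 / 2 := lt_of_not_ge hc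
    exact hp (by rw [weight, past_of_le hc.le, zero_mul])
  · by_contra hc
    exact hp (by rw [weight, hg _ hc, mul_zero])

theorem IsTest.zero_of_notMem {T : ℝ} {φ : ℝ × ℝ → ℝ} (h : IsTest T φ) {p : ℝ × ℝ}
    (hp : p ∉ Iio T ×ˢ Ioo (-1 : ℝ) 1) : φ p = 0 :=
  image_eq_zero_of_notMem_tsupport fun hc => hp (h.support hc)

theorem IsTest.bounds {T : ℝ} {φ : ℝ × ℝ → ℝ} (h : IsTest T φ) :
    ∃ C : ℝ, 0 ≤ C ∧ ∀ p, |φ p| ≤ C ∧ |dt φ p| ≤ C ∧ |dm φ p| ≤ C := by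
  obtain ⟨C₁, h0, h1⟩ := exists_abs_le_of_hasCompactSupport h.smooth.continuous h.compact
  obtain ⟨C₂, h0', h2⟩ := exists_abs_le_of_hasCompactSupport (continuous_dt h.contDiff_one)
    (hasCompactSupport_dt h.compact)
  obtain ⟨C₃, h0'', h3⟩ := exists_abs_le_of_hasCompactSupport (continuous_dm h.contDiff_one)
    (hasCompactSupport_dm h.compact)
  exact ⟨C₁ + C₂ + C₃, by positivity, fun p => ⟨by linarith [h1 p], by linarith [h2 p],
    by linarith [h3 p]⟩⟩

/-- The identity is tested with `φ` times the cut-off `off d`. The derivative of the cut-off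
produces one layer term on each side of `m = 0`; these converge to the traces of `B`, and everything
else converges because `m = 0` is a null set. It is stated for general coefficients to serve the
weak form and the entropy form alike. -/
theorem functional_eq_layer {A B C : ℝ × ℝ → ℝ} {D : ℝ → ℝ} {T c : ℝ} {Bp Bm : ℝ → ℝ}
    (hA : Measurable A) (hB : Measurable B) (hC : Measurable C) (hD : Measurable D)
    (bA : ∀ p : ℝ × ℝ, |p.2| ≤ 1 → |A p| ≤ c) (bB : ∀ p : ℝ × ℝ, |p.2| ≤ 1 → |B p| ≤ c)
    (bC : ∀ p : ℝ × ℝ, |p.2| ≤ 1 → |C p| ≤ c) (bD : ∀ m : ℝ, |m| ≤ 1 → |D m| ≤ c)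
    (hBp : ∀ t ∈ Ioo 0 T, Tendsto (fun h => B (t, 1 * h)) (𝓝[>] 0) (𝓝 (Bp t)))
    (hBm : ∀ t ∈ Ioo 0 T, Tendsto (fun h => B (t, -1 * h)) (𝓝[>] 0) (𝓝 (Bm t)))
    (H : ∀ φ, IsTest T φ → tsupport φ ⊆ {p | -1 < p.1 ∧ p.2 ≠ 0} →
      (∫ p in domain T, (A p * dt φ p + B p * dm φ p + C p * φ p))
        + ∫ m in Ioo (-1 : ℝ) 1, D m * φ (0, m) = 0)
    {φ : ℝ × ℝ → ℝ} (hφ : IsTest T φ) :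
    (∫ p in domain T, (A p * dt φ p + B p * dm φ p + C p * φ p))
        + ∫ m in Ioo (-1 : ℝ) 1, D m * φ (0, m)
      = (∫ t in Ioo 0 T, Bm t * φ (t, 0)) * (∫ y in Icc (1 : ℝ) 2, deriv kap y)
        - (∫ t in Ioo 0 T, Bp t * φ (t, 0)) * (∫ y in Icc (1 : ℝ) 2, deriv kap y) := by
  obtain ⟨b, hb0, hb⟩ := hφ.bounds
  have hc0 : 0 ≤ c := (abs_nonneg _).trans (bA (0, 0) (by simp))
  have cφ := hφ.smooth.continuous
  have cdt := continuous_dt hφ.contDiff_one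
  have cdm := continuous_dm hφ.contDiff_one
  have hdom : ∀ p ∈ domain T, |p.2| ≤ 1 := fun p hp => (abs_lt.2 hp.2).le
  set F : ℝ × ℝ → ℝ := fun p => A p * dt φ p + B p * dm φ p + C p * φ p with hF
  have mF : Measurable F :=
    ((hA.mul cdt.measurable).add (hB.mul cdm.measurable)).add (hC.mul cφ.measurable)
  have bF : ∀ p ∈ domain T, |F p| ≤ 3 * (c * b) := by
    intro p hp
    have e1 : |A p * dt φ p| ≤ c * b := by
      rw [abs_mul]; exact mul_le_mul (bA p (hdom p hp)) (hb p).2.1 (abs_nonneg _) hc0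
    have e2 : |B p * dm φ p| ≤ c * b := by
      rw [abs_mul]; exact mul_le_mul (bB p (hdom p hp)) (hb p).2.2 (abs_nonneg _) hc0
    have e3 : |C p * φ p| ≤ c * b := by
      rw [abs_mul]; exact mul_le_mul (bC p (hdom p hp)) (hb p).1 (abs_nonneg _) hc0
    rw [hF]
    have := abs_add_three (A p * dt φ p) (B p * dm φ p) (C p * φ p)
    simp only
    linarith
  have bQ : ∀ t m, |B (t, m) * φ (t, m)| ≤ c * b := by
    intro t m
    by_cases h : |m| ≤ 1
    · rw [abs_mul]; exact mul_le_mul (bB (t, m) h) (hb _).1 (abs_nonneg _) hc0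
    · rw [hφ.zero_of_notMem, mul_zero, abs_zero]
      · positivity
      · rintro ⟨-, h2⟩
        exact h (abs_lt.2 h2).le
  have mQ : Measurable fun p : ℝ × ℝ => B (p.1, p.2) * φ (p.1, p.2) :=
    hB.mul cφ.measurable
  have l1 := tendsto_layer (Q := fun t m => B (t, m) * φ (t, m)) (T := T)
    (Q₀ := fun t => Bp t * φ (t, 0)) (c := 1) (by simp) mQ bQ (fun t ht => by
      refine (hBp t ht).mul ?_
      have : Tendsto (fun h : ℝ => φ (t, 1 * h)) (𝓝 0) (𝓝 (φ (t, 1 * 0))) :=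
        Continuous.tendsto (by fun_prop) 0
      rw [mul_zero] at this
      exact this.mono_left nhdsWithin_le_nhds)
  have l2 := tendsto_layer (Q := fun t m => B (t, m) * φ (t, m)) (T := T)
    (Q₀ := fun t => Bm t * φ (t, 0)) (c := -1) (by simp) mQ bQ (fun t ht => by
      refine (hBm t ht).mul ?_
      have : Tendsto (fun h : ℝ => φ (t, -1 * h)) (𝓝 0) (𝓝 (φ (t, -1 * 0))) :=
        Continuous.tendsto (by fun_prop) 0
      rw [mul_zero] at this
      exact this.mono_left nhdsWithin_le_nhds)
  have nullF : ∀ᵐ p ∂((volume : Measure (ℝ × ℝ)).restrict (domain T)), p.2 ≠ 0 := by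
    refine ae_restrict_of_ae ?_
    rw [Measure.volume_eq_prod]
    exact Measure.quasiMeasurePreserving_snd.ae (Measure.ae_ne volume (0 : ℝ))
  have l3 : Tendsto (fun d => ∫ p in domain T, F p * off d p.2) (𝓝[>] 0)
      (𝓝 (∫ p in domain T, F p)) := by
    refine tendsto_integral_filter_of_dominated_convergence (fun _ => 3 * (c * b)) ?_ ?_
      (integrable_const _) ?_
    · exact Eventually.of_forall fun d => (mF.mul
        ((contDiff_off d).continuous.measurable.comp measurable_snd)).aestronglyMeasurable
    · filter_upwards [self_mem_nhdsWithin] with d hd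
      refine (ae_restrict_iff' (measurableSet_domain T)).2 (ae_of_all _ fun p hp => ?_)
      have := off_mem (d := d) hd p.2
      rw [Real.norm_eq_abs, abs_mul, abs_of_nonneg this.1]
      calc |F p| * off d p.2 ≤ 3 * (c * b) * 1 :=
            mul_le_mul (bF p hp) this.2 this.1 (by positivity)
        _ = _ := mul_one _
    · filter_upwards [nullF] with p hp
      simpa using (tendsto_off hp).const_mul (F p)
  have l4 : Tendsto (fun d => ∫ m in Ioo (-1 : ℝ) 1, D m * φ (0, m) * off d m) (𝓝[>] 0)
      (𝓝 (∫ m in Ioo (-1 : ℝ) 1, D m * φ (0, m))) := by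
    refine tendsto_integral_filter_of_dominated_convergence (fun _ => c * b) ?_ ?_
      (integrable_const _) ?_
    · exact Eventually.of_forall fun d => ((hD.mul (cφ.measurable.comp (by fun_prop))).mul
        (contDiff_off d).continuous.measurable).aestronglyMeasurable
    · filter_upwards [self_mem_nhdsWithin] with d hd
      refine (ae_restrict_iff' measurableSet_Ioo).2 (ae_of_all _ fun m hm => ?_)
      have := off_mem (d := d) hd m
      rw [Real.norm_eq_abs, abs_mul, abs_of_nonneg this.1, abs_mul]
      calc |D m| * |φ (0, m)| * off d m ≤ c * b * 1 :=
            mul_le_mul (mul_le_mul (bD m (abs_lt.2 hm).le) (hb _).1 (abs_nonneg _) hc0)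
              this.2 this.1 (by positivity)
        _ = _ := mul_one _
    · refine ae_restrict_of_ae ?_
      filter_upwards [Measure.ae_ne volume (0 : ℝ)] with m hm
      simpa using (tendsto_off hm).const_mul (D m * φ (0, m))
  have htot := ((l3.add l1).sub l2).add l4
  have hzero : (fun d => (∫ p in domain T, F p * off d p.2)
      + (∫ p in domain T, B (p.1, p.2) * φ (p.1, p.2) * (deriv kap (1 * p.2 / d) * (1 / d)))
      - (∫ p in domain T, B (p.1, p.2) * φ (p.1, p.2) * (deriv kap (-1 * p.2 / d) * (1 / d)))
      + ∫ m in Ioo (-1 : ℝ) 1, D m * φ (0, m) * off d m) =ᶠ[𝓝[>] 0] fun _ => 0 := by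
    filter_upwards [self_mem_nhdsWithin] with d hd
    have hd : 0 < d := hd
    obtain ⟨K, hK0, hK⟩ := exists_deriv_kap_le
    have hclosed : IsClosed {m : ℝ | d ≤ |m|} := isClosed_le continuous_const continuous_abs
    have hsub := tsupport_weight_subset (g := off d) hclosed
      (fun m hm => off_of_le hd (not_le.1 hm).le)
    have h1 := H (fun p => φ p * weight (off d) p) (hφ.mul (contDiff_weight (contDiff_off d)))
      (fun p hp => by
        have := hsub (tsupport_mul_subset_right hp)
        refine ⟨by linarith [show -1 / 2 ≤ p.1 from this.1], ?_⟩
        intro h0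
        have h2 : d ≤ |p.2| := this.2
        rw [h0, abs_zero] at h2
        linarith)
    have i1 : IntegrableOn (fun p => F p * off d p.2) (domain T) := by
      refine integrableOn_domain_of_bdd (C := 3 * (c * b)) (mF.mul
        ((contDiff_off d).continuous.measurable.comp measurable_snd)) fun p hp => ?_
      have := off_mem hd p.2
      rw [abs_mul, abs_of_nonneg this.1]
      calc |F p| * off d p.2 ≤ 3 * (c * b) * 1 :=
            mul_le_mul (bF p hp) this.2 this.1 (by positivity)
        _ = _ := mul_one _
    have i2 : ∀ e : ℝ, IntegrableOn (fun p : ℝ × ℝ =>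
        B (p.1, p.2) * φ (p.1, p.2) * (deriv kap (e * p.2 / d) * (1 / d))) (domain T) := by
      intro e
      refine integrableOn_domain_of_bdd (C := c * b * (K * (1 / d))) (mQ.mul
        ((continuous_deriv_kap.measurable.comp (by fun_prop)).mul_const _)) fun p hp => ?_
      have h0 : 0 ≤ deriv kap (e * p.2 / d) * (1 / d) :=
        mul_nonneg (deriv_kap_nonneg _) (by positivity)
      rw [abs_mul, abs_of_nonneg h0]
      refine mul_le_mul (bQ _ _) ?_ h0 (by positivity)
      gcongr
      exact hK _
    have e1 : (∫ p in domain T, (A p * dt (fun p => φ p * weight (off d) p) p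
        + B p * dm (fun p => φ p * weight (off d) p) p + C p * (φ p * weight (off d) p)))
        = (∫ p in domain T, F p * off d p.2)
      + (∫ p in domain T, B (p.1, p.2) * φ (p.1, p.2) * (deriv kap (1 * p.2 / d) * (1 / d)))
      - (∫ p in domain T, B (p.1, p.2) * φ (p.1, p.2) * (deriv kap (-1 * p.2 / d) * (1 / d))) := by
      have i3 : IntegrableOn (fun p : ℝ × ℝ => F p * off d p.2
          + B (p.1, p.2) * φ (p.1, p.2) * (deriv kap (1 * p.2 / d) * (1 / d))) (domain T) :=
        i1.add (i2 1)
      rw [← integral_add i1 (i2 1), ← integral_sub i3 (i2 (-1))]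
      refine setIntegral_congr_fun (measurableSet_domain T) fun p hp => ?_
      rw [dt_mul_weight (contDiff_off d) (hφ.differentiableAt p) hp.1.1,
        dm_mul_weight (contDiff_off d) (hφ.differentiableAt p) hp.1.1 (hasDerivAt_off d p.2),
        weight_of_nonneg _ hp.1.1.le]
      simp only [hF, Prod.mk.eta]
      ring
    have e2 : (∫ m in Ioo (-1 : ℝ) 1, D m * (φ (0, m) * weight (off d) (0, m)))
        = ∫ m in Ioo (-1 : ℝ) 1, D m * φ (0, m) * off d m := by
      refine integral_congr_ae (ae_of_all _ fun m => ?_)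
      simp only
      rw [weight_of_nonneg _ le_rfl, mul_assoc]
    rw [e1, e2] at h1
    exact h1
  have := tendsto_nhds_unique (htot.congr' hzero) tendsto_const_nhds
  linarith

/-! ### `Z` is an entropy solution -/

/-- `Z` as a function on space-time. -/
def Zs (p : ℝ × ℝ) : ℝ := Zstar p.1 p.2

/-- The set on which `Z` is smooth. -/
def smoothSet : Set (ℝ × ℝ) := {p | 0 < p.1 ∧ -1 < p.2 ∧ p.2 < 1 ∧ p.2 ≠ 0}

/-- A Borel function equal to `Z` on the domain. -/
def Zm : ℝ × ℝ → ℝ := smoothSet.indicator Zs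

theorem isOpen_smoothSet : IsOpen smoothSet :=
  (isOpen_lt continuous_const continuous_fst).inter
    ((isOpen_lt continuous_const continuous_snd).inter
      ((isOpen_lt continuous_snd continuous_const).inter
        (isOpen_ne_fun continuous_snd continuous_const)))

theorem measurable_Zm : Measurable Zm := by
  classical
  have h : ContinuousOn Zs smoothSet := by
    refine continuousOn_Zstar.mono fun p hp => ?_
    exact ⟨hp.1.le, ⟨hp.2.1.le, hp.2.2.1.le⟩, fun h => hp.2.2.2 h.1⟩
  rw [Zm, ← piecewise_eq_indicator]
  exact h.measurable_piecewise continuousOn_const isOpen_smoothSet.measurableSet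

theorem Zm_eq {p : ℝ × ℝ} (h0 : 0 < p.1) (h1 : p.2 ∈ Ioo (-1 : ℝ) 1) : Zm p = Zs p := by
  by_cases h : p.2 = 0
  · rw [Zm, indicator_of_notMem (fun hp => hp.2.2.2 h), Zs, h, Zstar_zero]
  · exact indicator_of_mem (show p ∈ smoothSet from ⟨h0, h1.1, h1.2, h⟩) _

theorem abs_Zm_le (p : ℝ × ℝ) : |Zm p| ≤ 2 := by
  by_cases h : p ∈ smoothSet
  · rw [Zm, indicator_of_mem h]
    exact abs_Zstar_le h.1.le ⟨h.2.1.le, h.2.2.1.le⟩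
  · rw [Zm, indicator_of_notMem h]
    simp

theorem tendsto_Zm_right {t : ℝ} (ht : 0 < t) :
    Tendsto (fun h => Zm (t, 1 * h)) (𝓝[>] 0) (𝓝 (Zplus t)) := by
  refine (tendsto_Zstar_right ht.le).congr' ?_
  filter_upwards [Ioo_mem_nhdsGT (zero_lt_one (α := ℝ))] with h hh
  rw [one_mul, Zm_eq (p := (t, h)) ht ⟨by linarith [hh.1], hh.2⟩, Zs]

theorem tendsto_Zm_left {t : ℝ} (ht : 0 < t) :
    Tendsto (fun h => Zm (t, -1 * h)) (𝓝[>] 0) (𝓝 (-Zplus t)) := by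
  refine (tendsto_Zstar_right ht.le).neg.congr' ?_
  filter_upwards [Ioo_mem_nhdsGT (zero_lt_one (α := ℝ))] with h hh
  rw [neg_one_mul, Zm_eq (p := (t, -h)) ht ⟨by linarith [hh.2], by linarith [hh.1]⟩, Zs]
  exact (Zstar_neg ht.le ⟨by linarith [hh.1], hh.2.le⟩).symm

theorem contDiffAt_Zs {p : ℝ × ℝ} (ht : -1 < p.1) (hm : p.2 ≠ 0) (h : p.2 ∈ Ioo (-1 : ℝ) 1) :
    ContDiffAt ℝ ∞ Zs p :=
  contDiffAt_Zstar ht hm h.1 h.2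

theorem Zs_ne_zero {p : ℝ × ℝ} (ht : -1 < p.1) (hm : p.2 ≠ 0) (h : p.2 ∈ Ioo (-1 : ℝ) 1) :
    Zs p ≠ 0 := by
  rcases lt_or_gt_of_ne hm with h' | h'
  · have ha := adm_of_lt (t := p.1) (m := -p.2) ⟨ht, by linarith, by linarith [h.1]⟩
    have h1 := Zstar_neg_of_adm ha
    rw [neg_neg] at h1
    rw [Zs, h1, neg_ne_zero]
    exact (Zstar_pos ha).ne'
  · exact (Zstar_pos (adm_of_lt ⟨ht, h', h.2⟩)).ne'

theorem contDiffAt_flux_Zs {p : ℝ × ℝ} (ht : -1 < p.1) (hm : p.2 ≠ 0)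
    (h : p.2 ∈ Ioo (-1 : ℝ) 1) : ContDiffAt ℝ ∞ (fun p => flux p.2 (Zs p)) p := by
  have hZ := contDiffAt_Zs ht hm h
  have hA : ContDiffAt ℝ ∞ (fun p => |Zs p|) p :=
    ContDiffAt.comp p (contDiffAt_abs (Zs_ne_zero ht hm h)) hZ
  unfold flux
  exact (contDiffAt_snd.mul ((hZ.mul hA).div_const 2)).sub ((hZ.pow 2).div_const 2)

theorem hasDerivAt_flux_comp {z : ℝ → ℝ} {z' m : ℝ} (hz : HasDerivAt z z' m) :
    HasDerivAt (fun m => flux m (z m)) (z m * |z m| / 2 + fluxZ m (z m) * z') m := by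
  unfold flux fluxZ
  have h1 : HasDerivAt (fun m => z m * |z m|) (2 * |z m| * z') m :=
    (hasDerivAt_mul_abs (z m)).comp m hz
  have h2 := ((hasDerivAt_id m).mul (h1.div_const 2)).sub ((hz.pow 2).div_const 2)
  convert! h2 using 1
  simp
  ring

/-- Multiplying the classical equation by a smooth `σ (Z - k)` gives an identity for the entropy `σ
(Z - k) (Z - k)`, with an error carrying `σ'`. The choice `σ = 1`, `k = 0` is the weak form; smooth
approximations of the sign lead to Kruzhkov's entropies. -/
theorem conservation_law_smooth {σ : ℝ → ℝ} (hσ : ContDiff ℝ 1 σ) (k : ℝ) {T : ℝ} (hT : 0 < T)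
    {φ : ℝ × ℝ → ℝ} (hφ : IsTest T φ) (hs : tsupport φ ⊆ {p | -1 < p.1 ∧ p.2 ≠ 0}) :
    Continuous (fun p => dt (fun p => φ p * (σ (Zs p - k) * (Zs p - k))) p
      + dm (fun p => φ p * (σ (Zs p - k) * (flux p.2 (Zs p) - flux p.2 k))) p) ∧
    (∀ p ∈ domain T, dt (fun p => φ p * (σ (Zs p - k) * (Zs p - k))) p
      + dm (fun p => φ p * (σ (Zs p - k) * (flux p.2 (Zs p) - flux p.2 k))) p
      = σ (Zs p - k) * (Zs p - k) * dt φ p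
        + σ (Zs p - k) * (flux p.2 (Zs p) - flux p.2 k) * dm φ p
        + -(σ (Zs p - k) * (k * |k| / 2)) * φ p
        + deriv σ (Zs p - k) * ((Zs p - k) * (φ p * dt Zs p)
          + (flux p.2 (Zs p) - flux p.2 k) * (φ p * dm Zs p))) ∧
    (∫ p in domain T, (dt (fun p => φ p * (σ (Zs p - k) * (Zs p - k))) p
      + dm (fun p => φ p * (σ (Zs p - k) * (flux p.2 (Zs p) - flux p.2 k))) p))
      + ∫ m in Ioo (-1 : ℝ) 1, φ (0, m) * (σ (2 * m - k) * (2 * m - k)) = 0 := by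
  have hle : (1 : WithTop ℕ∞) ≤ ∞ := by exact_mod_cast le_top
  have hreg : ∀ p ∈ tsupport φ, ContDiffAt ℝ 1 Zs p ∧
      ContDiffAt ℝ 1 (fun p => flux p.2 (Zs p)) p ∧
      dt Zs p + Zs p * |Zs p| / 2 + fluxZ p.2 (Zs p) * dm Zs p = 0 := by
    intro p hp
    have h1 := hs hp
    have h2 := (hφ.support hp).2
    exact ⟨(contDiffAt_Zs h1.1 h1.2 h2).of_le hle, (contDiffAt_flux_Zs h1.1 h1.2 h2).of_le hle,
      Zstar_pde h1.1 h1.2 h2.1 h2.2⟩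
  have hσZ : ∀ p ∈ tsupport φ, ContDiffAt ℝ 1 (fun p => σ (Zs p - k)) p := fun p hp =>
    ContDiffAt.comp p hσ.contDiffAt ((hreg p hp).1.sub contDiffAt_const)
  have hk : ContDiff ℝ 1 fun p : ℝ × ℝ => flux p.2 k := by
    unfold flux
    fun_prop
  have g1 : ContDiff ℝ 1 (fun p => φ p * (σ (Zs p - k) * (Zs p - k))) :=
    contDiff_of_tsupport fun p hp => by
      have hp := tsupport_mul_subset_left hp
      exact hφ.contDiff_one.contDiffAt.mul
        ((hσZ p hp).mul ((hreg p hp).1.sub contDiffAt_const))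
  have g2 : ContDiff ℝ 1 (fun p => φ p * (σ (Zs p - k) * (flux p.2 (Zs p) - flux p.2 k))) :=
    contDiff_of_tsupport fun p hp => by
      have hp := tsupport_mul_subset_left hp
      exact hφ.contDiff_one.contDiffAt.mul
        ((hσZ p hp).mul ((hreg p hp).2.1.sub hk.contDiffAt))
  refine ⟨(continuous_dt g1).add (continuous_dm g2), fun p _ => ?_, ?_⟩
  · by_cases hp : p ∈ tsupport φ
    · obtain ⟨r1, r2, r3⟩ := hreg p hp
      have hZt := hasDerivAt_fst (r1.differentiableAt one_ne_zero)
      have hZm := hasDerivAt_snd (r1.differentiableAt one_ne_zero)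
      have hσd : HasDerivAt σ (deriv σ (Zs p - k)) (Zs p - k) :=
        ((hσ.differentiable one_ne_zero) _).hasDerivAt
      have s1 : HasDerivAt (fun t => σ (Zs (t, p.2) - k)) (deriv σ (Zs p - k) * dt Zs p) p.1 :=
        hσd.comp p.1 (hZt.sub_const k)
      have s2 : HasDerivAt (fun m => σ (Zs (p.1, m) - k)) (deriv σ (Zs p - k) * dm Zs p) p.2 :=
        hσd.comp p.2 (hZm.sub_const k)
      have d1 := ((hasDerivAt_fst (hφ.differentiableAt p)).mul
        (s1.mul (hZt.sub_const k))).deriv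
      have d2 := ((hasDerivAt_snd (hφ.differentiableAt p)).mul
        (s2.mul ((hasDerivAt_flux_comp hZm).sub (hasDerivAt_flux_left p.2 k)))).deriv
      have d1' : dt (fun p => φ p * (σ (Zs p - k) * (Zs p - k))) p = _ := d1
      have d2' : dm (fun p => φ p * (σ (Zs p - k) * (flux p.2 (Zs p) - flux p.2 k))) p = _ := d2
      rw [d1', d2']
      simp only [Pi.mul_apply, Pi.sub_apply, Prod.mk.eta]
      linear_combination φ p * σ (Zs p - k) * r3
    · have z0 : φ p = 0 := image_eq_zero_of_notMem_tsupport hp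
      rw [dt_eq_zero_of_notMem (fun h => hp (tsupport_mul_subset_left h)),
        dm_eq_zero_of_notMem (fun h => hp (tsupport_mul_subset_left h)),
        dt_eq_zero_of_notMem hp, dm_eq_zero_of_notMem hp, z0]
      ring
  · have := green hT g1 g2 (tsupport_mul_subset_left.trans hφ.support)
      (tsupport_mul_subset_left.trans hφ.support)
    refine Eq.trans ?_ this
    congr 1
    refine setIntegral_congr_fun measurableSet_Ioo fun m hm => ?_
    rw [show Zs (0, m) = 2 * m from Zstar_initial ⟨hm.1.le, hm.2.le⟩]

theorem weak_smooth {T : ℝ} (hT : 0 < T) {φ : ℝ × ℝ → ℝ} (hφ : IsTest T φ)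
    (hs : tsupport φ ⊆ {p | -1 < p.1 ∧ p.2 ≠ 0}) :
    (∫ p in domain T, (Zm p * dt φ p + flux p.2 (Zm p) * dm φ p + 0 * φ p))
      + ∫ m in Ioo (-1 : ℝ) 1, (2 * m) * φ (0, m) = 0 := by
  obtain ⟨-, h2, h3⟩ := conservation_law_smooth (σ := fun _ => 1) contDiff_const 0 hT hφ hs
  refine Eq.trans ?_ h3
  congr 1
  · refine setIntegral_congr_fun (measurableSet_domain T) fun p hp => ?_
    rw [h2 p hp, Zm_eq hp.1.1 hp.2]
    simp [flux]
  · refine integral_congr_ae (ae_of_all _ fun m => ?_)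
    simp only
    ring

/-! ### Kruzhkov's entropies on the smooth region -/

/-- A smooth odd function equal to `-1` for `x ≤ -2` and to `1` for `x ≥ 2`. -/
def ssign (x : ℝ) : ℝ := kap x - kap (-x)

theorem contDiff_ssign : ContDiff ℝ ∞ ssign := contDiff_kap.sub (contDiff_kap.comp contDiff_neg)

theorem hasDerivAt_ssign (x : ℝ) : HasDerivAt ssign (deriv kap x + deriv kap (-x)) x := by
  have h := (hasDerivAt_kap x).sub (HasDerivAt.scomp x (hasDerivAt_kap (-x)) (hasDerivAt_neg x))
  have e : deriv kap x + deriv kap (-x) = deriv kap x - (-1 : ℝ) • deriv kap (-x) := by simp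
  rw [e]
  exact h

theorem ssign_eq_sign {x : ℝ} (h : 2 ≤ |x|) : ssign x = Real.sign x := by
  rcases le_total 0 x with h1 | h1
  · rw [abs_of_nonneg h1] at h
    rw [ssign, kap_of_ge h, kap_of_le (by linarith), Real.sign_of_pos (by linarith), sub_zero]
  · rw [abs_of_nonpos h1] at h
    rw [ssign, kap_of_le (by linarith), kap_of_ge h, Real.sign_of_neg (by linarith), zero_sub]

theorem abs_ssign_le (x : ℝ) : |ssign x| ≤ 1 := by
  have h1 := kap_nonneg x
  have h2 := kap_le_one x
  have h3 := kap_nonneg (-x)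
  have h4 := kap_le_one (-x)
  rw [ssign, abs_le]
  constructor <;> linarith

/-- Scale invariance: with `σ (x) = ssign (n x)` one has `x σ' (x) = (n x) ssign' (n x)`, so the
same bound holds for all `n`. -/
theorem exists_mul_deriv_ssign_le : ∃ L : ℝ, 0 ≤ L ∧ ∀ x, |x * deriv ssign x| ≤ L := by
  obtain ⟨K, hK0, hK⟩ := exists_deriv_kap_le
  refine ⟨2 * (K + K), by positivity, fun x => ?_⟩
  rw [(hasDerivAt_ssign x).deriv]
  by_cases h : |x| ≤ 2
  · rw [abs_mul]
    refine mul_le_mul h ?_ (abs_nonneg _) (by norm_num)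
    rw [abs_of_nonneg (add_nonneg (deriv_kap_nonneg _) (deriv_kap_nonneg _))]
    exact add_le_add (hK _) (hK _)
  · have hx : deriv kap x = 0 := deriv_kap_of_notMem fun h' => h (by
      rw [abs_of_nonneg (by linarith [h'.1])]; exact h'.2)
    have hx' : deriv kap (-x) = 0 := deriv_kap_of_notMem fun h' => h (by
      rw [abs_of_nonpos (by linarith [h'.1])]; exact h'.2)
    rw [hx, hx', add_zero, mul_zero, abs_zero]
    positivity

theorem deriv_ssign_of_gt {x : ℝ} (h : 2 < |x|) : deriv ssign x = 0 := by
  have hx : deriv kap x = 0 := deriv_kap_of_notMem fun h' => not_le.2 h (by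
    rw [abs_of_nonneg (by linarith [h'.1])]; exact h'.2)
  have hx' : deriv kap (-x) = 0 := deriv_kap_of_notMem fun h' => not_le.2 h (by
    rw [abs_of_nonpos (by linarith [h'.1])]; exact h'.2)
  rw [(hasDerivAt_ssign x).deriv, hx, hx', add_zero]

/-- Since `φ Z` is itself a test function, its derivatives are bounded; the product rule then bounds
`φ ∂Z`, as `Z ∂φ` is bounded. -/
theorem exists_bound_mul_deriv_Zs {T : ℝ} {φ : ℝ × ℝ → ℝ} (hφ : IsTest T φ)
    (hs : tsupport φ ⊆ {p | -1 < p.1 ∧ p.2 ≠ 0}) :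
    ∃ C : ℝ, 0 ≤ C ∧ ∀ p ∈ domain T, |φ p * dt Zs p| ≤ C ∧ |φ p * dm Zs p| ≤ C := by
  have hd : ∀ p ∈ tsupport φ, ContDiffAt ℝ ∞ Zs p := fun p hp =>
    contDiffAt_Zs (hs hp).1 (hs hp).2 (hφ.support hp).2
  have ht : IsTest T fun p => φ p * Zs p :=
    ⟨contDiff_of_tsupport fun p hp => hφ.smooth.contDiffAt.mul
      (hd p (tsupport_mul_subset_left hp)), hφ.compact.mul_right,
      tsupport_mul_subset_left.trans hφ.support⟩
  obtain ⟨b, hb0, hb⟩ := hφ.bounds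
  obtain ⟨c, hc0, hc⟩ := ht.bounds
  refine ⟨c + b * 2, by positivity, fun p hp => ?_⟩
  by_cases hmem : p ∈ tsupport φ
  · have h1 := (hd p hmem).differentiableAt (by simp)
    have hz : |Zs p| ≤ 2 := by
      rw [← Zm_eq hp.1.1 hp.2]
      exact abs_Zm_le p
    have key : ∀ x y a : ℝ, |a| ≤ b → |a * Zs p + y| ≤ c → |y| ≤ c + b * 2 := by
      intro x y a ha hy
      have h2 : |a * Zs p| ≤ b * 2 := by
        rw [abs_mul]
        exact mul_le_mul ha hz (abs_nonneg _) hb0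
      have h3 : y = (a * Zs p + y) - a * Zs p := by ring
      rw [h3]
      exact (abs_sub _ _).trans (add_le_add hy h2)
    refine ⟨key 0 _ (dt φ p) (hb p).2.1 ?_, key 0 _ (dm φ p) (hb p).2.2 ?_⟩
    · rw [← dt_mul (hφ.differentiableAt p) h1]
      exact (hc p).2.1
    · rw [← dm_mul (hφ.differentiableAt p) h1]
      exact (hc p).2.2
  · rw [image_eq_zero_of_notMem_tsupport hmem]
    simp only [zero_mul, abs_zero]
    constructor <;> positivity

/-- Equality holds because no entropy is dissipated where `Z` is smooth. The sign is approximated by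
`ssign (n x)`; the error term stays bounded and vanishes for `n |Z - k| > 2`, as well as where `Z =
k`. -/
theorem entropy_smooth (k : ℝ) {T : ℝ} (hT : 0 < T) {φ : ℝ × ℝ → ℝ} (hφ : IsTest T φ)
    (hs : tsupport φ ⊆ {p | -1 < p.1 ∧ p.2 ≠ 0}) :
    (∫ p in domain T, (|Zm p - k| * dt φ p + kflux p.2 (Zm p) k * dm φ p
      + -(Real.sign (Zm p - k) * (k * |k| / 2)) * φ p))
      + ∫ m in Ioo (-1 : ℝ) 1, |2 * m - k| * φ (0, m) = 0 := by
  obtain ⟨b, hb0, hb⟩ := hφ.bounds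
  obtain ⟨C, hC0, hC⟩ := exists_bound_mul_deriv_Zs hφ hs
  obtain ⟨L, hL0, hL⟩ := exists_mul_deriv_ssign_le
  set B : ℝ := 2 + |k| with hBdef
  have hB0 : 0 ≤ B := by positivity
  have hσ : ∀ n : ℕ, ContDiff ℝ 1 (fun x : ℝ => ssign (n * x)) := fun n =>
    (contDiff_ssign.of_le (by exact_mod_cast le_top)).comp (contDiff_const.mul contDiff_id)
  have hσd : ∀ (n : ℕ) (x : ℝ),
      deriv (fun x : ℝ => ssign (n * x)) x = n * deriv ssign (n * x) := by
    intro n x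
    have h := HasDerivAt.scomp x ((contDiff_ssign.differentiable (by simp) (n * x)).hasDerivAt)
      ((hasDerivAt_id x).const_mul (n : ℝ))
    have := h.deriv
    simpa [Function.comp_def] using this
  have ev : ∀ x : ℝ, x ≠ 0 → ∀ᶠ n : ℕ in atTop, 2 < |(n : ℝ) * x| := by
    intro x hx
    have : Tendsto (fun n : ℕ => (n : ℝ) * |x|) atTop atTop :=
      tendsto_natCast_atTop_atTop.atTop_mul_const (abs_pos.2 hx)
    filter_upwards [this.eventually_gt_atTop 2] with n hn
    rwa [abs_mul, Nat.abs_cast]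
  have main : ∀ n : ℕ, _ := fun n => conservation_law_smooth (hσ n) k hT hφ hs
  have lim1 : Tendsto (fun n : ℕ => ∫ p in domain T,
      (dt (fun p => φ p * (ssign (n * (Zs p - k)) * (Zs p - k))) p
      + dm (fun p => φ p * (ssign (n * (Zs p - k)) * (flux p.2 (Zs p) - flux p.2 k))) p)) atTop
      (𝓝 (∫ p in domain T, (|Zm p - k| * dt φ p + kflux p.2 (Zm p) k * dm φ p
      + -(Real.sign (Zm p - k) * (k * |k| / 2)) * φ p))) := by
    refine tendsto_integral_filter_of_dominated_convergence
      (fun _ => 2 * B * b + 4 * B ^ 2 * b + B ^ 2 * b + (L * C + 2 * B * (L * C))) ?_ ?_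
      (integrable_const _) ?_
    · exact Eventually.of_forall fun n => (main n).1.aestronglyMeasurable
    · refine Eventually.of_forall fun n =>
        (ae_restrict_iff' (measurableSet_domain T)).2 (ae_of_all _ fun p hp => ?_)
      rw [(main n).2.1 p hp, hσd, Real.norm_eq_abs]
      have hm : |p.2| ≤ 1 := (abs_lt.2 hp.2).le
      have hZ : |Zs p| ≤ B := by
        rw [← Zm_eq hp.1.1 hp.2]
        exact (abs_Zm_le p).trans (by rw [hBdef]; linarith [abs_nonneg k])
      have hk : |k| ≤ B := by rw [hBdef]; linarith
      have hx : |Zs p - k| ≤ 2 * B := (abs_sub _ _).trans (by linarith)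
      set s := ssign (n * (Zs p - k)) with hs'
      have hs1 : |s| ≤ 1 := abs_ssign_le _
      have hG := abs_flux_sub_le hm hZ hk
      have hG2 : |flux p.2 (Zs p) - flux p.2 k| ≤ 4 * B ^ 2 := by nlinarith
      have t1 : |s * (Zs p - k) * dt φ p| ≤ 2 * B * b := by
        rw [abs_mul, abs_mul]
        have : |s| * |Zs p - k| ≤ 1 * (2 * B) := mul_le_mul hs1 hx (abs_nonneg _) zero_le_one
        rw [one_mul] at this
        exact mul_le_mul this (hb p).2.1 (abs_nonneg _) (by positivity)
      have t2 : |s * (flux p.2 (Zs p) - flux p.2 k) * dm φ p| ≤ 4 * B ^ 2 * b := by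
        rw [abs_mul, abs_mul]
        have : |s| * |flux p.2 (Zs p) - flux p.2 k| ≤ 1 * (4 * B ^ 2) :=
          mul_le_mul hs1 hG2 (abs_nonneg _) zero_le_one
        rw [one_mul] at this
        exact mul_le_mul this (hb p).2.2 (abs_nonneg _) (by positivity)
      have t3 : |-(s * (k * |k| / 2)) * φ p| ≤ B ^ 2 * b := by
        rw [abs_mul, abs_neg, abs_mul]
        have h1 : abs (k * |k| / 2) ≤ B ^ 2 := by
          rw [abs_div, abs_mul, abs_abs, abs_two]
          nlinarith [abs_nonneg k]
        have : |s| * abs (k * |k| / 2) ≤ 1 * B ^ 2 := mul_le_mul hs1 h1 (abs_nonneg _) zero_le_one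
        rw [one_mul] at this
        exact mul_le_mul this (hb p).1 (abs_nonneg _) (by positivity)
      have h4 := hL (n * (Zs p - k))
      -- `D` may be of order `n`, but it meets only `Z - k` or a flux difference, which is at most
      -- `2 B |Z - k|`.
      set D := (n : ℝ) * deriv ssign (n * (Zs p - k)) with hD
      have h5 : |D| * |Zs p - k| ≤ L := by
        rw [← abs_mul, hD]
        rw [show (n : ℝ) * deriv ssign (n * (Zs p - k)) * (Zs p - k)
          = n * (Zs p - k) * deriv ssign (n * (Zs p - k)) by ring]
        exact h4
      have t4 : |D * ((Zs p - k) * (φ p * dt Zs p)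
          + (flux p.2 (Zs p) - flux p.2 k) * (φ p * dm Zs p))| ≤ L * C + 2 * B * (L * C) := by
        rw [mul_add]
        refine (abs_add_le _ _).trans (add_le_add ?_ ?_)
        · rw [← mul_assoc, abs_mul, abs_mul]
          exact mul_le_mul h5 (hC p hp).1 (abs_nonneg _) hL0
        · rw [← mul_assoc, abs_mul, abs_mul]
          have h6 : |D| * |flux p.2 (Zs p) - flux p.2 k| ≤ 2 * B * L := by
            calc |D| * |flux p.2 (Zs p) - flux p.2 k| ≤ |D| * (2 * B * |Zs p - k|) := by gcongr
              _ = 2 * B * (|D| * |Zs p - k|) := by ring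
              _ ≤ 2 * B * L := by gcongr
          calc _ ≤ 2 * B * L * C := mul_le_mul h6 (hC p hp).2 (abs_nonneg _) (by positivity)
            _ = _ := by ring
      exact (abs_add_le _ _).trans (add_le_add ((abs_add_three _ _ _).trans
        (add_le_add (add_le_add t1 t2) t3)) t4)
    · refine (ae_restrict_iff' (measurableSet_domain T)).2 (ae_of_all _ fun p hp => ?_)
      refine tendsto_const_nhds.congr' ?_
      rw [Zm_eq hp.1.1 hp.2]
      by_cases hx : Zs p - k = 0
      · refine Eventually.of_forall fun n => ?_
        simp only
        rw [(main n).2.1 p hp, kflux, sub_eq_zero.1 hx]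
        simp [ssign]
      · filter_upwards [ev _ hx] with n hn
        rw [(main n).2.1 p hp, hσd, deriv_ssign_of_gt hn, ssign_eq_sign hn.le, kflux]
        have hn0 : (0 : ℝ) < n := by
          rcases Nat.eq_zero_or_pos n with h | h
          · rw [h] at hn
            norm_num at hn
          · exact_mod_cast h
        have hsg : Real.sign (n * (Zs p - k)) = Real.sign (Zs p - k) := by
          rcases lt_or_gt_of_ne hx with h | h
          · rw [Real.sign_of_neg h, Real.sign_of_neg (mul_neg_of_pos_of_neg hn0 h)]
          · rw [Real.sign_of_pos h, Real.sign_of_pos (mul_pos hn0 h)]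
        have hab : Real.sign (Zs p - k) * (Zs p - k) = |Zs p - k| := by
          rcases lt_or_gt_of_ne hx with h | h
          · rw [Real.sign_of_neg h, abs_of_neg h]; ring
          · rw [Real.sign_of_pos h, abs_of_pos h]; ring
        rw [hsg, hab]
        ring
  have lim2 : Tendsto (fun n : ℕ => ∫ m in Ioo (-1 : ℝ) 1,
      φ (0, m) * (ssign (n * (2 * m - k)) * (2 * m - k))) atTop
      (𝓝 (∫ m in Ioo (-1 : ℝ) 1, |2 * m - k| * φ (0, m))) := by
    refine tendsto_integral_filter_of_dominated_convergence (fun _ => b * B) ?_ ?_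
      (integrable_const _) ?_
    · refine Eventually.of_forall fun n => Continuous.aestronglyMeasurable ?_
      have := contDiff_ssign.continuous
      have := hφ.smooth.continuous
      fun_prop
    · refine Eventually.of_forall fun n =>
        (ae_restrict_iff' measurableSet_Ioo).2 (ae_of_all _ fun m hm => ?_)
      rw [Real.norm_eq_abs, abs_mul, abs_mul]
      refine mul_le_mul (hb _).1 ?_ (by positivity) hb0
      have h1 : |2 * m - k| ≤ B := by
        have : |2 * m| ≤ 2 := by
          rw [abs_le]
          constructor <;> linarith [hm.1, hm.2]
        exact (abs_sub _ _).trans (by rw [hBdef]; linarith)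
      calc _ ≤ 1 * B := mul_le_mul (abs_ssign_le _) h1 (abs_nonneg _) zero_le_one
        _ = B := one_mul _
    · refine ae_of_all _ fun m => ?_
      refine tendsto_const_nhds.congr' ?_
      by_cases hx : 2 * m - k = 0
      · refine Eventually.of_forall fun n => ?_
        simp [hx]
      · filter_upwards [ev _ hx] with n hn
        rw [ssign_eq_sign hn.le]
        have hn0 : (0 : ℝ) < n := by
          rcases Nat.eq_zero_or_pos n with h | h
          · rw [h] at hn
            norm_num at hn
          · exact_mod_cast h
        rcases lt_or_gt_of_ne hx with h | h
        · rw [Real.sign_of_neg (mul_neg_of_pos_of_neg hn0 h), abs_of_neg h]; ring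
        · rw [Real.sign_of_pos (mul_pos hn0 h), abs_of_pos h]; ring
  refine tendsto_nhds_unique (lim1.add lim2) ?_
  exact tendsto_const_nhds.congr fun n => (main n).2.2.symm

theorem abs_le_of_abs_two_mul {m k : ℝ} (hm : |m| ≤ 1) : |2 * m - k| ≤ 2 + |k| := by
  have h := abs_sub (2 * m) k
  rw [abs_mul, abs_two] at h
  linarith

theorem isEntropySolution_Zstar {T : ℝ} (hT : 0 < T) :
    IsEntropySolution flux (fun m => 2 * m) T Zstar := by
  have hZ := measurable_Zm
  have hzp : ∀ t ∈ Ioo 0 T, 0 ≤ Zplus t := fun t ht => Zplus_nonneg ht.1.le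
  refine ⟨?_, ⟨2, ?_⟩, ?_, ?_⟩
  · refine ⟨Zm, hZ, ?_⟩
    exact (ae_restrict_iff' (measurableSet_domain T)).2
      (ae_of_all _ fun p hp => (Zm_eq hp.1.1 hp.2).symm)
  · exact (ae_restrict_iff' (measurableSet_domain T)).2
      (ae_of_all _ fun p hp => abs_Zstar_le hp.1.1.le ⟨hp.2.1.le, hp.2.2.le⟩)
  · intro φ hφ
    have hflux : ∀ m z : ℝ, |m| ≤ 1 → |z| ≤ 2 → |flux m z| ≤ 8 := by
      intro m z hm hz
      have h := abs_flux_sub_le (B := 2) hm hz (k := 0) (by simp)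
      have h0 : flux m 0 = 0 := by simp [flux]
      rw [h0, sub_zero, sub_zero] at h
      linarith
    have key := functional_eq_layer (A := Zm) (B := fun p => flux p.2 (Zm p)) (C := fun _ => 0)
      (D := fun m => 2 * m) (T := T) (c := 8) (Bp := fun t => flux 0 (Zplus t))
      (Bm := fun t => flux 0 (-Zplus t)) hZ
      (continuous_flux.measurable.comp (measurable_snd.prodMk hZ)) measurable_const
      (by fun_prop) (fun p _ => (abs_Zm_le p).trans (by norm_num))
      (fun p hp => hflux _ _ hp (abs_Zm_le p)) (fun p _ => by simp)
      (fun m hm => by rw [abs_mul, abs_two]; linarith)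
      (fun t ht => by
        refine (continuous_flux.tendsto (0, Zplus t)).comp
          (Tendsto.prodMk_nhds ?_ (tendsto_Zm_right ht.1))
        have h1 : Tendsto (fun h : ℝ => 1 * h) (𝓝 0) (𝓝 (1 * 0)) := tendsto_id.const_mul _
        rw [mul_zero] at h1
        exact h1.mono_left nhdsWithin_le_nhds)
      (fun t ht => by
        refine (continuous_flux.tendsto (0, -Zplus t)).comp
          (Tendsto.prodMk_nhds ?_ (tendsto_Zm_left ht.1))
        have h1 : Tendsto (fun h : ℝ => -1 * h) (𝓝 0) (𝓝 (-1 * 0)) := tendsto_id.const_mul _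
        rw [mul_zero] at h1
        exact h1.mono_left nhdsWithin_le_nhds)
      (fun φ hφ hs => weak_smooth hT hφ hs) hφ
    -- Rankine–Hugoniot: at `m = 0` the flux is even in `z`, so the two layer terms cancel.
    have e : ∀ t, flux 0 (-Zplus t) = flux 0 (Zplus t) := fun t => by simp [flux]
    simp only [e, sub_self] at key
    refine Eq.trans ?_ key
    congr 1
    refine setIntegral_congr_fun (measurableSet_domain T) fun p hp => ?_
    rw [Zm_eq hp.1.1 hp.2, zero_mul, add_zero, Zs]
  · intro k φ hφ hpos
    set B : ℝ := 2 + |k| with hB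
    have hk : |k| ≤ B := by rw [hB]; linarith
    have hB0 : 0 ≤ B := by positivity
    have hZB : ∀ p, |Zm p| ≤ B := fun p => (abs_Zm_le p).trans (by rw [hB]; linarith [abs_nonneg k])
    have hcont : ∀ z : ℝ, Continuous fun q : ℝ × ℝ => kflux q.1 z k := by
      intro z
      unfold kflux flux
      fun_prop
    have htr : ∀ (c : ℝ) (t z : ℝ), |c| = 1 → |z| ≤ B →
        Tendsto (fun h => Zm (t, c * h)) (𝓝[>] 0) (𝓝 z) →
        Tendsto (fun h => kflux (c * h) (Zm (t, c * h)) k) (𝓝[>] 0) (𝓝 (kflux 0 z k)) := by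
      intro c t z hc hzB hz
      rw [tendsto_iff_norm_sub_tendsto_zero]
      have h1 : Tendsto (fun h => B ^ 2 * |c * h| + 2 * B * |Zm (t, c * h) - z|) (𝓝[>] 0)
          (𝓝 (B ^ 2 * |c * 0| + 2 * B * |z - z|)) := by
        have h2 : Tendsto (fun h : ℝ => B ^ 2 * |c * h|) (𝓝 0) (𝓝 (B ^ 2 * |c * 0|)) :=
          Continuous.tendsto (by fun_prop) 0
        exact (h2.mono_left nhdsWithin_le_nhds).add ((hz.sub_const z).abs.const_mul _)
      rw [mul_zero, sub_self, abs_zero, mul_zero, mul_zero, add_zero] at h1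
      refine squeeze_zero (fun _ => norm_nonneg _) (fun h => ?_) h1
      rw [Real.norm_eq_abs]
      calc |kflux (c * h) (Zm (t, c * h)) k - kflux 0 z k|
          ≤ |kflux (c * h) (Zm (t, c * h)) k - kflux 0 (Zm (t, c * h)) k|
            + |kflux 0 (Zm (t, c * h)) k - kflux 0 z k| := abs_sub_le _ _ _
        _ ≤ B ^ 2 * |c * h| + 2 * B * |Zm (t, c * h) - z| := by
            refine add_le_add ?_ ?_
            · have := abs_kflux_sub_le' (m := c * h) (m' := 0) (hZB (t, c * h)) hk
              rwa [sub_zero] at this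
            · rw [kflux_comm, kflux_comm 0 z]
              exact abs_kflux_sub_le (by simp) hk (hZB _) hzB
    have hZpB : ∀ t ∈ Ioo 0 T, |Zplus t| ≤ B := fun t ht =>
      le_of_tendsto (tendsto_Zm_right ht.1).abs (Eventually.of_forall fun h => hZB _)
    have key := functional_eq_layer (A := fun p => |Zm p - k|)
      (B := fun p => kflux p.2 (Zm p) k)
      (C := fun p => -(Real.sign (Zm p - k) * (k * |k| / 2)))
      (D := fun m => |2 * m - k|) (T := T) (c := 2 * B + 4 * B ^ 2)
      (Bp := fun t => kflux 0 (Zplus t) k)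
      (Bm := fun t => kflux 0 (-Zplus t) k)
      (by fun_prop)
      (measurable_kflux.comp (measurable_snd.prodMk (hZ.prodMk measurable_const)))
      (((measurable_sign.comp (hZ.sub_const k)).mul_const _).neg)
      (by fun_prop)
      (fun p _ => by
        simp only [abs_abs]
        nlinarith [abs_sub (Zm p) k, hZB p])
      (fun p hp => (abs_kflux_le_sq hp (hZB p) hk).trans (by linarith))
      (fun p _ => by
        rw [abs_neg, abs_mul, abs_div, abs_mul, abs_abs, abs_two]
        have h1 := abs_sign_le (Zm p - k)
        have h2 : |k| * |k| / 2 ≤ B ^ 2 := by nlinarith [abs_nonneg k]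
        have : |Real.sign (Zm p - k)| * (|k| * |k| / 2) ≤ 1 * B ^ 2 :=
          mul_le_mul h1 h2 (by positivity) zero_le_one
        nlinarith)
      (fun m hm => by
        simp only [abs_abs]
        have := abs_le_of_abs_two_mul (k := k) hm
        nlinarith)
      (fun t ht => htr 1 t (Zplus t) (by simp) (hZpB t ht) (tendsto_Zm_right ht.1))
      (fun t ht => htr (-1) t (-Zplus t) (by simp) (by rw [abs_neg]; exact hZpB t ht)
        (tendsto_Zm_left ht.1))
      (fun φ hφ hs => entropy_smooth k hT hφ hs) hφ
    have hcontZ : ContinuousOn Zplus (Icc 0 T) := continuousOn_Zplus.mono fun t ht => ht.1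
    -- Entropy condition of the shock: the layer terms do not cancel, but their difference has the
    -- right sign for `φ ≥ 0`.
    have hmono : (∫ t in Ioo 0 T, kflux 0 (Zplus t) k * φ (t, 0))
        ≤ ∫ t in Ioo 0 T, kflux 0 (-Zplus t) k * φ (t, 0) := by
      have hm : AEStronglyMeasurable Zplus (volume.restrict (Ioo 0 T)) :=
        (hcontZ.mono Ioo_subset_Icc_self).aestronglyMeasurable measurableSet_Ioo
      obtain ⟨b, hb0, hb⟩ := hφ.bounds
      have hint : ∀ f : ℝ → ℝ, AEMeasurable f (volume.restrict (Ioo 0 T)) →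
          (∀ t ∈ Ioo 0 T, |f t| ≤ B) →
          Integrable (fun t => kflux 0 (f t) k * φ (t, 0)) (volume.restrict (Ioo 0 T)) := by
        intro f hf hfB
        refine Integrable.of_bound (C := 4 * B ^ 2 * b) ?_ ?_
        · refine (AEMeasurable.mul ?_ ?_).aestronglyMeasurable
          · exact measurable_kflux.comp_aemeasurable
              (aemeasurable_const.prodMk (hf.prodMk aemeasurable_const))
          · exact (hφ.smooth.continuous.comp (by fun_prop)).measurable.aemeasurable
        · refine (ae_restrict_iff' measurableSet_Ioo).2 (ae_of_all _ fun t ht => ?_)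
          rw [Real.norm_eq_abs, abs_mul]
          exact mul_le_mul (abs_kflux_le_sq (by simp) (hfB t ht) hk) (hb _).1 (abs_nonneg _)
            (by positivity)
      refine setIntegral_mono_on (hint _ hm.aemeasurable hZpB)
        (hint _ hm.aemeasurable.neg fun t ht => by rw [abs_neg]; exact hZpB t ht)
        measurableSet_Ioo fun t ht => mul_le_mul_of_nonneg_right ?_ (hpos _)
      rw [kflux_comm, kflux_comm 0 (-Zplus t)]
      exact kflux_zero_left_le (hzp t ht)
    have hκ : 0 ≤ ∫ y in Icc (1 : ℝ) 2, deriv kap y :=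
      setIntegral_nonneg measurableSet_Icc fun y _ => deriv_kap_nonneg y
    have hfin := sub_nonneg.2 (mul_le_mul_of_nonneg_right hmono hκ)
    rw [← key] at hfin
    refine hfin.trans_eq ?_
    congr 1
    refine setIntegral_congr_fun (measurableSet_domain T) fun p hp => ?_
    rw [Zm_eq hp.1.1 hp.2, deriv_flux_left, kflux, Zs]
    ring

/-! ### One-dimensional mollification -/

/-- Smooth even probability densities supported in `[-1, 1]`. -/
structure IsMollifier (ρ : ℝ → ℝ) : Prop where
  smooth : ContDiff ℝ ∞ ρ
  nonneg : ∀ s, 0 ≤ ρ s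
  even : ∀ s, ρ (-s) = ρ s
  zero : ∀ s, 1 ≤ |s| → ρ s = 0
  integral : ∫ s in Icc (-1 : ℝ) 1, ρ s = 1

theorem exists_isMollifier : ∃ ρ : ℝ → ℝ, IsMollifier ρ := by
  let f : ContDiffBump (0 : ℝ) := ⟨1 / 2, 1, by norm_num, by norm_num⟩
  have hz : ∀ s, 1 ≤ |s| → f.normed volume s = 0 := by
    intro s hs
    have h : s ∉ Function.support (f.normed volume) := by
      rw [f.support_normed_eq]
      simpa [f] using hs
    simpa using h
  refine ⟨f.normed volume, f.contDiff_normed, fun s => f.nonneg_normed s,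
    fun s => f.normed_neg s, hz, ?_⟩
  rw [setIntegral_eq_integral_of_forall_compl_eq_zero, f.integral_normed]
  intro s hs
  refine hz s ?_
  by_contra hc
  exact hs (abs_le.1 (not_le.1 hc).le)

theorem setIntegral_odd {f : ℝ → ℝ} (hf : ∀ s, f (-s) = -f s) :
    ∫ s in Icc (-1 : ℝ) 1, f s = 0 := by
  rw [integral_Icc_eq_integral_Ioc, ← intervalIntegral.integral_of_le (by norm_num)]
  have h := intervalIntegral.integral_comp_neg (a := -1) (b := 1) f
  simp only [hf, intervalIntegral.integral_neg, neg_neg] at h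
  linarith

namespace IsMollifier

variable {ρ : ℝ → ℝ}

theorem hasDerivAt (h : IsMollifier ρ) (s : ℝ) : HasDerivAt ρ (deriv ρ s) s :=
  (h.smooth.differentiable (by simp) s).hasDerivAt

theorem continuous_deriv (h : IsMollifier ρ) : Continuous (deriv ρ) :=
  h.smooth.continuous_deriv (by simp)

theorem deriv_neg (h : IsMollifier ρ) (s : ℝ) : deriv ρ (-s) = -deriv ρ s := by
  have h1 : deriv (fun s => ρ (-s)) s = deriv ρ s := by
    congr 1
    exact funext h.even
  rw [deriv_comp_neg] at h1
  linarith

theorem deriv_zero (h : IsMollifier ρ) {s : ℝ} (hs : 1 < |s|) : deriv ρ s = 0 := by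
  have : ρ =ᶠ[𝓝 s] fun _ => (0 : ℝ) := by
    filter_upwards [continuous_abs.continuousAt.eventually (lt_mem_nhds hs)] with x hx
    exact h.zero x (le_of_lt hx)
  rw [this.deriv_eq, deriv_const]

theorem integral_deriv (h : IsMollifier ρ) : ∫ s in Icc (-1 : ℝ) 1, deriv ρ s = 0 :=
  setIntegral_odd h.deriv_neg

theorem integral_abs_mul_deriv (h : IsMollifier ρ) :
    ∫ s in Icc (-1 : ℝ) 1, |s| * deriv ρ s = 0 :=
  setIntegral_odd fun s => by rw [abs_neg, h.deriv_neg]; ring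

theorem integral_sign_mul (h : IsMollifier ρ) :
    ∫ s in Icc (-1 : ℝ) 1, Real.sign s * ρ s = 0 :=
  setIntegral_odd fun s => by rw [Real.sign_neg, h.even]; ring

theorem integral_mul_deriv (h : IsMollifier ρ) :
    ∫ s in Icc (-1 : ℝ) 1, s * deriv ρ s = -1 := by
  have h2 := h.integral
  rw [integral_Icc_eq_integral_Ioc, ← intervalIntegral.integral_of_le (by norm_num)] at h2 ⊢
  rw [intervalIntegral.integral_mul_deriv_eq_deriv_mul (u := fun s => s) (u' := fun _ => 1)
    (v := ρ) (fun s _ => hasDerivAt_id s) (fun s _ => h.hasDerivAt s)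
    intervalIntegrable_const (h.continuous_deriv.intervalIntegrable _ _)]
  simp only [one_mul]
  rw [h2, h.zero 1 (by simp), h.zero (-1) (by simp)]
  ring

theorem exists_bound (h : IsMollifier ρ) :
    ∃ P : ℝ, 0 ≤ P ∧ (∀ s, |ρ s| ≤ P) ∧ ∀ s, |deriv ρ s| ≤ P := by
  have key : ∀ f : ℝ → ℝ, Continuous f → (∀ s, 1 < |s| → f s = 0) → ∃ P : ℝ, 0 ≤ P ∧
      ∀ s, |f s| ≤ P := by
    intro f hf hz
    obtain ⟨P, hP⟩ := isCompact_Icc.exists_bound_of_continuousOn (s := Icc (-1 : ℝ) 1)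
      hf.continuousOn
    refine ⟨|P|, abs_nonneg _, fun s => ?_⟩
    by_cases hs : |s| ≤ 1
    · exact (hP s (abs_le.1 hs)).trans (le_abs_self _)
    · rw [hz s (not_le.1 hs), abs_zero]
      exact abs_nonneg _
  obtain ⟨P₁, h1, h1'⟩ := key ρ h.smooth.continuous fun s hs => h.zero s hs.le
  obtain ⟨P₂, h2, h2'⟩ := key _ h.continuous_deriv fun s hs => h.deriv_zero hs
  exact ⟨P₁ + P₂, by positivity, fun s => by linarith [h1' s], fun s => by linarith [h2' s]⟩

end IsMollifier

/-- The average of `g (v + ε s)` against `ρ`. -/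
def mol (ρ g : ℝ → ℝ) (v ε : ℝ) : ℝ := ∫ s in Icc (-1 : ℝ) 1, g (v + ε * s) * ρ s

/-- The derivative in `v` of the average of `g (v + ε s)` against `ρ`. -/
def dmol (ρ g : ℝ → ℝ) (v ε : ℝ) : ℝ :=
  ∫ s in Icc (-1 : ℝ) 1, g (v + ε * s) / ε * -deriv ρ s

theorem volume_Icc_neg_one_one : (volume : Measure ℝ).real (Icc (-1) 1) = 2 := by
  rw [Real.volume_real_Icc]
  norm_num

theorem abs_mul_le_of_mem {ε s : ℝ} (h0 : 0 < ε) (h1 : ε ≤ 1) (hs : s ∈ Icc (-1 : ℝ) 1) :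
    |ε * s| ≤ ε ∧ |ε * s| ≤ 1 := by
  have : |ε * s| ≤ ε := by
    rw [abs_mul, abs_of_pos h0]
    have := abs_le.2 hs
    nlinarith
  exact ⟨this, this.trans h1⟩

theorem integrableOn_mol {ρ g : ℝ → ℝ} (hg : Measurable g) (hρ : Continuous ρ) {v ε b : ℝ}
    (h0 : 0 < ε) (h1 : ε ≤ 1) (hb : ∀ h, |h| ≤ 1 → |g (v + h)| ≤ b) :
    IntegrableOn (fun s => g (v + ε * s) * ρ s) (Icc (-1) 1) := by
  refine IntegrableOn.mul_continuousOn ?_ hρ.continuousOn isCompact_Icc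
  refine Measure.integrableOn_of_bounded (M := b) (by simp)
    (hg.comp (by fun_prop)).aestronglyMeasurable ?_
  exact (ae_restrict_iff' measurableSet_Icc).2
    (ae_of_all _ fun s hs => hb _ (abs_mul_le_of_mem h0 h1 hs).2)

theorem abs_mol_le {ρ g : ℝ → ℝ} {v ε b P : ℝ} (h0 : 0 < ε) (h1 : ε ≤ 1)
    (hP : ∀ s, |ρ s| ≤ P) (hb : ∀ h, |h| ≤ 1 → |g (v + h)| ≤ b) :
    |mol ρ g v ε| ≤ b * P * 2 := by
  have hb0 : 0 ≤ b := (abs_nonneg _).trans (hb 0 (by simp))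
  have := norm_setIntegral_le_of_norm_le_const (μ := volume) (s := Icc (-1 : ℝ) 1)
    (f := fun s => g (v + ε * s) * ρ s) (C := b * P) (by simp) (fun s hs => by
      rw [Real.norm_eq_abs, abs_mul]
      exact mul_le_mul (hb _ (abs_mul_le_of_mem h0 h1 hs).2) (hP s) (abs_nonneg _) hb0)
  rwa [volume_Icc_neg_one_one] at this

/-- As `∫ ρ' = 0`, the value `g v` may be subtracted. The integrand becomes a difference quotient,
bounded uniformly in `ε` for Lipschitz `g`. -/
theorem dmol_eq {ρ g : ℝ → ℝ} (hρ : IsMollifier ρ) (hg : Measurable g) {v ε b : ℝ}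
    (h0 : 0 < ε) (h1 : ε ≤ 1) (hb : ∀ h, |h| ≤ 1 → |g (v + h)| ≤ b) :
    dmol ρ g v ε = ∫ s in Icc (-1 : ℝ) 1, (g (v + ε * s) - g v) / ε * -deriv ρ s := by
  have i1 : IntegrableOn (fun s => ε⁻¹ * (g (v + ε * s) * -deriv ρ s)) (Icc (-1) 1) :=
    (integrableOn_mol hg hρ.continuous_deriv.neg h0 h1 hb).const_mul ε⁻¹
  have i2 : IntegrableOn (fun s => g v / ε * -deriv ρ s) (Icc (-1) 1) :=
    (continuous_const.mul hρ.continuous_deriv.neg).integrableOn_Icc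
  have e : ∀ s, (g (v + ε * s) - g v) / ε * -deriv ρ s
      = ε⁻¹ * (g (v + ε * s) * -deriv ρ s) - g v / ε * -deriv ρ s := by
    intro s
    rw [div_eq_mul_inv, div_eq_mul_inv]
    ring
  simp only [e]
  rw [integral_sub i1 i2, integral_const_mul (g v / ε), integral_neg, hρ.integral_deriv, neg_zero,
    mul_zero, sub_zero, dmol]
  refine integral_congr_ae (ae_of_all _ fun s => ?_)
  simp only
  rw [div_eq_mul_inv]
  ring

theorem abs_dmol_le {ρ g : ℝ → ℝ} (hρ : IsMollifier ρ) (hg : Measurable g) {v ε b L P : ℝ}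
    (h0 : 0 < ε) (h1 : ε ≤ 1) (hP : ∀ s, |deriv ρ s| ≤ P) (hL0 : 0 ≤ L)
    (hb : ∀ h, |h| ≤ 1 → |g (v + h)| ≤ b)
    (hL : ∀ h, |h| ≤ 1 → |g (v + h) - g v| ≤ L * |h|) :
    |dmol ρ g v ε| ≤ L * P * 2 := by
  rw [dmol_eq hρ hg h0 h1 hb]
  have := norm_setIntegral_le_of_norm_le_const (μ := volume) (s := Icc (-1 : ℝ) 1)
    (f := fun s => (g (v + ε * s) - g v) / ε * -deriv ρ s) (C := L * P) (by simp) (fun s hs => by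
      rw [Real.norm_eq_abs, abs_mul, abs_neg]
      refine mul_le_mul ?_ (hP s) (abs_nonneg _) hL0
      have h2 := abs_mul_le_of_mem h0 h1 hs
      rw [abs_div, abs_of_pos h0, div_le_iff₀ h0]
      exact (hL _ h2.2).trans (by gcongr; exact h2.1))
  rwa [volume_Icc_neg_one_one] at this

/-- A jump of `g` at `v` is allowed if it is symmetric about `a`: its odd part `c sgn h` integrates
to zero against the even `ρ`. This matches the convention `Real.sign 0 = 0`. -/
theorem tendsto_mol {ρ g : ℝ → ℝ} (hρ : IsMollifier ρ) (hg : Measurable g) {v b a c : ℝ}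
    (hb : ∀ h, |h| ≤ 1 → |g (v + h)| ≤ b)
    (hlim : Tendsto (fun h => g (v + h) - c * Real.sign h) (𝓝 0) (𝓝 a)) :
    Tendsto (mol ρ g v) (𝓝[>] 0) (𝓝 a) := by
  obtain ⟨P, hP0, hP, -⟩ := hρ.exists_bound
  have hb0 : 0 ≤ b := (abs_nonneg _).trans (hb 0 (by simp))
  have e : ∫ s in Icc (-1 : ℝ) 1, (a + c * Real.sign s) * ρ s = a := by
    have i1 : IntegrableOn (fun s => Real.sign s * ρ s) (Icc (-1) 1) := by
      refine Measure.integrableOn_of_bounded (M := 1 * P) (by simp)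
        (measurable_sign.mul hρ.smooth.continuous.measurable).aestronglyMeasurable ?_
      refine ae_of_all _ fun s => ?_
      rw [Real.norm_eq_abs, abs_mul]
      exact mul_le_mul (abs_sign_le s) (hP s) (abs_nonneg _) zero_le_one
    have i2 : IntegrableOn ρ (Icc (-1) 1) := hρ.smooth.continuous.integrableOn_Icc
    simp only [add_mul, mul_assoc]
    rw [integral_add (i2.const_mul a) (i1.const_mul c), integral_const_mul, integral_const_mul,
      hρ.integral, hρ.integral_sign_mul]
    ring
  rw [← e]
  have hsmall : ∀ᶠ ε : ℝ in 𝓝[>] 0, 0 < ε ∧ ε ≤ 1 :=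
    Ioc_mem_nhdsGT (zero_lt_one (α := ℝ))
  refine tendsto_integral_filter_of_dominated_convergence (fun _ => b * P) ?_ ?_
    (integrable_const _) ?_
  · exact Eventually.of_forall fun ε => ((hg.comp (by fun_prop)).mul
      hρ.smooth.continuous.measurable).aestronglyMeasurable
  · filter_upwards [hsmall] with ε hε
    refine (ae_restrict_iff' measurableSet_Icc).2 (ae_of_all _ fun s hs => ?_)
    rw [Real.norm_eq_abs, abs_mul]
    exact mul_le_mul (hb _ (abs_mul_le_of_mem hε.1 hε.2 hs).2) (hP s) (abs_nonneg _) hb0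
  · refine ae_of_all _ fun s => Tendsto.mul_const _ ?_
    have h1 : Tendsto (fun ε : ℝ => ε * s) (𝓝[>] 0) (𝓝 0) := by
      have : Tendsto (fun ε : ℝ => ε * s) (𝓝 0) (𝓝 (0 * s)) := tendsto_id.mul_const s
      rw [zero_mul] at this
      exact this.mono_left nhdsWithin_le_nhds
    refine ((hlim.comp h1).add_const (c * Real.sign s)).congr' ?_
    filter_upwards [hsmall] with ε hε
    have : Real.sign (ε * s) = Real.sign s := by
      rcases lt_trichotomy s 0 with h | h | h
      · rw [Real.sign_of_neg h, Real.sign_of_neg (mul_neg_of_pos_of_neg hε.1 h)]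
      · rw [h, mul_zero]
      · rw [Real.sign_of_pos h, Real.sign_of_pos (mul_pos hε.1 h)]
    simp only [Function.comp, this]
    ring

/-- A symmetric kink `c |h|` is allowed, since `|s| ρ'(s)` is odd; the linear part survives through
`∫ s ρ'(s) = -1`. -/
theorem tendsto_dmol {ρ g : ℝ → ℝ} (hρ : IsMollifier ρ) (hg : Measurable g) {v b L d c : ℝ}
    (hL0 : 0 ≤ L) (hb : ∀ h, |h| ≤ 1 → |g (v + h)| ≤ b)
    (hL : ∀ h, |h| ≤ 1 → |g (v + h) - g v| ≤ L * |h|)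
    (hd : HasDerivAt (fun h => g (v + h) - c * |h|) d 0) :
    Tendsto (dmol ρ g v) (𝓝[>] 0) (𝓝 d) := by
  obtain ⟨P, hP0, -, hP⟩ := hρ.exists_bound
  have hsmall : ∀ᶠ ε : ℝ in 𝓝[>] 0, 0 < ε ∧ ε ≤ 1 :=
    Ioc_mem_nhdsGT (zero_lt_one (α := ℝ))
  have e : ∫ s in Icc (-1 : ℝ) 1, (d * s + c * |s|) * -deriv ρ s = d := by
    have i1 : IntegrableOn (fun s => s * deriv ρ s) (Icc (-1) 1) :=
      (continuous_id.mul hρ.continuous_deriv).integrableOn_Icc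
    have i2 : IntegrableOn (fun s => |s| * deriv ρ s) (Icc (-1) 1) :=
      (continuous_abs.mul hρ.continuous_deriv).integrableOn_Icc
    have e1 : ∀ s, (d * s + c * |s|) * -deriv ρ s
        = -d * (s * deriv ρ s) + -c * (|s| * deriv ρ s) := fun s => by ring
    simp only [e1]
    rw [integral_add (i1.const_mul _) (i2.const_mul _), integral_const_mul, integral_const_mul,
      hρ.integral_mul_deriv, hρ.integral_abs_mul_deriv]
    ring
  rw [← e]
  have key : Tendsto (fun ε => ∫ s in Icc (-1 : ℝ) 1, (g (v + ε * s) - g v) / ε * -deriv ρ s)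
      (𝓝[>] 0) (𝓝 (∫ s in Icc (-1 : ℝ) 1, (d * s + c * |s|) * -deriv ρ s)) := by
    refine tendsto_integral_filter_of_dominated_convergence (fun _ => L * P) ?_ ?_
      (integrable_const _) ?_
    · exact Eventually.of_forall fun ε => ((((hg.comp (by fun_prop)).sub_const _).div_const _).mul
        hρ.continuous_deriv.measurable.neg).aestronglyMeasurable
    · filter_upwards [hsmall] with ε hε
      refine (ae_restrict_iff' measurableSet_Icc).2 (ae_of_all _ fun s hs => ?_)
      rw [Real.norm_eq_abs, abs_mul, abs_neg]
      refine mul_le_mul ?_ (hP s) (abs_nonneg _) hL0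
      have h2 := abs_mul_le_of_mem hε.1 hε.2 hs
      rw [abs_div, abs_of_pos hε.1, div_le_iff₀ hε.1]
      exact (hL _ h2.2).trans (by gcongr; exact h2.1)
    · refine ae_of_all _ fun s => Tendsto.mul_const _ ?_
      have h1 : HasDerivAt (fun ε : ℝ => ε * s) s 0 := by
        simpa using (hasDerivAt_id (0 : ℝ)).mul_const s
      have h2 : HasDerivAt (fun ε : ℝ => g (v + ε * s) - c * |ε * s|) (d * s) 0 := by
        refine HasDerivAt.comp (h₂ := fun h => g (v + h) - c * |h|) 0 ?_ h1
        rw [zero_mul]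
        exact hd
      have h3 := (hasDerivAt_iff_tendsto_slope_zero.1 h2).mono_left
        (nhdsWithin_mono 0 (fun x (hx : 0 < x) => hx.ne'))
      refine (h3.add_const (c * |s|)).congr' ?_
      filter_upwards [hsmall] with ε hε
      have hne := hε.1.ne'
      simp only [zero_add, zero_mul, add_zero, abs_zero, mul_zero, sub_zero, smul_eq_mul]
      rw [abs_mul, abs_of_pos hε.1]
      field_simp
      ring
  refine key.congr' ?_
  filter_upwards [hsmall] with ε hε
  exact (dmol_eq hρ hg hε.1 hε.2 hb).symm

/-- The substitution `k = v + ε s`. The integration range on the left does not depend on `v`, so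
that Fubini's theorem can be used when `v` varies with the point. -/
theorem setIntegral_rescale {f : ℝ → ℝ} {v ε R : ℝ} (h0 : 0 < ε) (h1 : ε ≤ 1) (hv : |v| ≤ R)
    (hf : ∀ s, 1 < |s| → f (v + ε * s) = 0) :
    ∫ k in Icc (-(R + 1)) (R + 1), f k = ε * ∫ s in Icc (-1 : ℝ) 1, f (v + ε * s) := by
  have hz : ∀ k, k ∉ Icc (-(R + 1)) (R + 1) → f k = 0 := by
    intro k hk
    have hk' : R + 1 < |k| := by
      by_contra hc
      exact hk (abs_le.1 (not_lt.1 hc))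
    have h2 : ε < |k - v| := by
      have := abs_sub_abs_le_abs_sub k v
      linarith
    have e : k = v + ε * ((k - v) / ε) := by
      field_simp
      ring
    rw [e]
    refine hf _ ?_
    rw [abs_div, abs_of_pos h0, lt_div_iff₀ h0]
    linarith
  rw [setIntegral_eq_integral_of_forall_compl_eq_zero hz,
    setIntegral_eq_integral_of_forall_compl_eq_zero]
  · have h2 := Measure.integral_comp_mul_left (fun x => f (v + x)) ε
    rw [abs_of_pos (inv_pos.2 h0), integral_add_left_eq_self f v, smul_eq_mul] at h2
    rw [h2]
    field_simp
  · intro s hs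
    refine hf s ?_
    by_contra hc
    exact hs (abs_le.1 (not_lt.1 hc))

/-! ### Kruzhkov's inequality against smooth functions -/

theorem eventually_sign_sub_eq {w v : ℝ} (h : w - v ≠ 0) :
    ∀ᶠ x in 𝓝 (0 : ℝ), Real.sign (w - (v + x)) = Real.sign (w - v) := by
  have hc : Tendsto (fun x => w - (v + x)) (𝓝 0) (𝓝 (w - (v + 0))) :=
    Continuous.tendsto (by fun_prop) 0
  rw [add_zero] at hc
  rcases lt_or_gt_of_ne h with h | h
  · filter_upwards [hc.eventually (gt_mem_nhds h)] with x hx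
    rw [Real.sign_of_neg h, Real.sign_of_neg hx]
  · filter_upwards [hc.eventually (lt_mem_nhds h)] with x hx
    rw [Real.sign_of_pos h, Real.sign_of_pos hx]

theorem abs_eq_sign_mul (x : ℝ) : |x| = Real.sign x * x := by
  rcases lt_trichotomy x 0 with h | h | h
  · rw [Real.sign_of_neg h, abs_of_neg h]; ring
  · rw [h]; simp
  · rw [Real.sign_of_pos h, abs_of_pos h]; ring

/-- Separates the kink at `v = w`, where `c = 1` and the remaining derivative `0` agrees with
`Real.sign 0 = 0`. -/
theorem exists_hasDerivAt_abs_sub (w v : ℝ) :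
    ∃ c : ℝ, HasDerivAt (fun h => |w - (v + h)| - c * |h|) (-Real.sign (w - v)) 0 := by
  by_cases hv : w - v = 0
  · refine ⟨1, ?_⟩
    have e : (fun h : ℝ => |w - (v + h)| - 1 * |h|) = fun _ => 0 := by
      funext h
      rw [show w - (v + h) = -h by linarith, abs_neg]
      ring
    rw [e, hv, Real.sign_zero, neg_zero]
    exact hasDerivAt_const _ _
  · refine ⟨0, ?_⟩
    have h1 : HasDerivAt (fun h : ℝ => Real.sign (w - v) * (w - (v + h)))
        (-Real.sign (w - v)) 0 := by
      have := (((hasDerivAt_id (0 : ℝ)).const_add v).const_sub w).const_mul (Real.sign (w - v))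
      simpa using this
    refine h1.congr_of_eventuallyEq ?_
    filter_upwards [eventually_sign_sub_eq hv] with h hh
    rw [abs_eq_sign_mul, hh, zero_mul, sub_zero]

/-- At `v = w` the entropy flux is `sgn h` times the increment of the flux, so its kink has slope
`fluxZ m v`. Elsewhere the sign is locally constant and there is no kink. -/
theorem exists_hasDerivAt_kflux (m w v : ℝ) :
    ∃ c : ℝ, HasDerivAt (fun h => kflux m w (v + h) - c * |h|)
      (-(Real.sign (w - v) * fluxZ m v)) 0 := by
  have hf : HasDerivAt (fun h => flux m (v + h)) (fluxZ m v) 0 := by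
    have h1 : HasDerivAt (fun h : ℝ => v + h) 1 0 := (hasDerivAt_id (0 : ℝ)).const_add v
    have h2 : HasDerivAt (fun z => flux m z) (fluxZ m v) (v + 0) := by
      rw [add_zero]
      exact hasDerivAt_flux m v
    have h3 := HasDerivAt.comp (h₂ := fun z => flux m z) 0 h2 h1
    rw [mul_one] at h3
    exact h3
  by_cases hv : w - v = 0
  · refine ⟨fluxZ m v, ?_⟩
    have hw : w = v := by linarith
    rw [hv, Real.sign_zero, zero_mul, neg_zero, hasDerivAt_iff_isLittleO_nhds_zero]
    rw [hasDerivAt_iff_isLittleO_nhds_zero] at hf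
    simp only [zero_add, add_zero, abs_zero, mul_zero, sub_zero, smul_zero] at hf ⊢
    have e : (fun h => kflux m w (v + h) - fluxZ m v * |h| - kflux m w v)
        = fun h => Real.sign h * (flux m (v + h) - flux m v - h • fluxZ m v) := by
      funext h
      rw [hw, kflux, kflux, sub_self, Real.sign_zero, show v - (v + h) = -h by ring,
        Real.sign_neg, abs_eq_sign_mul h, smul_eq_mul]
      ring
    rw [e]
    refine Asymptotics.IsBigO.trans_isLittleO ?_ hf
    refine Asymptotics.IsBigO.of_bound 1 (Eventually.of_forall fun h => ?_)
    rw [norm_mul]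
    exact mul_le_mul_of_nonneg_right (abs_sign_le h) (norm_nonneg _)
  · refine ⟨0, ?_⟩
    have h1 := (hf.const_sub (flux m w)).const_mul (Real.sign (w - v))
    rw [mul_neg] at h1
    refine h1.congr_of_eventuallyEq ?_
    filter_upwards [eventually_sign_sub_eq hv] with h hh
    rw [kflux, hh, zero_mul, sub_zero]

theorem exists_tendsto_sign_mul (w v : ℝ) :
    ∃ c : ℝ, Tendsto (fun h => Real.sign (w - (v + h)) * ((v + h) * |v + h| / 2) - c * Real.sign h)
      (𝓝 0) (𝓝 (Real.sign (w - v) * (v * |v| / 2))) := by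
  have hc : Tendsto (fun h : ℝ => (v + h) * |v + h| / 2) (𝓝 0) (𝓝 ((v + 0) * |v + 0| / 2)) :=
    Continuous.tendsto (by fun_prop) 0
  rw [add_zero] at hc
  by_cases hv : w - v = 0
  · refine ⟨-(v * |v| / 2), ?_⟩
    rw [hv, Real.sign_zero, zero_mul]
    have h1 := (hc.sub_const (v * |v| / 2)).abs
    rw [sub_self, abs_zero] at h1
    refine squeeze_zero_norm (fun h => ?_) h1
    rw [show w - (v + h) = -h by linarith, Real.sign_neg, Real.norm_eq_abs,
      show -Real.sign h * ((v + h) * |v + h| / 2) - -(v * |v| / 2) * Real.sign h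
        = -(Real.sign h * ((v + h) * |v + h| / 2 - v * |v| / 2)) by ring, abs_neg, abs_mul]
    exact mul_le_of_le_one_left (abs_nonneg _) (abs_sign_le h)
  · refine ⟨0, ?_⟩
    refine (hc.const_mul (Real.sign (w - v))).congr' ?_
    filter_upwards [eventually_sign_sub_eq hv] with h hh
    rw [hh, zero_mul, sub_zero]

/-! ### Levels that vary from point to point -/

/-- Kruzhkov's entropy inequality for the datum `2 m`. -/
def EntropyIneq (T : ℝ) (w : ℝ × ℝ → ℝ) : Prop :=
  ∀ k : ℝ, ∀ φ : ℝ × ℝ → ℝ, IsTest T φ → (∀ p, 0 ≤ φ p) →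
    0 ≤ (∫ p in domain T, (|w p - k| * dt φ p + kflux p.2 (w p) k * dm φ p
        - Real.sign (w p - k) * (k * |k| / 2) * φ p))
      + ∫ m in Ioo (-1 : ℝ) 1, |2 * m - k| * φ (0, m)

/-- The integrand of the entropy inequality at level `k` with test function
`φ ρ ((k - V) / ε)`. -/
def levelIntegrand (ρ : ℝ → ℝ) (φ V w : ℝ × ℝ → ℝ) (ε k : ℝ) (p : ℝ × ℝ) : ℝ :=
  |w p - k| * (dt φ p * ρ ((k - V p) / ε) - φ p * (deriv ρ ((k - V p) / ε) * (dt V p / ε)))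
    + kflux p.2 (w p) k
      * (dm φ p * ρ ((k - V p) / ε) - φ p * (deriv ρ ((k - V p) / ε) * (dm V p / ε)))
    - Real.sign (w p - k) * (k * |k| / 2) * (φ p * ρ ((k - V p) / ε))

theorem dt_level {ρ : ℝ → ℝ} (hρ : IsMollifier ρ) {φ V : ℝ × ℝ → ℝ} {p : ℝ × ℝ}
    (hφ : DifferentiableAt ℝ φ p) (hV : DifferentiableAt ℝ V p) (ε k : ℝ) :
    dt (fun p => φ p * ρ ((k - V p) / ε)) p
      = dt φ p * ρ ((k - V p) / ε) - φ p * (deriv ρ ((k - V p) / ε) * (dt V p / ε)) := by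
  have h1 : HasDerivAt (fun t => ρ ((k - V (t, p.2)) / ε))
      (deriv ρ ((k - V p) / ε) * (-dt V p / ε)) p.1 :=
    (hρ.hasDerivAt _).comp p.1 (((hasDerivAt_fst hV).const_sub k).div_const ε)
  have h2 : dt (fun p => φ p * ρ ((k - V p) / ε)) p = _ :=
    ((hasDerivAt_fst hφ).mul h1).deriv
  rw [h2]
  ring

theorem dm_level {ρ : ℝ → ℝ} (hρ : IsMollifier ρ) {φ V : ℝ × ℝ → ℝ} {p : ℝ × ℝ}
    (hφ : DifferentiableAt ℝ φ p) (hV : DifferentiableAt ℝ V p) (ε k : ℝ) :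
    dm (fun p => φ p * ρ ((k - V p) / ε)) p
      = dm φ p * ρ ((k - V p) / ε) - φ p * (deriv ρ ((k - V p) / ε) * (dm V p / ε)) := by
  have h1 : HasDerivAt (fun m => ρ ((k - V (p.1, m)) / ε))
      (deriv ρ ((k - V p) / ε) * (-dm V p / ε)) p.2 :=
    (hρ.hasDerivAt _).comp p.2 (((hasDerivAt_snd hV).const_sub k).div_const ε)
  have h2 : dm (fun p => φ p * ρ ((k - V p) / ε)) p = _ :=
    ((hasDerivAt_snd hφ).mul h1).deriv
  rw [h2]
  ring

theorem measurable_levelIntegrand {ρ : ℝ → ℝ} (hρ : IsMollifier ρ) {φ V w : ℝ × ℝ → ℝ}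
    (hφ : ContDiff ℝ 1 φ) (hV : ContDiff ℝ 1 V) (hw : Measurable w) (ε : ℝ)
    {α : Type*} [MeasurableSpace α] {k : α → ℝ} {p : α → ℝ × ℝ} (hk : Measurable k)
    (hp : Measurable p) : Measurable fun a => levelIntegrand ρ φ V w ε (k a) (p a) := by
  have m1 := hφ.continuous.measurable.comp hp
  have m2 := (continuous_dt hφ).measurable.comp hp
  have m3 := (continuous_dm hφ).measurable.comp hp
  have m4 := hV.continuous.measurable.comp hp
  have m5 := (continuous_dt hV).measurable.comp hp
  have m6 := (continuous_dm hV).measurable.comp hp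
  have m7 := hw.comp hp
  have m8 : Measurable fun a => (k a - V (p a)) / ε := (hk.sub m4).div_const ε
  have m9 := hρ.smooth.continuous.measurable.comp m8
  have m10 := hρ.continuous_deriv.measurable.comp m8
  have m11 : Measurable fun a => w (p a) - k a := m7.sub hk
  have m12 : Measurable fun a => |w (p a) - k a| := continuous_abs.measurable.comp m11
  have m13 := measurable_kflux.comp ((measurable_snd.comp hp).prodMk (m7.prodMk hk))
  have m14 : Measurable fun a => k a * |k a| / 2 :=
    (hk.mul (continuous_abs.measurable.comp hk)).div_const 2
  exact ((m12.mul ((m2.mul m9).sub (m1.mul (m10.mul (m5.div_const ε))))).add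
    (m13.mul ((m3.mul m9).sub (m1.mul (m10.mul (m6.div_const ε)))))).sub
    (((measurable_sign.comp m11).mul m14).mul (m1.mul m9))

theorem exists_bounds_on_domain {V : ℝ × ℝ → ℝ} (hV : ContDiff ℝ 1 V) (T : ℝ) :
    ∃ R : ℝ, 0 ≤ R ∧ ∀ p ∈ Icc 0 T ×ˢ Icc (-1 : ℝ) 1,
      |V p| ≤ R ∧ |dt V p| ≤ R ∧ |dm V p| ≤ R := by
  have hK : IsCompact (Icc 0 T ×ˢ Icc (-1 : ℝ) 1) := isCompact_Icc.prod isCompact_Icc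
  obtain ⟨C₁, h1⟩ := hK.exists_bound_of_continuousOn hV.continuous.continuousOn
  obtain ⟨C₂, h2⟩ := hK.exists_bound_of_continuousOn (continuous_dt hV).continuousOn
  obtain ⟨C₃, h3⟩ := hK.exists_bound_of_continuousOn (continuous_dm hV).continuousOn
  refine ⟨|C₁| + |C₂| + |C₃|, by positivity, fun p hp => ?_⟩
  have e1 : |V p| ≤ C₁ := h1 p hp
  have e2 : |dt V p| ≤ C₂ := h2 p hp
  have e3 : |dm V p| ≤ C₃ := h3 p hp
  have := abs_nonneg C₁
  have := abs_nonneg C₂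
  have := abs_nonneg C₃
  have := le_abs_self C₁
  have := le_abs_self C₂
  have := le_abs_self C₃
  exact ⟨by linarith, by linarith, by linarith⟩

theorem abs_mul_abs_half_le {k B : ℝ} (hk : |k| ≤ B) : abs (k * |k| / 2) ≤ B ^ 2 := by
  rw [abs_div, abs_mul, abs_abs, abs_two]
  nlinarith [abs_nonneg k]

theorem abs_levelIntegrand_le {ρ : ℝ → ℝ} {φ V w : ℝ × ℝ → ℝ} {ε k b P R B : ℝ} {p : ℝ × ℝ}
    (h0 : 0 < ε) (hb : |φ p| ≤ b ∧ |dt φ p| ≤ b ∧ |dm φ p| ≤ b) (hP : ∀ s, |ρ s| ≤ P)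
    (hP' : ∀ s, |deriv ρ s| ≤ P) (hR : |dt V p| ≤ R ∧ |dm V p| ≤ R)
    (hm : |p.2| ≤ 1) (hw : |w p| ≤ B) (hk : |k| ≤ B) :
    |levelIntegrand ρ φ V w ε k p|
      ≤ 2 * B * (b * P + b * (P * (R / ε))) + 4 * B ^ 2 * (b * P + b * (P * (R / ε)))
        + B ^ 2 * (b * P) := by
  have hb0 : 0 ≤ b := (abs_nonneg _).trans hb.1
  have hP0 : 0 ≤ P := (abs_nonneg _).trans (hP 0)
  have hB0 : 0 ≤ B := (abs_nonneg _).trans hk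
  have hR0 : 0 ≤ R := (abs_nonneg _).trans hR.1
  have hx : ∀ a v : ℝ, |a| ≤ b → |v| ≤ R →
      |a * ρ ((k - V p) / ε) - φ p * (deriv ρ ((k - V p) / ε) * (v / ε))|
        ≤ b * P + b * (P * (R / ε)) := by
    intro a v ha hv
    refine (abs_sub _ _).trans (add_le_add ?_ ?_)
    · rw [abs_mul]
      exact mul_le_mul ha (hP _) (abs_nonneg _) hb0
    · rw [abs_mul, abs_mul, abs_div, abs_of_pos h0]
      have : |v| / ε ≤ R / ε := by gcongr
      exact mul_le_mul hb.1 (mul_le_mul (hP' _) this (by positivity) hP0) (by positivity) hb0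
  have t1 : |w p - k| ≤ 2 * B := (abs_sub _ _).trans (by linarith)
  have t2 := abs_kflux_le_sq hm hw hk
  rw [levelIntegrand]
  refine (abs_sub _ _).trans (add_le_add ((abs_add_le _ _).trans (add_le_add ?_ ?_)) ?_)
  · rw [abs_mul, abs_abs]
    exact mul_le_mul t1 (hx _ _ hb.2.1 hR.1) (abs_nonneg _) (by positivity)
  · rw [abs_mul]
    exact mul_le_mul t2 (hx _ _ hb.2.2 hR.2) (abs_nonneg _) (by positivity)
  · rw [abs_mul, abs_mul, abs_mul (φ p)]
    have h1 : |Real.sign (w p - k)| * abs (k * |k| / 2) ≤ 1 * B ^ 2 :=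
      mul_le_mul (abs_sign_le _) (abs_mul_abs_half_le hk) (abs_nonneg _) zero_le_one
    rw [one_mul] at h1
    exact mul_le_mul h1 (mul_le_mul hb.1 (hP _) (abs_nonneg _) hb0) (by positivity)
      (by positivity)

/-- For each constant `k` the function `φ ρ ((k - V) / ε)` is an admissible test function
concentrated where `V` is close to `k`. Integrating the resulting inequalities over `k` and
exchanging the integrals effectively puts `V p + ε s` in place of `k`. -/
theorem integrated_entropy {T B : ℝ} (hT : 0 < T) {w : ℝ × ℝ → ℝ} (hw : Measurable w)
    (hB : ∀ p, |w p| ≤ B) (hE : EntropyIneq T w) {ρ : ℝ → ℝ} (hρ : IsMollifier ρ)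
    {V φ : ℝ × ℝ → ℝ} (hV : ContDiff ℝ ∞ V) (hφ : IsTest T φ) (hpos : ∀ p, 0 ≤ φ p)
    {ε : ℝ} (h0 : 0 < ε) (h1 : ε ≤ 1) :
    0 ≤ (∫ p in domain T, ∫ s in Icc (-1 : ℝ) 1, levelIntegrand ρ φ V w ε (V p + ε * s) p)
      + ∫ m in Ioo (-1 : ℝ) 1, ∫ s in Icc (-1 : ℝ) 1,
          |2 * m - (V (0, m) + ε * s)| * (φ (0, m) * ρ s) := by
  have hle : (1 : WithTop ℕ∞) ≤ ∞ := by exact_mod_cast le_top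
  have hV1 : ContDiff ℝ 1 V := hV.of_le hle
  obtain ⟨b, hb0, hb⟩ := hφ.bounds
  obtain ⟨P, hP0, hP, hP'⟩ := hρ.exists_bound
  obtain ⟨R, hR0, hR⟩ := exists_bounds_on_domain hV1 T
  have hB0 : 0 ≤ B := (abs_nonneg _).trans (hB (0, 0))
  -- Since `|V| ≤ R` and `ε ≤ 1`, this interval contains every level that matters, at all points of
  -- the domain at once.
  set K := Icc (-(R + 1)) (R + 1) with hK
  have hψ : ∀ k, IsTest T fun p => φ p * ρ ((k - V p) / ε) := fun k =>
    hφ.mul (hρ.smooth.comp ((contDiff_const.sub hV).div_const ε))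
  have hmeas : Measurable fun q : ℝ × (ℝ × ℝ) => levelIntegrand ρ φ V w ε q.1 q.2 :=
    measurable_levelIntegrand hρ hφ.contDiff_one hV1 hw ε measurable_fst measurable_snd
  have hmeas2 : Measurable fun q : ℝ × ℝ =>
      |2 * q.2 - q.1| * (φ (0, q.2) * ρ ((q.1 - V (0, q.2)) / ε)) := by
    have c1 := hφ.smooth.continuous
    have c2 := hρ.smooth.continuous
    have c3 := hV.continuous
    exact Continuous.measurable (by fun_prop)
  have step : ∀ k, 0 ≤ (∫ p in domain T, levelIntegrand ρ φ V w ε k p)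
      + ∫ m in Ioo (-1 : ℝ) 1, |2 * m - k| * (φ (0, m) * ρ ((k - V (0, m)) / ε)) := by
    intro k
    refine (hE k _ (hψ k) fun p => mul_nonneg (hpos p) (hρ.nonneg _)).trans_eq ?_
    congr 1
    refine setIntegral_congr_fun (measurableSet_domain T) fun p _ => ?_
    have d1 := hφ.differentiableAt p
    have d2 : DifferentiableAt ℝ V p := hV1.differentiable one_ne_zero p
    simp only [dt_level hρ d1 d2, dm_level hρ d1 d2, levelIntegrand]
  have hKB : ∀ k ∈ K, |k| ≤ R + 1 := fun k hk => abs_le.2 hk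
  have int1 : Integrable (fun q : ℝ × (ℝ × ℝ) => levelIntegrand ρ φ V w ε q.1 q.2)
      ((volume.restrict K).prod (volume.restrict (domain T))) := by
    refine Integrable.of_bound hmeas.aestronglyMeasurable
      (2 * (B + R + 1) * (b * P + b * (P * (R / ε)))
        + 4 * (B + R + 1) ^ 2 * (b * P + b * (P * (R / ε))) + (B + R + 1) ^ 2 * (b * P)) ?_
    rw [Measure.prod_restrict]
    refine (ae_restrict_iff' (measurableSet_Icc.prod (measurableSet_domain T))).2
      (ae_of_all _ fun q hq => ?_)
    have h2 := hR q.2 (domain_subset T hq.2)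
    exact abs_levelIntegrand_le h0 (hb q.2) hP hP' h2.2 (abs_lt.2 hq.2.2).le
      ((hB _).trans (by linarith)) ((hKB _ hq.1).trans (by linarith))
  have int2 : Integrable (fun q : ℝ × ℝ =>
      |2 * q.2 - q.1| * (φ (0, q.2) * ρ ((q.1 - V (0, q.2)) / ε)))
      ((volume.restrict K).prod (volume.restrict (Ioo (-1 : ℝ) 1))) := by
    refine Integrable.of_bound hmeas2.aestronglyMeasurable ((2 + (R + 1)) * (b * P)) ?_
    rw [Measure.prod_restrict]
    refine (ae_restrict_iff' (measurableSet_Icc.prod measurableSet_Ioo)).2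
      (ae_of_all _ fun q hq => ?_)
    rw [Real.norm_eq_abs, abs_mul, abs_abs, abs_mul (φ _)]
    refine mul_le_mul ?_ (mul_le_mul (hb _).1 (hP _) (abs_nonneg _) hb0) (by positivity)
      (by positivity)
    exact (abs_le_of_abs_two_mul (abs_lt.2 hq.2).le).trans
      (add_le_add le_rfl (hKB _ hq.1))
  have total : 0 ≤ (∫ k in K, ∫ p in domain T, levelIntegrand ρ φ V w ε k p)
      + ∫ k in K, ∫ m in Ioo (-1 : ℝ) 1, |2 * m - k| * (φ (0, m) * ρ ((k - V (0, m)) / ε)) := by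
    rw [← integral_add int1.integral_prod_left int2.integral_prod_left]
    exact integral_nonneg step
  rw [integral_integral_swap (f := fun k p => levelIntegrand ρ φ V w ε k p) int1,
    integral_integral_swap
      (f := fun k m => |2 * m - k| * (φ (0, m) * ρ ((k - V (0, m)) / ε))) int2] at total
  have harg : ∀ v s : ℝ, (v + ε * s - v) / ε = s := by
    intro v s
    field_simp
    ring
  have r1 : ∫ p in domain T, ∫ k in K, levelIntegrand ρ φ V w ε k p
      = ε * ∫ p in domain T, ∫ s in Icc (-1 : ℝ) 1,
        levelIntegrand ρ φ V w ε (V p + ε * s) p := by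
    rw [← integral_const_mul]
    refine setIntegral_congr_fun (measurableSet_domain T) fun p hp => ?_
    refine setIntegral_rescale h0 h1 (hR p (domain_subset T hp)).1 fun s hs => ?_
    rw [levelIntegrand, harg, hρ.zero s hs.le, hρ.deriv_zero hs]
    ring
  have r2 : ∫ m in Ioo (-1 : ℝ) 1, ∫ k in K,
        |2 * m - k| * (φ (0, m) * ρ ((k - V (0, m)) / ε))
      = ε * ∫ m in Ioo (-1 : ℝ) 1, ∫ s in Icc (-1 : ℝ) 1,
          |2 * m - (V (0, m) + ε * s)| * (φ (0, m) * ρ s) := by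
    rw [← integral_const_mul]
    refine setIntegral_congr_fun measurableSet_Ioo fun m hm => ?_
    have hmem : ((0 : ℝ), m) ∈ Icc 0 T ×ˢ Icc (-1 : ℝ) 1 :=
      ⟨⟨le_rfl, hT.le⟩, ⟨hm.1.le, hm.2.le⟩⟩
    refine (setIntegral_rescale h0 h1 (hR _ hmem).1 fun s hs => ?_).trans ?_
    · rw [harg, hρ.zero s hs.le]
      ring
    · simp only [harg]
  -- The substitution yields a common factor `ε`, which is divided out; hence the test functions
  -- carry no factor `1 / ε`.
  rw [r1, r2, ← mul_add] at total
  exact nonneg_of_mul_nonneg_right total h0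

theorem integral_sum_five {α : Type*} [MeasurableSpace α] {μ : Measure α}
    {f₁ f₂ f₃ f₄ f₅ : α → ℝ} (h₁ : Integrable f₁ μ) (h₂ : Integrable f₂ μ)
    (h₃ : Integrable f₃ μ) (h₄ : Integrable f₄ μ) (h₅ : Integrable f₅ μ) :
    ∫ a, (f₁ a + f₂ a + f₃ a + f₄ a - f₅ a) ∂μ
      = ∫ a, f₁ a ∂μ + ∫ a, f₂ a ∂μ + ∫ a, f₃ a ∂μ + ∫ a, f₄ a ∂μ - ∫ a, f₅ a ∂μ := by
  rw [integral_sub (f := fun a => f₁ a + f₂ a + f₃ a + f₄ a) (((h₁.add h₂).add h₃).add h₄) h₅,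
    integral_add (f := fun a => f₁ a + f₂ a + f₃ a) ((h₁.add h₂).add h₃) h₄,
    integral_add (f := fun a => f₁ a + f₂ a) (h₁.add h₂) h₃, integral_add h₁ h₂]

theorem levelIntegral_eq {ρ : ℝ → ℝ} (hρ : IsMollifier ρ) {φ V w : ℝ × ℝ → ℝ} {ε R : ℝ}
    {p : ℝ × ℝ} (h0 : 0 < ε) (h1 : ε ≤ 1) (hm : |p.2| ≤ 1) (hw : |w p| ≤ R)
    (hv : |V p| + 1 ≤ R) :
    ∫ s in Icc (-1 : ℝ) 1, levelIntegrand ρ φ V w ε (V p + ε * s) p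
      = dt φ p * mol ρ (fun k => |w p - k|) (V p) ε
        + φ p * dt V p * dmol ρ (fun k => |w p - k|) (V p) ε
        + dm φ p * mol ρ (fun k => kflux p.2 (w p) k) (V p) ε
        + φ p * dm V p * dmol ρ (fun k => kflux p.2 (w p) k) (V p) ε
        - φ p * mol ρ (fun k => Real.sign (w p - k) * (k * |k| / 2)) (V p) ε := by
  have hk : ∀ h, |h| ≤ 1 → |V p + h| ≤ R := fun h hh => (abs_add_le _ _).trans (by linarith)
  have m1 : Measurable fun k => |w p - k| := by fun_prop
  have m2 : Measurable fun k => kflux p.2 (w p) k :=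
    measurable_kflux.comp (measurable_const.prodMk (measurable_const.prodMk measurable_id))
  have m3 : Measurable fun k => Real.sign (w p - k) * (k * |k| / 2) :=
    (measurable_sign.comp (by fun_prop)).mul (by fun_prop)
  have b1 : ∀ h, |h| ≤ 1 → |(|w p - (V p + h)|)| ≤ 2 * R := fun h hh => by
    rw [abs_abs]
    exact (abs_sub _ _).trans (by linarith [hk h hh])
  have b2 : ∀ h, |h| ≤ 1 → |kflux p.2 (w p) (V p + h)| ≤ 4 * R ^ 2 := fun h hh =>
    abs_kflux_le_sq hm hw (hk h hh)
  have b3 : ∀ h, |h| ≤ 1 →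
      abs (Real.sign (w p - (V p + h)) * ((V p + h) * |V p + h| / 2)) ≤ 1 * R ^ 2 :=
    fun h hh => by
      rw [abs_mul]
      exact mul_le_mul (abs_sign_le _) (abs_mul_abs_half_le (hk h hh)) (abs_nonneg _) zero_le_one
  have cρ := hρ.smooth.continuous
  have cρ' := hρ.continuous_deriv
  have i1 := (integrableOn_mol m1 cρ h0 h1 b1).const_mul (dt φ p)
  have i2 := (integrableOn_mol m1 cρ' h0 h1 b1).const_mul (φ p * dt V p * -ε⁻¹)
  have i3 := (integrableOn_mol m2 cρ h0 h1 b2).const_mul (dm φ p)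
  have i4 := (integrableOn_mol m2 cρ' h0 h1 b2).const_mul (φ p * dm V p * -ε⁻¹)
  have i5 := (integrableOn_mol m3 cρ h0 h1 b3).const_mul (φ p)
  have dm_eq : ∀ g : ℝ → ℝ, dmol ρ g (V p) ε
      = -ε⁻¹ * ∫ s in Icc (-1 : ℝ) 1, g (V p + ε * s) * deriv ρ s := by
    intro g
    rw [dmol, ← integral_const_mul]
    refine integral_congr_ae (ae_of_all _ fun s => ?_)
    simp only
    rw [div_eq_mul_inv]
    ring
  rw [dm_eq, dm_eq, mol, mol, mol, ← mul_assoc, ← mul_assoc, ← integral_const_mul (dt φ p),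
    ← integral_const_mul (φ p * dt V p * -ε⁻¹), ← integral_const_mul (dm φ p),
    ← integral_const_mul (φ p * dm V p * -ε⁻¹), ← integral_const_mul (φ p)]
  rw [← integral_sum_five i1 i2 i3 i4 i5]
  refine integral_congr_ae (ae_of_all _ fun s => ?_)
  have harg : (V p + ε * s - V p) / ε = s := by
    field_simp
    ring
  simp only [levelIntegrand, harg]
  rw [div_eq_mul_inv (dt V p), div_eq_mul_inv (dm V p)]
  ring

theorem measurable_sign_mul (a : ℝ) : Measurable fun k => Real.sign (a - k) * (k * |k| / 2) :=
  (measurable_sign.comp (by fun_prop)).mul (by fun_prop)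

theorem measurable_kflux_right (m a : ℝ) : Measurable fun k => kflux m a k :=
  measurable_kflux.comp (measurable_const.prodMk (measurable_const.prodMk measurable_id))

theorem abs_kflux_add_sub_le {m a v R h : ℝ} (hm : |m| ≤ 1) (ha : |a| ≤ R) (hv : |v| + 1 ≤ R)
    (hh : |h| ≤ 1) : |kflux m a (v + h) - kflux m a v| ≤ 2 * R * |h| := by
  have := abs_kflux_sub_le hm ha (k := v + h) (k' := v) ((abs_add_le _ _).trans (by linarith))
    (by linarith)
  rwa [add_sub_cancel_left] at this

/-- The terms with `ρ` converge to values at `k = V p`, those with `ρ'` to derivatives in `k`.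
Multiplied by `∂V`, the latter combine with the explicit term in `m` into the residual of `V`. -/
theorem tendsto_levelIntegral {ρ : ℝ → ℝ} (hρ : IsMollifier ρ) {φ V w : ℝ × ℝ → ℝ} {R : ℝ}
    {p : ℝ × ℝ} (hm : |p.2| ≤ 1) (hw : |w p| ≤ R) (hv : |V p| + 1 ≤ R) :
    Tendsto (fun ε => ∫ s in Icc (-1 : ℝ) 1, levelIntegrand ρ φ V w ε (V p + ε * s) p) (𝓝[>] 0)
      (𝓝 (|w p - V p| * dt φ p + kflux p.2 (w p) (V p) * dm φ p
        - Real.sign (w p - V p) * (V p * |V p| / 2 + dt V p + fluxZ p.2 (V p) * dm V p)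
          * φ p)) := by
  have hR0 : 0 ≤ R := (abs_nonneg _).trans hw
  have hk : ∀ h, |h| ≤ 1 → |V p + h| ≤ R := fun h hh => (abs_add_le _ _).trans (by linarith)
  have m1 : Measurable fun k => |w p - k| := by fun_prop
  have m2 := measurable_kflux_right p.2 (w p)
  have m3 := measurable_sign_mul (w p)
  have b1 : ∀ h, |h| ≤ 1 → |(|w p - (V p + h)|)| ≤ 2 * R := fun h hh => by
    rw [abs_abs]
    exact (abs_sub _ _).trans (by linarith [hk h hh])
  have b2 : ∀ h, |h| ≤ 1 → |kflux p.2 (w p) (V p + h)| ≤ 4 * R ^ 2 := fun h hh =>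
    abs_kflux_le_sq hm hw (hk h hh)
  have b3 : ∀ h, |h| ≤ 1 →
      abs (Real.sign (w p - (V p + h)) * ((V p + h) * |V p + h| / 2)) ≤ 1 * R ^ 2 :=
    fun h hh => by
      rw [abs_mul]
      exact mul_le_mul (abs_sign_le _) (abs_mul_abs_half_le (hk h hh)) (abs_nonneg _) zero_le_one
  have l1 : ∀ h, |h| ≤ 1 → |(|w p - (V p + h)| - |w p - V p|)| ≤ 1 * |h| := fun h _ => by
    refine (abs_abs_sub_abs_le _ _).trans ?_
    rw [show w p - (V p + h) - (w p - V p) = -h by ring, abs_neg, one_mul]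
  have l2 : ∀ h, |h| ≤ 1 → |kflux p.2 (w p) (V p + h) - kflux p.2 (w p) (V p)| ≤ 2 * R * |h| :=
    fun h hh => abs_kflux_add_sub_le hm hw hv hh
  obtain ⟨c1, d1⟩ := exists_hasDerivAt_abs_sub (w p) (V p)
  obtain ⟨c2, d2⟩ := exists_hasDerivAt_kflux p.2 (w p) (V p)
  obtain ⟨c3, d3⟩ := exists_tendsto_sign_mul (w p) (V p)
  have t1 : Tendsto (mol ρ (fun k => |w p - k|) (V p)) (𝓝[>] 0) (𝓝 |w p - V p|) := by
    refine tendsto_mol (c := 0) hρ m1 b1 ?_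
    have : Tendsto (fun h => |w p - (V p + h)| - 0 * Real.sign h) (𝓝 0)
        (𝓝 (|w p - (V p + 0)|)) := by
      simp only [zero_mul, sub_zero]
      exact Continuous.tendsto (by fun_prop) 0
    rwa [add_zero] at this
  have t2 : Tendsto (mol ρ (fun k => kflux p.2 (w p) k) (V p)) (𝓝[>] 0)
      (𝓝 (kflux p.2 (w p) (V p))) := by
    refine tendsto_mol (c := 0) hρ m2 b2 ?_
    simp only [zero_mul, sub_zero]
    rw [tendsto_iff_norm_sub_tendsto_zero]
    have h0 : Tendsto (fun h : ℝ => 2 * R * |h|) (𝓝 0) (𝓝 (2 * R * |0|)) :=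
      Continuous.tendsto (by fun_prop) 0
    rw [abs_zero, mul_zero] at h0
    refine squeeze_zero' (Eventually.of_forall fun _ => norm_nonneg _) ?_ h0
    have : ∀ᶠ h : ℝ in 𝓝 0, |h| < 1 := by
      have hc : Tendsto (fun h : ℝ => |h|) (𝓝 0) (𝓝 |0|) := Continuous.tendsto (by fun_prop) 0
      rw [abs_zero] at hc
      exact hc.eventually (gt_mem_nhds zero_lt_one)
    filter_upwards [this] with h hh using l2 h hh.le
  have t3 := tendsto_mol hρ m3 b3 d3
  have t4 := tendsto_dmol hρ m1 zero_le_one b1 l1 d1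
  have t5 := tendsto_dmol hρ m2 (by positivity) b2 l2 d2
  have tot := ((((t1.const_mul (dt φ p)).add (t4.const_mul (φ p * dt V p))).add
    (t2.const_mul (dm φ p))).add (t5.const_mul (φ p * dm V p))).sub (t3.const_mul (φ p))
  have e : dt φ p * |w p - V p| + φ p * dt V p * -Real.sign (w p - V p)
      + dm φ p * kflux p.2 (w p) (V p)
      + φ p * dm V p * -(Real.sign (w p - V p) * fluxZ p.2 (V p))
      - φ p * (Real.sign (w p - V p) * (V p * |V p| / 2))
      = |w p - V p| * dt φ p + kflux p.2 (w p) (V p) * dm φ p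
        - Real.sign (w p - V p) * (V p * |V p| / 2 + dt V p + fluxZ p.2 (V p) * dm V p)
          * φ p := by ring
  rw [e] at tot
  refine tot.congr' ?_
  filter_upwards [Ioc_mem_nhdsGT (zero_lt_one (α := ℝ))] with ε hε
  exact (levelIntegral_eq hρ hε.1 hε.2 hm hw hv).symm

/-- A bound free of `ε`, for dominated convergence: Lipschitz continuity in `k` absorbs the factor
`1 / ε` in front of `ρ'`. -/
theorem abs_levelIntegral_le {ρ : ℝ → ℝ} (hρ : IsMollifier ρ) {φ V w : ℝ × ℝ → ℝ}
    {ε b P Q R : ℝ} {p : ℝ × ℝ} (h0 : 0 < ε) (h1 : ε ≤ 1) (hm : |p.2| ≤ 1) (hw : |w p| ≤ R)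
    (hv : |V p| + 1 ≤ R) (hb : |φ p| ≤ b ∧ |dt φ p| ≤ b ∧ |dm φ p| ≤ b) (hP : ∀ s, |ρ s| ≤ P)
    (hP' : ∀ s, |deriv ρ s| ≤ P) (hQ : |dt V p| ≤ Q ∧ |dm V p| ≤ Q) :
    |∫ s in Icc (-1 : ℝ) 1, levelIntegrand ρ φ V w ε (V p + ε * s) p|
      ≤ b * (2 * R * P * 2) + b * Q * (1 * P * 2) + b * (4 * R ^ 2 * P * 2)
        + b * Q * (2 * R * P * 2) + b * (1 * R ^ 2 * P * 2) := by
  have hR0 : 0 ≤ R := (abs_nonneg _).trans hw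
  have hb0 : 0 ≤ b := (abs_nonneg _).trans hb.1
  have hQ0 : 0 ≤ Q := (abs_nonneg _).trans hQ.1
  have hP0 : 0 ≤ P := (abs_nonneg _).trans (hP 0)
  have hk : ∀ h, |h| ≤ 1 → |V p + h| ≤ R := fun h hh => (abs_add_le _ _).trans (by linarith)
  have m1 : Measurable fun k => |w p - k| := by fun_prop
  have m2 := measurable_kflux_right p.2 (w p)
  have b1 : ∀ h, |h| ≤ 1 → |(|w p - (V p + h)|)| ≤ 2 * R := fun h hh => by
    rw [abs_abs]
    exact (abs_sub _ _).trans (by linarith [hk h hh])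
  have b2 : ∀ h, |h| ≤ 1 → |kflux p.2 (w p) (V p + h)| ≤ 4 * R ^ 2 := fun h hh =>
    abs_kflux_le_sq hm hw (hk h hh)
  have b3 : ∀ h, |h| ≤ 1 →
      abs (Real.sign (w p - (V p + h)) * ((V p + h) * |V p + h| / 2)) ≤ 1 * R ^ 2 :=
    fun h hh => by
      rw [abs_mul]
      exact mul_le_mul (abs_sign_le _) (abs_mul_abs_half_le (hk h hh)) (abs_nonneg _) zero_le_one
  have l1 : ∀ h, |h| ≤ 1 → |(|w p - (V p + h)| - |w p - V p|)| ≤ 1 * |h| := fun h _ => by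
    refine (abs_abs_sub_abs_le _ _).trans ?_
    rw [show w p - (V p + h) - (w p - V p) = -h by ring, abs_neg, one_mul]
  have l2 : ∀ h, |h| ≤ 1 → |kflux p.2 (w p) (V p + h) - kflux p.2 (w p) (V p)| ≤ 2 * R * |h| :=
    fun h hh => abs_kflux_add_sub_le hm hw hv hh
  rw [levelIntegral_eq hρ h0 h1 hm hw hv]
  have e1 := abs_mol_le (g := fun k => |w p - k|) h0 h1 hP b1
  have e2 := abs_dmol_le hρ m1 h0 h1 hP' zero_le_one b1 l1
  have e3 := abs_mol_le (g := fun k => kflux p.2 (w p) k) h0 h1 hP b2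
  have e4 := abs_dmol_le hρ m2 h0 h1 hP' (by positivity) b2 l2
  have e5 := abs_mol_le (g := fun k => Real.sign (w p - k) * (k * |k| / 2)) h0 h1 hP b3
  have q1 : |φ p * dt V p| ≤ b * Q := by
    rw [abs_mul]
    exact mul_le_mul hb.1 hQ.1 (abs_nonneg _) hb0
  have q2 : |φ p * dm V p| ≤ b * Q := by
    rw [abs_mul]
    exact mul_le_mul hb.1 hQ.2 (abs_nonneg _) hb0
  have hmul : ∀ x y X Y : ℝ, 0 ≤ X → |x| ≤ X → |y| ≤ Y → |x * y| ≤ X * Y := by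
    intro x y X Y hX hx hy
    rw [abs_mul]
    exact mul_le_mul hx hy (abs_nonneg _) hX
  refine (abs_sub _ _).trans (add_le_add ((abs_add_le _ _).trans (add_le_add
    ((abs_add_le _ _).trans (add_le_add ((abs_add_le _ _).trans (add_le_add ?_ ?_)) ?_)) ?_)) ?_)
  · exact hmul _ _ _ _ hb0 hb.2.1 e1
  · exact hmul _ _ _ _ (by positivity) q1 e2
  · exact hmul _ _ _ _ hb0 hb.2.2 e3
  · exact hmul _ _ _ _ (by positivity) q2 e4
  · exact hmul _ _ _ _ hb0 hb.1 e5

/-- The factor of the sign is the residual `V_t + ∂_m (G (m, V))`. It vanishes where `V` is a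
classical solution, and the inequality then compares `w` with `V` directly. -/
theorem kruzhkov_smooth {T B : ℝ} (hT : 0 < T) {w : ℝ × ℝ → ℝ} (hw : Measurable w)
    (hB : ∀ p, |w p| ≤ B) (hE : EntropyIneq T w) {V φ : ℝ × ℝ → ℝ} (hV : ContDiff ℝ ∞ V)
    (hφ : IsTest T φ) (hpos : ∀ p, 0 ≤ φ p) :
    0 ≤ (∫ p in domain T, (|w p - V p| * dt φ p + kflux p.2 (w p) (V p) * dm φ p
        - Real.sign (w p - V p) * (V p * |V p| / 2 + dt V p + fluxZ p.2 (V p) * dm V p) * φ p))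
      + ∫ m in Ioo (-1 : ℝ) 1, |2 * m - V (0, m)| * φ (0, m) := by
  obtain ⟨ρ, hρ⟩ := exists_isMollifier
  have hle : (1 : WithTop ℕ∞) ≤ ∞ := by exact_mod_cast le_top
  have hV1 : ContDiff ℝ 1 V := hV.of_le hle
  obtain ⟨b, hb0, hb⟩ := hφ.bounds
  obtain ⟨P, hP0, hP, hP'⟩ := hρ.exists_bound
  obtain ⟨Q, hQ0, hQ⟩ := exists_bounds_on_domain hV1 T
  have hB0 : 0 ≤ B := (abs_nonneg _).trans (hB (0, 0))
  set R := B + Q + 1 with hR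
  have hR0 : 0 ≤ R := by positivity
  have hsmall : ∀ᶠ ε : ℝ in 𝓝[>] 0, 0 < ε ∧ ε ≤ 1 :=
    Ioc_mem_nhdsGT (zero_lt_one (α := ℝ))
  have cφ := hφ.smooth.continuous
  have cρ := hρ.smooth.continuous
  have cV := hV.continuous
  have lim1 : Tendsto (fun ε => ∫ p in domain T, ∫ s in Icc (-1 : ℝ) 1,
      levelIntegrand ρ φ V w ε (V p + ε * s) p) (𝓝[>] 0)
      (𝓝 (∫ p in domain T, (|w p - V p| * dt φ p + kflux p.2 (w p) (V p) * dm φ p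
        - Real.sign (w p - V p) * (V p * |V p| / 2 + dt V p + fluxZ p.2 (V p) * dm V p)
          * φ p))) := by
    refine tendsto_integral_filter_of_dominated_convergence
      (fun _ => b * (2 * R * P * 2) + b * Q * (1 * P * 2) + b * (4 * R ^ 2 * P * 2)
        + b * Q * (2 * R * P * 2) + b * (1 * R ^ 2 * P * 2)) ?_ ?_ (integrable_const _) ?_
    · refine Eventually.of_forall fun ε => StronglyMeasurable.aestronglyMeasurable ?_
      refine StronglyMeasurable.integral_prod_right
        (f := fun p s => levelIntegrand ρ φ V w ε (V p + ε * s) p) ?_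
      exact (measurable_levelIntegrand hρ hφ.contDiff_one hV1 hw ε
        (k := fun q : (ℝ × ℝ) × ℝ => V q.1 + ε * q.2)
        ((cV.measurable.comp measurable_fst).add (measurable_snd.const_mul ε))
        measurable_fst).stronglyMeasurable
    · filter_upwards [hsmall] with ε hε
      refine (ae_restrict_iff' (measurableSet_domain T)).2 (ae_of_all _ fun p hp => ?_)
      have h2 := hQ p (domain_subset T hp)
      exact abs_levelIntegral_le (R := R) hρ hε.1 hε.2 (abs_lt.2 hp.2).le ((hB p).trans (by linarith))
        (by linarith [h2.1]) (hb p) hP hP' h2.2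
    · refine (ae_restrict_iff' (measurableSet_domain T)).2 (ae_of_all _ fun p hp => ?_)
      have h2 := hQ p (domain_subset T hp)
      exact tendsto_levelIntegral (R := R) hρ (abs_lt.2 hp.2).le ((hB p).trans (by linarith))
        (by linarith [h2.1])
  have lim2 : Tendsto (fun ε => ∫ m in Ioo (-1 : ℝ) 1, ∫ s in Icc (-1 : ℝ) 1,
      |2 * m - (V (0, m) + ε * s)| * (φ (0, m) * ρ s)) (𝓝[>] 0)
      (𝓝 (∫ m in Ioo (-1 : ℝ) 1, |2 * m - V (0, m)| * φ (0, m))) := by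
    have heq : ∀ ε m, (∫ s in Icc (-1 : ℝ) 1, |2 * m - (V (0, m) + ε * s)| * (φ (0, m) * ρ s))
        = φ (0, m) * mol ρ (fun k => |2 * m - k|) (V (0, m)) ε := by
      intro ε m
      rw [mol, ← integral_const_mul]
      refine integral_congr_ae (ae_of_all _ fun s => ?_)
      simp only
      ring
    have hbd : ∀ m ∈ Ioo (-1 : ℝ) 1, ∀ h, |h| ≤ 1 →
        |(|2 * m - (V (0, m) + h)|)| ≤ 2 + (Q + 1) := by
      intro m hm h hh
      have hmem : ((0 : ℝ), m) ∈ Icc 0 T ×ˢ Icc (-1 : ℝ) 1 :=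
        ⟨⟨le_rfl, hT.le⟩, ⟨hm.1.le, hm.2.le⟩⟩
      rw [abs_abs]
      refine (abs_le_of_abs_two_mul (abs_lt.2 hm).le).trans (add_le_add le_rfl ?_)
      exact (abs_add_le _ _).trans (add_le_add (hQ _ hmem).1 hh)
    refine tendsto_integral_filter_of_dominated_convergence
      (fun _ => b * ((2 + (Q + 1)) * P * 2)) ?_ ?_ (integrable_const _) ?_
    · refine Eventually.of_forall fun ε => StronglyMeasurable.aestronglyMeasurable ?_
      refine StronglyMeasurable.integral_prod_right
        (f := fun m s => |2 * m - (V (0, m) + ε * s)| * (φ (0, m) * ρ s)) ?_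
      refine Continuous.stronglyMeasurable ?_
      simp only [Function.uncurry_def]
      fun_prop
    · filter_upwards [hsmall] with ε hε
      refine (ae_restrict_iff' measurableSet_Ioo).2 (ae_of_all _ fun m hm => ?_)
      rw [heq, Real.norm_eq_abs, abs_mul]
      exact mul_le_mul (hb _).1 (abs_mol_le hε.1 hε.2 hP (hbd m hm)) (abs_nonneg _) hb0
    · refine (ae_restrict_iff' measurableSet_Ioo).2 (ae_of_all _ fun m hm => ?_)
      simp only [heq]
      rw [mul_comm |2 * m - V (0, m)|]
      refine Tendsto.const_mul _ ?_
      refine tendsto_mol (c := 0) hρ (by fun_prop) (hbd m hm) ?_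
      have : Tendsto (fun h => |2 * m - (V (0, m) + h)| - 0 * Real.sign h) (𝓝 0)
          (𝓝 (|2 * m - (V (0, m) + 0)|)) := by
        simp only [zero_mul, sub_zero]
        exact Continuous.tendsto (by fun_prop) 0
      rwa [add_zero] at this
  refine ge_of_tendsto (lim1.add lim2) ?_
  filter_upwards [hsmall] with ε hε
  exact integrated_entropy hT hw hB hE hρ hV hφ hpos hε.1 hε.2

/-! ### Uniqueness -/

theorem tendsto_layer_of_bdd {Q : ℝ → ℝ → ℝ} {Q₀ : ℝ → ℝ} {T C c : ℝ} (hc : |c| = 1)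
    (hm : Measurable fun p : ℝ × ℝ => Q p.1 p.2) (hC0 : 0 ≤ C)
    (hC : ∀ t ∈ Ioo 0 T, ∀ m ∈ Ioo (-1 : ℝ) 1, |Q t m| ≤ C)
    (hQ : ∀ t ∈ Ioo 0 T, Tendsto (fun h => Q t (c * h)) (𝓝[>] 0) (𝓝 (Q₀ t))) :
    Tendsto (fun d => ∫ p in domain T, Q p.1 p.2 * (deriv kap (c * p.2 / d) * (1 / d))) (𝓝[>] 0)
      (𝓝 ((∫ t in Ioo 0 T, Q₀ t) * ∫ y in Icc (1 : ℝ) 2, deriv kap y)) := by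
  have h := tendsto_layer (Q := fun t m => (domain T).indicator (fun p => Q p.1 p.2) (t, m))
    (Q₀ := Q₀) (T := T) (C := C) hc (hm.indicator (measurableSet_domain T)) (fun t m => by
      by_cases hp : (t, m) ∈ domain T
      · rw [indicator_of_mem hp]
        exact hC t hp.1 m hp.2
      · rw [indicator_of_notMem hp, abs_zero]
        exact hC0) (fun t ht => by
      refine (hQ t ht).congr' ?_
      filter_upwards [Ioo_mem_nhdsGT (zero_lt_one (α := ℝ))] with h hh
      have hmem : (t, c * h) ∈ domain T := by
        refine ⟨ht, abs_lt.1 ?_⟩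
        rw [abs_mul, hc, one_mul, abs_of_pos hh.1]
        exact hh.2
      rw [indicator_of_mem hmem])
  refine h.congr fun d => setIntegral_congr_fun (measurableSet_domain T) fun p hp => ?_
  simp only [Prod.mk.eta, indicator_of_mem hp]

/-! ### Cut-offs for the bulk, the ends and the layer at `m = 0` -/

/-- The cut-off function of the two ends of the space interval. -/
def ends (d m : ℝ) : ℝ := kap ((1 - m) / d) + kap ((1 + m) / d) - 1

theorem contDiff_ends (d : ℝ) : ContDiff ℝ ∞ (ends d) := by
  unfold ends
  exact ((contDiff_kap.comp ((contDiff_const.sub contDiff_id).div_const d)).add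
    (contDiff_kap.comp ((contDiff_const.add contDiff_id).div_const d))).sub contDiff_const

theorem hasDerivAt_ends (d m : ℝ) : HasDerivAt (ends d)
    (deriv kap ((1 - m) / d) * (-1 / d) + deriv kap ((1 + m) / d) * (1 / d)) m := by
  have h1 : HasDerivAt (fun m => kap ((1 - m) / d)) (deriv kap ((1 - m) / d) * (-1 / d)) m :=
    (hasDerivAt_kap _).comp m (((hasDerivAt_id m).const_sub 1).div_const d)
  have h2 : HasDerivAt (fun m => kap ((1 + m) / d)) (deriv kap ((1 + m) / d) * (1 / d)) m :=
    (hasDerivAt_kap _).comp m (((hasDerivAt_id m).const_add 1).div_const d)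
  exact (h1.add h2).sub_const 1

theorem ends_of_le {d m : ℝ} (hd : 0 < d) (h : |m| ≤ 1 - 2 * d) : ends d m = 1 := by
  have := abs_le.1 h
  rw [ends, kap_of_ge, kap_of_ge]
  · ring
  · rw [le_div_iff₀ hd]
    linarith
  · rw [le_div_iff₀ hd]
    linarith

theorem ends_of_ge {d m : ℝ} (hd : 0 < d) (hd' : d ≤ 1 / 4) (h : 1 - d ≤ |m|) : ends d m = 0 := by
  rcases le_total 0 m with h1 | h1
  · rw [abs_of_nonneg h1] at h
    rw [ends, kap_of_le, kap_of_ge]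
    · ring
    · rw [le_div_iff₀ hd]
      linarith
    · rw [div_le_one hd]
      linarith
  · rw [abs_of_nonpos h1] at h
    rw [ends, kap_of_ge, kap_of_le]
    · ring
    · rw [div_le_one hd]
      linarith
    · rw [le_div_iff₀ hd]
      linarith

theorem ends_mem {d : ℝ} (hd : 0 < d) (hd' : d ≤ 1 / 4) (m : ℝ) : ends d m ∈ Icc (0 : ℝ) 1 := by
  rcases le_total 0 m with h1 | h1
  · have : kap ((1 + m) / d) = 1 := kap_of_ge (by rw [le_div_iff₀ hd]; linarith)
    rw [ends, this, add_sub_cancel_right]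
    exact ⟨kap_nonneg _, kap_le_one _⟩
  · have : kap ((1 - m) / d) = 1 := kap_of_ge (by rw [le_div_iff₀ hd]; linarith)
    rw [ends, this, add_sub_cancel_left]
    exact ⟨kap_nonneg _, kap_le_one _⟩

/-- The cut-off function of the neighbourhoods of `-1`, `0` and `1`. -/
def bulk (d m : ℝ) : ℝ := ends d m + off d m - 1

theorem contDiff_bulk (d : ℝ) : ContDiff ℝ ∞ (bulk d) :=
  ((contDiff_ends d).add (contDiff_off d)).sub contDiff_const

/-- For `d ≤ 1/4` the regions where `ends` and `off` differ from `1` do not overlap, so at each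
point one of the two summands is `1`. -/
theorem bulk_mem {d : ℝ} (hd : 0 < d) (hd' : d ≤ 1 / 4) (m : ℝ) : bulk d m ∈ Icc (0 : ℝ) 1 := by
  rcases le_total (2 * d) |m| with h | h
  · rw [bulk, off_of_ge hd h, add_sub_cancel_right]
    exact ends_mem hd hd' m
  · rw [bulk, ends_of_le hd (by linarith), add_sub_cancel_left]
    exact off_mem hd m

theorem bulk_of_notMem {d m : ℝ} (hd : 0 < d) (hd' : d ≤ 1 / 4)
    (h : m ∉ {m : ℝ | d ≤ |m| ∧ |m| ≤ 1 - d}) : bulk d m = 0 := by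
  by_cases h1 : d ≤ |m|
  · have h2 : 1 - d < |m| := by
      by_contra hc
      exact h ⟨h1, not_lt.1 hc⟩
    rw [bulk, ends_of_ge hd hd' h2.le, off_of_ge hd (by linarith)]
    ring
  · have h1 := not_le.1 h1
    rw [bulk, ends_of_le hd (by linarith), off_of_le hd h1.le]
    ring

theorem bulk_of_mem {d m : ℝ} (hd : 0 < d) (h : 2 * d ≤ |m|)
    (h' : |m| ≤ 1 - 2 * d) : bulk d m = 1 := by
  rw [bulk, ends_of_le hd h', off_of_ge hd h]
  ring

theorem isCompact_annulus (d : ℝ) : IsCompact {m : ℝ | d ≤ |m| ∧ |m| ≤ 1 - d} := by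
  refine (isCompact_Icc (a := -(1 - d)) (b := 1 - d)).of_isClosed_subset ?_ fun m hm => ?_
  · exact (isClosed_le continuous_const continuous_abs).inter
      (isClosed_le continuous_abs continuous_const)
  · exact abs_le.1 hm.2

theorem tendsto_bulk {m : ℝ} (hm : m ≠ 0) (hm' : |m| < 1) :
    Tendsto (fun d => bulk d m) (𝓝[>] 0) (𝓝 1) := by
  refine tendsto_const_nhds.congr' ?_
  have h1 : 0 < |m| / 2 := by positivity
  have h2 : 0 < (1 - |m|) / 2 := by linarith
  filter_upwards [Ioc_mem_nhdsGT h1, Ioc_mem_nhdsGT h2] with d hd hd'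
  exact (bulk_of_mem hd.1 (by linarith [hd.2]) (by linarith [hd'.2])).symm

theorem isTest_separable {T T' : ℝ} (hT : T' < T) {θ g : ℝ → ℝ} (hθ : ContDiff ℝ ∞ θ)
    (hθ0 : ∀ t, T' ≤ t → θ t = 0) (hg : ContDiff ℝ ∞ g) {s : Set ℝ} (hs : IsCompact s)
    (hs' : s ⊆ Ioo (-1) 1) (hg0 : ∀ m, m ∉ s → g m = 0) :
    IsTest T fun p => θ p.1 * weight g p := by
  have hz : ∀ p : ℝ × ℝ, p ∉ Icc (-1 / 2) T' ×ˢ s → θ p.1 * weight g p = 0 := by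
    intro p hp
    by_cases h1 : T' ≤ p.1
    · rw [hθ0 _ h1, zero_mul]
    by_cases h2 : p.1 ≤ -1 / 2
    · rw [weight, past_of_le h2, zero_mul, mul_zero]
    · rw [weight, hg0, mul_zero, mul_zero]
      intro h3
      exact hp ⟨⟨(not_le.1 h2).le, (not_le.1 h1).le⟩, h3⟩
  have hK : IsCompact (Icc (-1 / 2) T' ×ˢ s) := isCompact_Icc.prod hs
  refine ⟨(hθ.comp contDiff_fst).mul (contDiff_weight hg), HasCompactSupport.intro hK hz, ?_⟩
  refine (closure_minimal (fun p hp => ?_) hK.isClosed).trans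
    (prod_mono (fun t ht => lt_of_le_of_lt ht.2 hT) hs')
  by_contra hc
  exact hp (hz p hc)

theorem dt_separable {θ g : ℝ → ℝ} (hθ : ContDiff ℝ ∞ θ) (hg : ContDiff ℝ ∞ g) {p : ℝ × ℝ}
    (hp : 0 < p.1) : dt (fun p => θ p.1 * weight g p) p = deriv θ p.1 * g p.2 := by
  have hd : ContDiff ℝ ∞ fun p : ℝ × ℝ => θ p.1 := hθ.comp contDiff_fst
  exact dt_mul_weight (φ := fun p => θ p.1) hg (hd.differentiable (by simp) p) hp

theorem dm_separable {θ g : ℝ → ℝ} (hθ : ContDiff ℝ ∞ θ) (hg : ContDiff ℝ ∞ g) {g' : ℝ}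
    {p : ℝ × ℝ} (hp : 0 < p.1) (hg' : HasDerivAt g g' p.2) :
    dm (fun p => θ p.1 * weight g p) p = θ p.1 * g' := by
  have hd : ContDiff ℝ ∞ fun p : ℝ × ℝ => θ p.1 := hθ.comp contDiff_fst
  have h := dm_mul_weight (φ := fun p => θ p.1) hg (hd.differentiable (by simp) p) hp hg'
  have e : dm (fun p : ℝ × ℝ => θ p.1) p = 0 := deriv_const p.2 (θ p.1)
  rw [h, e, zero_mul, zero_add]

/-- A globally smooth function equal to `Z` where `|m|` is not close to `0` or `1`. -/
def cutZ (d : ℝ) (p : ℝ × ℝ) : ℝ := kap (4 * p.1 + 4) * bulk (d / 4) p.2 * Zs p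

theorem contDiff_cutZ {d : ℝ} (hd : 0 < d) (hd' : d ≤ 1 / 4) : ContDiff ℝ ∞ (cutZ d) := by
  have hc : ContDiff ℝ ∞ fun p : ℝ × ℝ => kap (4 * p.1 + 4) * bulk (d / 4) p.2 :=
    (contDiff_kap.comp ((contDiff_const.mul contDiff_fst).add contDiff_const)).mul
      ((contDiff_bulk _).comp contDiff_snd)
  refine contDiff_of_tsupport fun p hp => ?_
  have hsub : tsupport (cutZ d) ⊆ Ici (-3 / 4) ×ˢ {m : ℝ | d / 4 ≤ |m| ∧ |m| ≤ 1 - d / 4} := by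
    refine closure_minimal (fun q hq => ?_) (isClosed_Ici.prod (isCompact_annulus _).isClosed)
    refine ⟨?_, ?_⟩
    · by_contra h
      have h : q.1 < -3 / 4 := not_le.1 h
      exact hq (by rw [cutZ, kap_of_le (by linarith), zero_mul, zero_mul])
    · by_contra h
      exact hq (by rw [cutZ, bulk_of_notMem (by linarith) (by linarith) h, mul_zero, zero_mul])
  have hmem := hsub hp
  have h1 : -3 / 4 ≤ p.1 := hmem.1
  have h2 : d / 4 ≤ |p.2| := hmem.2.1
  have h3 : |p.2| ≤ 1 - d / 4 := hmem.2.2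
  refine hc.contDiffAt.mul (contDiffAt_Zs (by linarith) ?_ (abs_lt.1 (by linarith)))
  intro h0
  rw [h0, abs_zero] at h2
  linarith

/-- The parameter `d / 4` inside `cutZ` leaves a margin: its cut-offs are `1` for `t ≥ -1/2`, `d / 2
≤ |m| ≤ 1 - d / 2`. The agreement holds on a neighbourhood, hence for the derivatives as well. -/
theorem eventually_cutZ_eq {d : ℝ} (hd : 0 < d) {p : ℝ × ℝ} (ht : 0 ≤ p.1)
    (h1 : d ≤ |p.2|) (h2 : |p.2| ≤ 1 - d) : cutZ d =ᶠ[𝓝 p] Zs := by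
  have hop : IsOpen {q : ℝ × ℝ | -1 / 2 < q.1 ∧ d / 2 < |q.2| ∧ |q.2| < 1 - d / 2} :=
    (isOpen_lt continuous_const continuous_fst).inter
      ((isOpen_lt continuous_const continuous_snd.abs).inter
        (isOpen_lt continuous_snd.abs continuous_const))
  filter_upwards [hop.mem_nhds (show p ∈ _ from ⟨by linarith, by linarith, by linarith⟩)]
    with q hq
  rw [cutZ, kap_of_ge (by linarith [hq.1]), bulk_of_mem (by linarith) (by linarith [hq.2.1])
    (by linarith [hq.2.2])]
  ring

theorem dt_congr {f g : ℝ × ℝ → ℝ} {p : ℝ × ℝ} (h : f =ᶠ[𝓝 p] g) : dt f p = dt g p := by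
  have hc : ContinuousAt (fun s : ℝ => (s, p.2)) p.1 := by fun_prop
  have h2 : (fun t => f (t, p.2)) =ᶠ[𝓝 p.1] fun t => g (t, p.2) := hc.eventually h
  exact h2.deriv_eq

theorem dm_congr {f g : ℝ × ℝ → ℝ} {p : ℝ × ℝ} (h : f =ᶠ[𝓝 p] g) : dm f p = dm g p := by
  have hc : ContinuousAt (fun s : ℝ => (p.1, s)) p.2 := by fun_prop
  have h2 : (fun t => f (p.1, t)) =ᶠ[𝓝 p.2] fun t => g (p.1, t) := hc.eventually h
  exact h2.deriv_eq

/-- The comparison function is `cutZ d`, which equals `Z` wherever the test function lives. Its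
residual and the initial difference vanish there, leaving only the time derivative and the
derivatives of the cut-offs. -/
theorem kruzhkov_bulk {T T' B : ℝ} (hT : 0 < T) (hT' : T' < T) {w : ℝ × ℝ → ℝ}
    (hw : Measurable w) (hB : ∀ p, |w p| ≤ B) (hE : EntropyIneq T w) {θ : ℝ → ℝ}
    (hθ : ContDiff ℝ ∞ θ) (hθ0 : ∀ t, T' ≤ t → θ t = 0) (hθp : ∀ t, 0 ≤ θ t) {d : ℝ}
    (hd : 0 < d) (hd' : d ≤ 1 / 4) :
    0 ≤ ∫ p in domain T, (|w p - Zm p| * (deriv θ p.1 * bulk d p.2)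
      + kflux p.2 (w p) (Zm p) * (θ p.1
        * (deriv kap ((1 - p.2) / d) * (-1 / d) + deriv kap ((1 + p.2) / d) * (1 / d)
        + (deriv kap (1 * p.2 / d) * (1 / d) + deriv kap (-1 * p.2 / d) * (-1 / d))))) := by
  have hsub : {m : ℝ | d ≤ |m| ∧ |m| ≤ 1 - d} ⊆ Ioo (-1) 1 := fun m hm =>
    abs_lt.1 (by linarith [show |m| ≤ 1 - d from hm.2])
  have hφ := isTest_separable hT' hθ hθ0 (contDiff_bulk d) (isCompact_annulus d) hsub
    fun m hm => bulk_of_notMem hd hd' hm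
  have hder : ∀ m, HasDerivAt (bulk d) (deriv kap ((1 - m) / d) * (-1 / d)
      + deriv kap ((1 + m) / d) * (1 / d)
      + (deriv kap (1 * m / d) * (1 / d) + deriv kap (-1 * m / d) * (-1 / d))) m := fun m =>
    ((hasDerivAt_ends d m).add (hasDerivAt_off d m)).sub_const 1
  have h := kruzhkov_smooth hT hw hB hE (contDiff_cutZ hd hd') hφ fun p =>
    mul_nonneg (hθp _) (mul_nonneg (past_mem _).1 (bulk_mem hd hd' _).1)
  have hinit : ∫ m in Ioo (-1 : ℝ) 1, |2 * m - cutZ d (0, m)|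
      * (θ (0, m).1 * weight (bulk d) (0, m)) = 0 := by
    refine (setIntegral_congr_fun (g := fun _ => (0 : ℝ)) measurableSet_Ioo fun m hm => ?_).trans
      (by simp)
    by_cases hmem : m ∈ {m : ℝ | d ≤ |m| ∧ |m| ≤ 1 - d}
    · have e := (eventually_cutZ_eq (p := (0, m)) hd le_rfl hmem.1 hmem.2).self_of_nhds
      rw [e, Zs, Zstar_initial ⟨hm.1.le, hm.2.le⟩]
      simp
    · rw [weight, bulk_of_notMem hd hd' hmem]
      simp
  rw [hinit, add_zero] at h
  refine h.trans_eq (setIntegral_congr_fun (measurableSet_domain T) fun p hp => ?_)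
  by_cases hmem : p.2 ∈ {m : ℝ | d ≤ |m| ∧ |m| ≤ 1 - d}
  · have e := eventually_cutZ_eq hd hp.1.1.le hmem.1 hmem.2
    have hne : p.2 ≠ 0 := by
      intro h0
      have h1 : d ≤ |p.2| := hmem.1
      rw [h0, abs_zero] at h1
      linarith
    have hpde : dt Zs p + Zs p * |Zs p| / 2 + fluxZ p.2 (Zs p) * dm Zs p = 0 :=
      Zstar_pde (by linarith [hp.1.1]) hne hp.2.1 hp.2.2
    rw [dt_separable hθ (contDiff_bulk d) hp.1.1, dm_separable hθ (contDiff_bulk d) hp.1.1 (hder _),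
      dt_congr e, dm_congr e, e.self_of_nhds, Zm_eq hp.1.1 hp.2,
      show Zs p * |Zs p| / 2 + dt Zs p + fluxZ p.2 (Zs p) * dm Zs p = 0 by linarith]
    ring
  -- Outside the closed annulus the cut-off vanishes near the point, so its derivative, written out
  -- as a sum, is zero too.
  · have hev : bulk d =ᶠ[𝓝 p.2] fun _ => 0 := by
      filter_upwards [(isCompact_annulus d).isClosed.isOpen_compl.mem_nhds hmem] with m hm
      exact bulk_of_notMem hd hd' hm
    have hd0 := (hder p.2).unique ((hasDerivAt_const p.2 (0 : ℝ)).congr_of_eventuallyEq hev)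
    rw [dt_separable hθ (contDiff_bulk d) hp.1.1, dm_separable hθ (contDiff_bulk d) hp.1.1 (hder _),
      hd0, weight, hev.self_of_nhds]
    ring

/-- The comparison function depends on time only and the test function is concentrated in `|m| ≤ 2
d`. Its purpose is the flux term, which has the opposite sign to the one of the bulk at `m = 0` and
does not vanish with `d`. -/
theorem kruzhkov_layer {T T' B : ℝ} (hT : 0 < T) (hT' : T' < T) {w : ℝ × ℝ → ℝ}
    (hw : Measurable w) (hB : ∀ p, |w p| ≤ B) (hE : EntropyIneq T w) {θ y : ℝ → ℝ}
    (hθ : ContDiff ℝ ∞ θ) (hθ0 : ∀ t, T' ≤ t → θ t = 0) (hθp : ∀ t, 0 ≤ θ t)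
    (hy : ContDiff ℝ ∞ y) {d : ℝ} (hd : 0 < d) (hd' : d ≤ 1 / 4) :
    0 ≤ (∫ p in domain T, (|w p - y p.1| * (deriv θ p.1 * (1 - off d p.2))
      + kflux p.2 (w p) (y p.1) * (θ p.1
        * -(deriv kap (1 * p.2 / d) * (1 / d) + deriv kap (-1 * p.2 / d) * (-1 / d)))
      - Real.sign (w p - y p.1) * (y p.1 * |y p.1| / 2 + deriv y p.1)
        * (θ p.1 * (1 - off d p.2))))
      + ∫ m in Ioo (-1 : ℝ) 1, |2 * m - y 0| * (θ 0 * (1 - off d m)) := by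
  have hg : ContDiff ℝ ∞ fun m => 1 - off d m := contDiff_const.sub (contDiff_off d)
  have hφ := isTest_separable (s := Icc (-(2 * d)) (2 * d)) hT' hθ hθ0 hg isCompact_Icc
    (fun m hm => ⟨by linarith [hm.1], by linarith [hm.2]⟩) fun m hm => by
      rw [off_of_ge hd, sub_self]
      by_contra hc
      exact hm (abs_le.1 (not_le.1 hc).le)
  have hV : ContDiff ℝ ∞ fun p : ℝ × ℝ => y p.1 := hy.comp contDiff_fst
  have h := kruzhkov_smooth hT hw hB hE hV hφ fun p =>
    mul_nonneg (hθp _) (mul_nonneg (past_mem _).1 (by linarith [(off_mem hd p.2).2]))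
  refine h.trans_eq ?_
  congr 1
  · refine setIntegral_congr_fun (measurableSet_domain T) fun p hp => ?_
    have e1 : dm (fun p : ℝ × ℝ => y p.1) p = 0 := deriv_const p.2 (y p.1)
    have e2 : dt (fun p : ℝ × ℝ => y p.1) p = deriv y p.1 := rfl
    rw [dt_separable hθ hg hp.1.1, dm_separable hθ hg hp.1.1 ((hasDerivAt_off d p.2).const_sub 1),
      e1, e2, mul_zero, add_zero, weight_of_nonneg _ hp.1.1.le]
  · refine integral_congr_ae (ae_of_all _ fun m => ?_)
    simp only
    rw [weight_of_nonneg _ le_rfl]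

theorem Zplus_le_two {t : ℝ} (ht : 0 ≤ t) : Zplus t ≤ 2 := by
  have h0 := rootPlus_nonneg t
  have h1 := rootPlus_le_one t
  have h2 : 0 ≤ t * rootPlus t := mul_nonneg ht h0
  rw [Zplus, div_le_iff₀ (by linarith)]
  linarith

theorem measurable_Zplus : Measurable Zplus := by
  have h := continuous_rootPlus.measurable
  unfold Zplus
  exact (h.const_mul 2).div ((measurable_id.mul h).add_const 1)

/-- Here `a` stands for `Z` near the right trace `z` and `y` for an approximation of the left trace
`-z`. The shock inequality holds at `m = 0` between exact traces; the three terms pay for `a`, `y`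
and `m` being off. -/
theorem kflux_sub_le_right {m w a y z B : ℝ} (hm : |m| ≤ 1) (hw : |w| ≤ B) (ha : |a| ≤ B)
    (hy : |y| ≤ B) (hz : |z| ≤ B) (hz0 : 0 ≤ z) :
    kflux m w a - kflux m w y ≤ 2 * B * |a - z| + 2 * B * |y + z| + 2 * B ^ 2 * |m| := by
  have hz' : |-z| ≤ B := by rwa [abs_neg]
  have h1 := abs_le.1 (abs_kflux_sub_le hm hw ha hz)
  have h2 := abs_le.1 (abs_kflux_sub_le' (m := m) (m' := 0) hw hz)
  have h3 := kflux_zero_left_le (w := w) hz0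
  have h4 := abs_le.1 (abs_kflux_sub_le' (m := m) (m' := 0) hw hz')
  have h5 := abs_le.1 (abs_kflux_sub_le hm hw hy hz')
  rw [sub_zero] at h2 h4
  rw [sub_neg_eq_add] at h5
  linarith [h1.2, h2.2, h4.1, h5.1]

/-- On the left both `a` and `y` are close to the same trace `-z`, so Lipschitz continuity suffices.
-/
theorem kflux_sub_le_left {m w a y z B : ℝ} (hm : |m| ≤ 1) (hw : |w| ≤ B) (ha : |a| ≤ B)
    (hy : |y| ≤ B) (hz : |z| ≤ B) :
    kflux m w y - kflux m w a ≤ 2 * B * |a + z| + 2 * B * |y + z| := by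
  have hz' : |-z| ≤ B := by rwa [abs_neg]
  have h1 := abs_le.1 (abs_kflux_sub_le hm hw ha hz')
  have h5 := abs_le.1 (abs_kflux_sub_le hm hw hy hz')
  rw [sub_neg_eq_add] at h1 h5
  linarith [h1.1, h5.2]

/-- The entropy flux points outwards at `m = ±1`, so its bad part is at most `B²` times the distance
to the end. On the support of the cut-off's derivative that distance is at most `2 d`, which cancels
the factor `1 / d`. -/
theorem kflux_ends {m w a B d : ℝ} (hd : 0 < d) (hw : |w| ≤ B) (ha : |a| ≤ B) (hm : |m| < 1) :
    kflux m w a * (deriv kap ((1 - m) / d) * (-1 / d) + deriv kap ((1 + m) / d) * (1 / d))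
      ≤ 2 * B ^ 2 * (deriv kap ((1 - m) / d) + deriv kap ((1 + m) / d)) := by
  have hm := abs_lt.1 hm
  have key : ∀ x s : ℝ, s ≤ B ^ 2 * x →
      s * (deriv kap (x / d) * (1 / d)) ≤ 2 * B ^ 2 * deriv kap (x / d) := by
    intro x s hs
    by_cases hx : 2 < x / d
    · rw [deriv_kap_of_gt hx]
      simp
    · have hx : x ≤ 2 * d := by
        rw [not_lt, div_le_iff₀ hd] at hx
        exact hx
      have h1 : s ≤ 2 * B ^ 2 * d := hs.trans (by nlinarith [sq_nonneg B])
      have h2 : s * (1 / d) ≤ 2 * B ^ 2 := by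
        rw [mul_one_div, div_le_iff₀ hd]
        exact h1
      calc _ = s * (1 / d) * deriv kap (x / d) := by ring
        _ ≤ _ := mul_le_mul_of_nonneg_right h2 (deriv_kap_nonneg _)
  have h1 : -kflux m w a ≤ B ^ 2 * (1 - m) := by
    have h := abs_le.1 (abs_kflux_sub_le' (m := m) (m' := 1) hw ha)
    rw [abs_of_neg (show m - 1 < 0 by linarith)] at h
    linarith [h.1, kflux_one_nonneg w a]
  have h2 : kflux m w a ≤ B ^ 2 * (1 + m) := by
    have h := abs_le.1 (abs_kflux_sub_le' (m := m) (m' := -1) hw ha)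
    rw [abs_of_pos (show 0 < m - -1 by linarith)] at h
    linarith [h.2, kflux_neg_one_nonpos w a]
  have e1 := key _ _ h1
  have e2 := key _ _ h2
  calc _ = -kflux m w a * (deriv kap ((1 - m) / d) * (1 / d))
        + kflux m w a * (deriv kap ((1 + m) / d) * (1 / d)) := by ring
    _ ≤ _ := by linarith

/-! ### Passing to the limit in the scale of the cut-offs -/

/-- Borel functions bounded on the domain. -/
structure Tame (T : ℝ) (f : ℝ × ℝ → ℝ) : Prop where
  measurable : Measurable f
  bounded : ∃ C, 0 ≤ C ∧ ∀ p ∈ domain T, |f p| ≤ C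

namespace Tame

variable {T : ℝ} {f g : ℝ × ℝ → ℝ}

theorem add (hf : Tame T f) (hg : Tame T g) : Tame T fun p => f p + g p := by
  obtain ⟨a, ha0, ha⟩ := hf.bounded
  obtain ⟨b, hb0, hb⟩ := hg.bounded
  exact ⟨hf.measurable.add hg.measurable, a + b, by positivity, fun p hp =>
    (abs_add_le _ _).trans (add_le_add (ha p hp) (hb p hp))⟩

theorem mul (hf : Tame T f) (hg : Tame T g) : Tame T fun p => f p * g p := by
  obtain ⟨a, ha0, ha⟩ := hf.bounded
  obtain ⟨b, hb0, hb⟩ := hg.bounded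
  refine ⟨hf.measurable.mul hg.measurable, a * b, by positivity, fun p hp => ?_⟩
  rw [abs_mul]
  exact mul_le_mul (ha p hp) (hb p hp) (abs_nonneg _) ha0

theorem const (c : ℝ) : Tame T fun _ => c :=
  ⟨measurable_const, |c|, abs_nonneg c, fun _ _ => le_rfl⟩

theorem neg (hf : Tame T f) : Tame T fun p => -f p := by
  obtain ⟨a, ha0, ha⟩ := hf.bounded
  exact ⟨hf.measurable.neg, a, ha0, fun p hp => by rw [abs_neg]; exact ha p hp⟩

theorem sub (hf : Tame T f) (hg : Tame T g) : Tame T fun p => f p - g p := by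
  simpa only [sub_eq_add_neg] using hf.add hg.neg

theorem abs (hf : Tame T f) : Tame T fun p => |f p| := by
  obtain ⟨a, ha0, ha⟩ := hf.bounded
  exact ⟨hf.measurable.abs, a, ha0, fun p hp => by rw [abs_abs]; exact ha p hp⟩

theorem of_continuous (hf : Continuous f) : Tame T f := by
  obtain ⟨a, ha⟩ := (isCompact_Icc.prod isCompact_Icc).exists_bound_of_continuousOn
    (s := Icc 0 T ×ˢ Icc (-1 : ℝ) 1) hf.continuousOn
  exact ⟨hf.measurable, |a|, abs_nonneg a, fun p hp =>
    (ha p (domain_subset T hp)).trans (le_abs_self a)⟩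

theorem sign (hf : Tame T f) : Tame T fun p => Real.sign (f p) :=
  ⟨measurable_sign.comp hf.measurable, 1, zero_le_one, fun _ _ => abs_sign_le _⟩

theorem kflux (hf : Tame T f) (hg : Tame T g) : Tame T fun p => kflux p.2 (f p) (g p) := by
  have hm : Tame T fun p => p.2 := of_continuous continuous_snd
  have key : ∀ {h : ℝ × ℝ → ℝ}, Tame T h → Tame T fun p => flux p.2 (h p) := by
    intro h hh
    have := (hm.mul ((hh.mul hh.abs).mul (const (1 / 2)))).sub ((hh.mul hh).mul (const (1 / 2)))
    convert this using 2 with p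
    rw [flux]
    ring
  exact (hf.sub hg).sign.mul ((key hf).sub (key hg))

theorem integrableOn (hf : Tame T f) : IntegrableOn f (domain T) := by
  obtain ⟨a, -, ha⟩ := hf.bounded
  exact integrableOn_domain_of_bdd hf.measurable ha

end Tame

theorem tendsto_integral_mul_of_bounded {α : Type*} [MeasurableSpace α] {μ : Measure α}
    [IsFiniteMeasure μ] {F : α → ℝ} {g : ℝ → α → ℝ} {C K c : ℝ} (hF : Measurable F)
    (hg : ∀ d, Measurable (g d)) (hC : ∀ᵐ x ∂μ, |F x| ≤ C)
    (hK : ∀ᶠ d in 𝓝[>] (0 : ℝ), ∀ x, |g d x| ≤ K)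
    (hlim : ∀ᵐ x ∂μ, Tendsto (fun d => g d x) (𝓝[>] 0) (𝓝 c)) :
    Tendsto (fun d => ∫ x, F x * g d x ∂μ) (𝓝[>] 0) (𝓝 ((∫ x, F x ∂μ) * c)) := by
  rw [← integral_mul_const]
  refine tendsto_integral_filter_of_dominated_convergence (fun _ => C * K) ?_ ?_
    (integrable_const _) ?_
  · exact Eventually.of_forall fun d => (hF.mul (hg d)).aestronglyMeasurable
  · filter_upwards [hK] with d hd
    filter_upwards [hC] with x hx
    rw [Real.norm_eq_abs, abs_mul]
    exact mul_le_mul hx (hd x) (abs_nonneg _) ((abs_nonneg _).trans hx)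
  · filter_upwards [hlim] with x hx
    exact hx.const_mul _

theorem tendsto_deriv_kap_div {x : ℝ} (hx : 0 < x) :
    Tendsto (fun d => deriv kap (x / d)) (𝓝[>] 0) (𝓝 0) := by
  refine tendsto_const_nhds.congr' ?_
  filter_upwards [Ioo_mem_nhdsGT (show 0 < x / 2 by positivity)] with d hd
  refine (deriv_kap_of_gt ?_).symm
  rw [lt_div_iff₀ hd.1]
  linarith [hd.2]

theorem ae_domain_snd_ne (T : ℝ) :
    ∀ᵐ p ∂((volume : Measure (ℝ × ℝ)).restrict (domain T)), p.2 ≠ 0 := by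
  refine ae_restrict_of_ae ?_
  rw [Measure.volume_eq_prod]
  exact Measure.quasiMeasurePreserving_snd.ae (Measure.ae_ne volume (0 : ℝ))

theorem Tame.ae_bounded {T : ℝ} {f : ℝ × ℝ → ℝ} (hf : Tame T f) :
    ∃ C, ∀ᵐ p ∂((volume : Measure (ℝ × ℝ)).restrict (domain T)), |f p| ≤ C := by
  obtain ⟨C, -, h1⟩ := hf.bounded
  exact ⟨C, (ae_restrict_iff' (measurableSet_domain T)).2 (ae_of_all _ h1)⟩

theorem eventually_scale : ∀ᶠ d in 𝓝[>] (0 : ℝ), 0 < d ∧ d ≤ 1 / 4 :=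
  Ioc_mem_nhdsGT (show (0 : ℝ) < 1 / 4 by norm_num)

theorem continuous_bulk_snd (d : ℝ) : Continuous fun p : ℝ × ℝ => bulk d p.2 :=
  (contDiff_bulk d).continuous.comp continuous_snd

theorem continuous_layer (d : ℝ) : Continuous fun m => 1 - off d m :=
  continuous_const.sub (contDiff_off d).continuous

theorem continuous_ends_sum (d : ℝ) : Continuous fun p : ℝ × ℝ =>
    deriv kap ((1 - p.2) / d) + deriv kap ((1 + p.2) / d) :=
  (continuous_deriv_kap.comp ((continuous_const.sub continuous_snd).div_const d)).add
    (continuous_deriv_kap.comp ((continuous_const.add continuous_snd).div_const d))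

theorem eventually_layer_le : ∀ᶠ d in 𝓝[>] (0 : ℝ), ∀ m, |1 - off d m| ≤ 1 := by
  filter_upwards [eventually_scale] with d hd m
  have := off_mem hd.1 m
  rw [abs_of_nonneg (by linarith [this.2])]
  linarith [this.1]

theorem tendsto_one_sub_off {m : ℝ} (hm : m ≠ 0) :
    Tendsto (fun d => 1 - off d m) (𝓝[>] 0) (𝓝 0) := by
  simpa using (tendsto_off hm).const_sub 1

theorem Tame.tendsto_bulk {T : ℝ} {F : ℝ × ℝ → ℝ} (hF : Tame T F) :
    Tendsto (fun d => ∫ p in domain T, F p * bulk d p.2) (𝓝[>] 0) (𝓝 (∫ p in domain T, F p)) := by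
  obtain ⟨C, hC⟩ := hF.ae_bounded
  have h := tendsto_integral_mul_of_bounded (μ := volume.restrict (domain T))
    (g := fun d p => bulk d p.2) (K := 1) (c := 1) hF.measurable
    (fun d => (continuous_bulk_snd d).measurable) hC ?_ ?_
  · rwa [mul_one] at h
  · filter_upwards [eventually_scale] with d hd p
    have := bulk_mem hd.1 hd.2 p.2
    rw [abs_of_nonneg this.1]
    exact this.2
  · filter_upwards [ae_domain_snd_ne T, ae_restrict_mem (measurableSet_domain T)] with p hp hp'
    exact TwoState.tendsto_bulk hp (abs_lt.2 hp'.2)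

theorem Tame.tendsto_one_sub_off {T : ℝ} {F : ℝ × ℝ → ℝ} (hF : Tame T F) :
    Tendsto (fun d => ∫ p in domain T, F p * (1 - off d p.2)) (𝓝[>] 0) (𝓝 0) := by
  obtain ⟨C, hC⟩ := hF.ae_bounded
  have h := tendsto_integral_mul_of_bounded (μ := volume.restrict (domain T))
    (g := fun d p => 1 - off d p.2) (K := 1) (c := 0) hF.measurable
    (fun d => ((continuous_layer d).comp continuous_snd).measurable) hC ?_ ?_
  · rwa [mul_zero] at h
  · filter_upwards [eventually_layer_le] with d hd p
    exact hd _
  · filter_upwards [ae_domain_snd_ne T] with p hp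
    exact TwoState.tendsto_one_sub_off hp

theorem tendsto_integral_one_sub_off {I : ℝ → ℝ} (hI : Continuous I) :
    Tendsto (fun d => ∫ m in Ioo (-1 : ℝ) 1, I m * (1 - off d m)) (𝓝[>] 0) (𝓝 0) := by
  obtain ⟨C, hC⟩ := isCompact_Icc.exists_bound_of_continuousOn (s := Icc (-1 : ℝ) 1)
    hI.continuousOn
  have h := tendsto_integral_mul_of_bounded (μ := volume.restrict (Ioo (-1 : ℝ) 1))
    (g := fun d m => 1 - off d m) (K := 1) (C := C) (c := 0)
    hI.measurable (fun d => (continuous_layer d).measurable)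
    ((ae_restrict_iff' measurableSet_Ioo).2 (ae_of_all _ fun m hm => hC m ⟨hm.1.le, hm.2.le⟩))
    eventually_layer_le (ae_restrict_of_ae ?_)
  · rwa [mul_zero] at h
  filter_upwards [Measure.ae_ne volume (0 : ℝ)] with m hm
  exact tendsto_one_sub_off hm

theorem Tame.tendsto_ends {T : ℝ} {G : ℝ × ℝ → ℝ} (hG : Tame T G) :
    Tendsto (fun d => ∫ p in domain T, G p
      * (deriv kap ((1 - p.2) / d) + deriv kap ((1 + p.2) / d))) (𝓝[>] 0) (𝓝 0) := by
  obtain ⟨K, -, hK⟩ := exists_deriv_kap_le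
  obtain ⟨C, hC⟩ := hG.ae_bounded
  have h := tendsto_integral_mul_of_bounded (μ := volume.restrict (domain T))
    (g := fun d p => deriv kap ((1 - p.2) / d) + deriv kap ((1 + p.2) / d)) (K := K + K) (c := 0)
    hG.measurable (fun d => (continuous_ends_sum d).measurable) hC ?_ ?_
  · rwa [mul_zero] at h
  · refine Eventually.of_forall fun d p => ?_
    rw [abs_of_nonneg (add_nonneg (deriv_kap_nonneg _) (deriv_kap_nonneg _))]
    exact add_le_add (hK _) (hK _)
  · filter_upwards [ae_restrict_mem (measurableSet_domain T)] with p hp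
    simpa using (tendsto_deriv_kap_div (show 0 < 1 - p.2 by linarith [hp.2.2])).add
      (tendsto_deriv_kap_div (show 0 < 1 + p.2 by linarith [hp.2.1]))

/-- Bound for the flux through the right side of the layer around `m = 0`. -/
def rightDefect (B : ℝ) (θ y : ℝ → ℝ) (p : ℝ × ℝ) : ℝ :=
  (2 * B * |Zm p - Zplus p.1| + 2 * B * |y p.1 + Zplus p.1| + 2 * B ^ 2 * |p.2|) * θ p.1

/-- Bound for the flux through the left side of the layer around `m = 0`. -/
def leftDefect (B : ℝ) (θ y : ℝ → ℝ) (p : ℝ × ℝ) : ℝ :=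
  (2 * B * |Zm p + Zplus p.1| + 2 * B * |y p.1 + Zplus p.1|) * θ p.1

theorem tame_Zm (T : ℝ) : Tame T Zm := ⟨measurable_Zm, 2, by norm_num, fun p _ => abs_Zm_le p⟩

theorem tame_Zplus (T : ℝ) : Tame T fun p => Zplus p.1 :=
  ⟨measurable_Zplus.comp measurable_fst, 2, by norm_num, fun p hp => by
    rw [abs_of_nonneg (Zplus_nonneg hp.1.1.le)]
    exact Zplus_le_two hp.1.1.le⟩

theorem Tame.fst {T : ℝ} {f : ℝ → ℝ} (hf : Continuous f) : Tame T fun p => f p.1 :=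
  .of_continuous (hf.comp continuous_fst)

theorem tame_rightDefect (T B : ℝ) {θ y : ℝ → ℝ} (hθ : Continuous θ) (hy : Continuous y) :
    Tame T (rightDefect B θ y) :=
  ((((Tame.const _).mul ((tame_Zm T).sub (tame_Zplus T)).abs).add
    ((Tame.const _).mul ((Tame.fst hy).add (tame_Zplus T)).abs)).add
      ((Tame.const _).mul (Tame.of_continuous continuous_snd).abs)).mul (Tame.fst hθ)

theorem tame_leftDefect (T B : ℝ) {θ y : ℝ → ℝ} (hθ : Continuous θ) (hy : Continuous y) :
    Tame T (leftDefect B θ y) :=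
  (((Tame.const _).mul ((tame_Zm T).add (tame_Zplus T)).abs).add
    ((Tame.const _).mul ((Tame.fst hy).add (tame_Zplus T)).abs)).mul (Tame.fst hθ)

/-- At `m = 0+` the function `Z` reaches its trace and `|m|` vanishes; only the error of `y` as an
approximation of `-Zplus` survives. -/
theorem tendsto_rightDefect (T B : ℝ) {θ y : ℝ → ℝ} (hθ : Continuous θ) (hy : Continuous y) :
    Tendsto (fun d => ∫ p in domain T, rightDefect B θ y p
      * (deriv kap (1 * p.2 / d) * (1 / d))) (𝓝[>] 0)
      (𝓝 ((∫ t in Ioo 0 T, 2 * B * |y t + Zplus t| * θ t)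
        * ∫ x in Icc (1 : ℝ) 2, deriv kap x)) := by
  have hR := tame_rightDefect T B hθ hy
  obtain ⟨C, hC0, hC⟩ := hR.bounded
  refine tendsto_layer_of_bdd (Q := fun t m => rightDefect B θ y (t, m)) (C := C) (by simp)
    hR.measurable hC0 (fun t ht m hm => hC (t, m) ⟨ht, hm⟩) fun t ht => ?_
  have h1 := ((tendsto_Zm_right ht.1).sub_const (Zplus t)).abs.const_mul (2 * B)
  have h2 : Tendsto (fun h : ℝ => 2 * B ^ 2 * |1 * h|) (𝓝[>] 0) (𝓝 (2 * B ^ 2 * |1 * 0|)) :=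
    (Continuous.tendsto (by fun_prop) 0).mono_left nhdsWithin_le_nhds
  have h3 := ((h1.add_const (2 * B * |y t + Zplus t|)).add h2).mul_const (θ t)
  simp only [sub_self, abs_zero, mul_zero, zero_add, add_zero] at h3
  exact h3

theorem tendsto_leftDefect (T B : ℝ) {θ y : ℝ → ℝ} (hθ : Continuous θ) (hy : Continuous y) :
    Tendsto (fun d => ∫ p in domain T, leftDefect B θ y p
      * (deriv kap (-1 * p.2 / d) * (1 / d))) (𝓝[>] 0)
      (𝓝 ((∫ t in Ioo 0 T, 2 * B * |y t + Zplus t| * θ t)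
        * ∫ x in Icc (1 : ℝ) 2, deriv kap x)) := by
  have hL := tame_leftDefect T B hθ hy
  obtain ⟨C, hC0, hC⟩ := hL.bounded
  refine tendsto_layer_of_bdd (Q := fun t m => leftDefect B θ y (t, m)) (C := C) (by simp)
    hL.measurable hC0 (fun t ht m hm => hC (t, m) ⟨ht, hm⟩) fun t ht => ?_
  have h1 := ((tendsto_Zm_left ht.1).add_const (Zplus t)).abs.const_mul (2 * B)
  have h3 := (h1.add_const (2 * B * |y t + Zplus t|)).mul_const (θ t)
  simp only [neg_add_cancel, abs_zero, mul_zero, zero_add] at h3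
  exact h3

/-- The sum of the inequalities of the bulk and of the layer, estimated pointwise. Adding them first
is essential: near `m = 0` each flux term alone is of size `1 / d`, and only their difference is
controlled. -/
theorem comparison_at_scale {T T' B : ℝ} (hT : 0 < T) (hT' : T' < T) {w : ℝ × ℝ → ℝ}
    (hw : Measurable w) (hB : ∀ p, |w p| ≤ B) (hB2 : 2 ≤ B) (hE : EntropyIneq T w) {θ y : ℝ → ℝ}
    (hθ : ContDiff ℝ ∞ θ) (hθ0 : ∀ t, T' ≤ t → θ t = 0) (hθp : ∀ t, 0 ≤ θ t)
    (hy : ContDiff ℝ ∞ y) (hyB : ∀ t ∈ Ioo 0 T, |y t| ≤ B) {F E : ℝ × ℝ → ℝ}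
    (hF : ∀ p, F p = |w p - Zm p| * deriv θ p.1) (tF : Tame T F)
    (hE' : ∀ p, E p = |w p - y p.1| * deriv θ p.1
      - Real.sign (w p - y p.1) * (y p.1 * |y p.1| / 2 + deriv y p.1) * θ p.1) (tE : Tame T E)
    {d : ℝ} (hd : 0 < d) (hd' : d ≤ 1 / 4) :
    0 ≤ (∫ p in domain T, F p * bulk d p.2)
      + (∫ p in domain T, 2 * B ^ 2 * θ p.1
        * (deriv kap ((1 - p.2) / d) + deriv kap ((1 + p.2) / d)))
      + (∫ p in domain T, rightDefect B θ y p * (deriv kap (1 * p.2 / d) * (1 / d)))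
      + (∫ p in domain T, leftDefect B θ y p * (deriv kap (-1 * p.2 / d) * (1 / d)))
      + (∫ p in domain T, E p * (1 - off d p.2))
      + ∫ m in Ioo (-1 : ℝ) 1, |2 * m - y 0| * θ 0 * (1 - off d m) := by
  have bZ : ∀ p, |Zm p| ≤ B := fun p => (abs_Zm_le p).trans hB2
  have tw : Tame T w := ⟨hw, B, by linarith, fun p _ => hB p⟩
  have tZ := tame_Zm T
  have tθ : Tame T fun p => θ p.1 := .fst hθ.continuous
  have ty : Tame T fun p => y p.1 := .fst hy.continuous
  have tb : Tame T fun p => bulk d p.2 := .of_continuous (continuous_bulk_snd d)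
  have tl : Tame T fun p => 1 - off d p.2 :=
    .of_continuous ((continuous_layer d).comp continuous_snd)
  have tk : ∀ c b : ℝ, Tame T fun p => deriv kap (c * p.2 / d) * (b / d) := fun c b =>
    .of_continuous ((continuous_deriv_kap.comp
      ((continuous_const.mul continuous_snd).div_const d)).mul continuous_const)
  have te : Tame T fun p => deriv kap ((1 - p.2) / d) * (-1 / d)
      + deriv kap ((1 + p.2) / d) * (1 / d) := .of_continuous
    (((continuous_deriv_kap.comp ((continuous_const.sub continuous_snd).div_const d)).mul
      continuous_const).add ((continuous_deriv_kap.comp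
        ((continuous_const.add continuous_snd).div_const d)).mul continuous_const))
  have h1 := kruzhkov_bulk hT hT' hw hB hE hθ hθ0 hθp hd hd'
  have h2 := kruzhkov_layer hT hT' hw hB hE hθ hθ0 hθp hy hd hd'
  have tFb := tF.mul tb
  have tG : Tame T fun p => 2 * B ^ 2 * θ p.1
      * (deriv kap ((1 - p.2) / d) + deriv kap ((1 + p.2) / d)) :=
    ((Tame.const _).mul tθ).mul (.of_continuous (continuous_ends_sum d))
  have tR := (tame_rightDefect T B hθ.continuous hy.continuous).mul (tk 1 1)
  have tL := (tame_leftDefect T B hθ.continuous hy.continuous).mul (tk (-1) 1)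
  have tEl := tE.mul tl
  have t1 : Tame T fun p => |w p - Zm p| * (deriv θ p.1 * bulk d p.2) + kflux p.2 (w p) (Zm p)
      * (θ p.1 * (deriv kap ((1 - p.2) / d) * (-1 / d) + deriv kap ((1 + p.2) / d) * (1 / d)
        + (deriv kap (1 * p.2 / d) * (1 / d) + deriv kap (-1 * p.2 / d) * (-1 / d)))) := by
    have h := tFb.add ((tw.kflux tZ).mul (tθ.mul (te.add ((tk 1 1).add (tk (-1) (-1))))))
    simpa only [hF, mul_assoc] using h
  have t2 : Tame T fun p => |w p - y p.1| * (deriv θ p.1 * (1 - off d p.2))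
      + kflux p.2 (w p) (y p.1) * (θ p.1
        * -(deriv kap (1 * p.2 / d) * (1 / d) + deriv kap (-1 * p.2 / d) * (-1 / d)))
      - Real.sign (w p - y p.1) * (y p.1 * |y p.1| / 2 + deriv y p.1)
        * (θ p.1 * (1 - off d p.2)) := by
    have h := tEl.add ((tw.kflux ty).mul (tθ.mul ((tk 1 1).add (tk (-1) (-1))).neg))
    convert h using 2 with p
    rw [hE']
    ring
  rw [← integral_add tFb.integrableOn tG.integrableOn,
    ← integral_add (tFb.add tG).integrableOn tR.integrableOn,
    ← integral_add ((tFb.add tG).add tR).integrableOn tL.integrableOn,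
    ← integral_add (((tFb.add tG).add tR).add tL).integrableOn tEl.integrableOn]
  have h3 : ∫ m in Ioo (-1 : ℝ) 1, |2 * m - y 0| * (θ 0 * (1 - off d m))
      = ∫ m in Ioo (-1 : ℝ) 1, |2 * m - y 0| * θ 0 * (1 - off d m) := by
    simp only [mul_assoc]
  rw [h3] at h2
  have h4 := add_nonneg h1 h2
  rw [← add_assoc, ← integral_add t1.integrableOn t2.integrableOn] at h4
  refine h4.trans (add_le_add (setIntegral_mono_on (t1.add t2).integrableOn
    ((((tFb.add tG).add tR).add tL).add tEl).integrableOn (measurableSet_domain T)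
    fun p hp => ?_) le_rfl)
  have hm := abs_lt.2 hp.2
  have hz0 := Zplus_nonneg hp.1.1.le
  have hz : |Zplus p.1| ≤ B := by
    rw [abs_of_nonneg hz0]
    exact (Zplus_le_two hp.1.1.le).trans hB2
  have b1 := mul_le_mul_of_nonneg_left (kflux_ends hd (hB p) (bZ p) hm) (hθp p.1)
  have k0 : ∀ c : ℝ, 0 ≤ θ p.1 * (deriv kap (c * p.2 / d) * (1 / d)) := fun c =>
    mul_nonneg (hθp _) (mul_nonneg (deriv_kap_nonneg _) (by positivity))
  have b2 := mul_le_mul_of_nonneg_right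
    (kflux_sub_le_right hm.le (hB p) (bZ p) (hyB _ hp.1) hz hz0) (k0 1)
  have b3 := mul_le_mul_of_nonneg_right
    (kflux_sub_le_left hm.le (hB p) (bZ p) (hyB _ hp.1) hz) (k0 (-1))
  simp only [hF, hE', rightDefect, leftDefect]
  linear_combination b1 + b2 + b3

/-- As `d → 0` the terms at the ends, the volume term of the layer and its initial term vanish. The
two defects contribute equally, whence the factor `2`. -/
theorem comparison_with_defect {T T' B : ℝ} (hT : 0 < T) (hT' : T' < T) {w : ℝ × ℝ → ℝ}
    (hw : Measurable w) (hB : ∀ p, |w p| ≤ B) (hB2 : 2 ≤ B) (hE : EntropyIneq T w) {θ y : ℝ → ℝ}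
    (hθ : ContDiff ℝ ∞ θ) (hθ0 : ∀ t, T' ≤ t → θ t = 0) (hθp : ∀ t, 0 ≤ θ t)
    (hy : ContDiff ℝ ∞ y) (hyB : ∀ t ∈ Ioo 0 T, |y t| ≤ B) :
    0 ≤ (∫ p in domain T, |w p - Zm p| * deriv θ p.1)
      + 2 * ((∫ t in Ioo 0 T, 2 * B * |y t + Zplus t| * θ t)
        * ∫ x in Icc (1 : ℝ) 2, deriv kap x) := by
  have hle : (1 : WithTop ℕ∞) ≤ ∞ := by exact_mod_cast le_top
  have tw : Tame T w := ⟨hw, B, by linarith, fun p _ => hB p⟩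
  have tθ : Tame T fun p => θ p.1 := .fst hθ.continuous
  have tθ' : Tame T fun p => deriv θ p.1 := .fst (hθ.continuous_deriv hle)
  have ty : Tame T fun p => y p.1 := .fst hy.continuous
  have ty' : Tame T fun p => deriv y p.1 := .fst (hy.continuous_deriv hle)
  have tF : Tame T fun p => |w p - Zm p| * deriv θ p.1 := (tw.sub (tame_Zm T)).abs.mul tθ'
  have tE : Tame T fun p => |w p - y p.1| * deriv θ p.1
      - Real.sign (w p - y p.1) * (y p.1 * |y p.1| / 2 + deriv y p.1) * θ p.1 :=
    ((tw.sub ty).abs.mul tθ').sub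
      (((tw.sub ty).sign.mul (((ty.mul ty.abs).mul (.const 2⁻¹)).add ty')).mul tθ)
  have tG : Tame T fun p => 2 * B ^ 2 * θ p.1 := (Tame.const _).mul tθ
  have hI : Continuous fun m : ℝ => |2 * m - y 0| * θ 0 :=
    ((continuous_const.mul continuous_id).sub continuous_const).abs.mul continuous_const
  have hlim := ((((tF.tendsto_bulk.add tG.tendsto_ends).add
    (tendsto_rightDefect T B hθ.continuous hy.continuous)).add
    (tendsto_leftDefect T B hθ.continuous hy.continuous)).add
    tE.tendsto_one_sub_off).add (tendsto_integral_one_sub_off hI)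
  refine (ge_of_tendsto hlim ?_).trans_eq (by ring)
  filter_upwards [eventually_scale] with d hd
  exact comparison_at_scale hT hT' hw hB hB2 hE hθ hθ0 hθp hy hyB (fun _ => rfl) tF
    (fun _ => rfl) tE hd.1 hd.2

theorem comparison {T T' B : ℝ} (hT : 0 < T) (hT' : T' < T) {w : ℝ × ℝ → ℝ}
    (hw : Measurable w) (hB : ∀ p, |w p| ≤ B) (hB3 : 3 ≤ B) (hE : EntropyIneq T w) {θ : ℝ → ℝ}
    (hθ : ContDiff ℝ ∞ θ) (hθ0 : ∀ t, T' ≤ t → θ t = 0) (hθp : ∀ t, 0 ≤ θ t) :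
    0 ≤ ∫ p in domain T, |w p - Zm p| * deriv θ p.1 := by
  set X := ∫ p in domain T, |w p - Zm p| * deriv θ p.1
  set κ := ∫ x in Icc (1 : ℝ) 2, deriv kap x
  have hκ : 0 ≤ κ := setIntegral_nonneg measurableSet_Icc fun x _ => deriv_kap_nonneg x
  have iθ : IntegrableOn θ (Ioo 0 T) :=
    (hθ.continuous.integrableOn_Icc (a := 0) (b := T)).mono_set Ioo_subset_Icc_self
  have main : ∀ η ∈ Ioo (0 : ℝ) 1, 0 ≤ X + η * (2 * (2 * B * (∫ t in Ioo 0 T, θ t) * κ)) := by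
    intro η hη
    -- The function `y` must be smooth whereas the trace `Zplus` is only known to be continuous, so
    -- Weierstrass approximation is used. With `η < 1` and `Zplus ≤ 2` one gets `|y| ≤ 3`, the
    -- reason for `3 ≤ B`.
    obtain ⟨P, hP⟩ := exists_polynomial_near_of_continuousOn 0 T Zplus
      (continuousOn_Zplus.mono Icc_subset_Ici_self) η hη.1
    have hP' : ∀ t ∈ Ioo 0 T, |-P.eval t + Zplus t| ≤ η := fun t ht => by
      rw [neg_add_eq_sub, abs_sub_comm]
      exact (hP t ⟨ht.1.le, ht.2.le⟩).le
    have h := comparison_with_defect hT hT' hw hB (by linarith) hE hθ hθ0 hθp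
      (y := fun t => -P.eval t) (P.contDiff_aeval ∞).neg fun t ht => by
        have h1 := abs_le.1 (hP' t ht)
        have h2 := Zplus_nonneg ht.1.le
        have h3 := Zplus_le_two ht.1.le
        rw [abs_le]
        constructor <;> linarith [h1.1, h1.2, hη.2]
    have h2 : ∫ t in Ioo 0 T, 2 * B * |-P.eval t + Zplus t| * θ t
        ≤ ∫ t in Ioo 0 T, 2 * B * η * θ t := by
      refine integral_mono_of_nonneg (ae_of_all _ fun t => ?_) (iθ.const_mul _)
        ((ae_restrict_iff' measurableSet_Ioo).2 (ae_of_all _ fun t ht => ?_))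
      · exact mul_nonneg (mul_nonneg (by linarith) (abs_nonneg _)) (hθp t)
      · exact mul_le_mul_of_nonneg_right
          (mul_le_mul_of_nonneg_left (hP' t ht) (by linarith)) (hθp t)
    rw [integral_const_mul] at h2
    have h3 := mul_le_mul_of_nonneg_right h2 hκ
    linarith
  have hlim : Tendsto (fun η : ℝ => X + η * (2 * (2 * B * (∫ t in Ioo 0 T, θ t) * κ)))
      (𝓝[>] 0) (𝓝 (X + 0 * (2 * (2 * B * (∫ t in Ioo 0 T, θ t) * κ)))) :=
    (Continuous.tendsto (by fun_prop) 0).mono_left nhdsWithin_le_nhds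
  rw [zero_mul, add_zero] at hlim
  refine ge_of_tendsto hlim ?_
  filter_upwards [Ioo_mem_nhdsGT (zero_lt_one (α := ℝ))] with η hη
  exact main η hη

theorem deriv_expNegInvGlue_pos {x : ℝ} (hx : 0 < x) : 0 < deriv expNegInvGlue x := by
  have h : expNegInvGlue =ᶠ[𝓝 x] fun x => Real.exp (-x⁻¹) := by
    filter_upwards [lt_mem_nhds hx] with y hy
    rw [expNegInvGlue, if_neg (not_le.2 hy)]
  have h2 : HasDerivAt (fun x : ℝ => Real.exp (-x⁻¹)) (Real.exp (-x⁻¹) * -(-(x ^ 2)⁻¹)) x :=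
    ((hasDerivAt_inv hx.ne').neg).exp
  rw [h.deriv_eq, h2.deriv, neg_neg]
  positivity

theorem deriv_expNegInvGlue_nonneg (x : ℝ) : 0 ≤ deriv expNegInvGlue x :=
  expNegInvGlue.monotone.deriv_nonneg

/-- The choice `θ (t) = expNegInvGlue (T' - t)` is smooth, vanishes from `T'` on and has negative
derivative before `T'`. The comparison makes the integral of a nonnegative function at most zero, so
`w = Z` almost everywhere before `T'`. -/
theorem ae_eq_Zm_of_lt {T T' B : ℝ} (hT : 0 < T) (hT' : T' < T) {w : ℝ × ℝ → ℝ}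
    (hw : Measurable w) (hB : ∀ p, |w p| ≤ B) (hB3 : 3 ≤ B) (hE : EntropyIneq T w) :
    ∀ᵐ p ∂((volume : Measure (ℝ × ℝ)).restrict (domain T)), p.1 < T' → w p = Zm p := by
  have hle : (1 : WithTop ℕ∞) ≤ ∞ := by exact_mod_cast le_top
  have hθ : ContDiff ℝ ∞ fun t => expNegInvGlue (T' - t) :=
    expNegInvGlue.contDiff.comp (contDiff_const.sub contDiff_id)
  have hd : ∀ t, deriv (fun t => expNegInvGlue (T' - t)) t = -deriv expNegInvGlue (T' - t) :=
    fun t => deriv_comp_const_sub _ _ _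
  have h := comparison hT hT' hw hB hB3 hE hθ
    (fun t ht => expNegInvGlue.zero_of_nonpos (by linarith)) fun t => expNegInvGlue.nonneg _
  have tw : Tame T w := ⟨hw, B, by linarith, fun p _ => hB p⟩
  have tF : Tame T fun p => |w p - Zm p| * deriv expNegInvGlue (T' - p.1) :=
    (tw.sub (tame_Zm T)).abs.mul (.fst (f := fun t => deriv expNegInvGlue (T' - t))
      (((expNegInvGlue.contDiff (n := ⊤)).continuous_deriv hle).comp
        (continuous_const.sub continuous_id)))
  have h0 : ∀ p : ℝ × ℝ, 0 ≤ |w p - Zm p| * deriv expNegInvGlue (T' - p.1) := fun p =>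
    mul_nonneg (abs_nonneg _) (deriv_expNegInvGlue_nonneg _)
  simp only [hd, mul_neg, integral_neg] at h
  have h1 := (integral_eq_zero_iff_of_nonneg h0 tF.integrableOn).1
    (le_antisymm (by linarith) (integral_nonneg h0))
  filter_upwards [h1] with p hp ht
  have h2 := deriv_expNegInvGlue_pos (show 0 < T' - p.1 by linarith)
  rcases mul_eq_zero.1 hp with h3 | h3
  · exact sub_eq_zero.1 (abs_eq_zero.1 h3)
  · exact absurd h3 h2.ne'

theorem ae_eq_Zm {T B : ℝ} (hT : 0 < T) {w : ℝ × ℝ → ℝ}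
    (hw : Measurable w) (hB : ∀ p, |w p| ≤ B) (hB3 : 3 ≤ B) (hE : EntropyIneq T w) :
    ∀ᵐ p ∂((volume : Measure (ℝ × ℝ)).restrict (domain T)), w p = Zm p := by
  have h : ∀ᵐ p ∂((volume : Measure (ℝ × ℝ)).restrict (domain T)), ∀ n : ℕ,
      p.1 < T - 1 / (n + 1) → w p = Zm p := ae_all_iff.2 fun n =>
    ae_eq_Zm_of_lt hT (sub_lt_self T (by positivity)) hw hB hB3 hE
  filter_upwards [h, ae_restrict_mem (measurableSet_domain T)] with p hp hp'
  obtain ⟨n, hn⟩ := exists_nat_one_div_lt (sub_pos.2 hp'.1.2)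
  exact hp n (by linarith)

theorem IsEntropySolution.ae_eq_Zstar {T : ℝ} (hT : 0 < T) {W : ℝ → ℝ → ℝ}
    (hW : IsEntropySolution flux (fun m => 2 * m) T W) :
    ∀ᵐ p ∂(volume.restrict (domain T)), W p.1 p.2 = Zstar p.1 p.2 := by
  obtain ⟨C, hC⟩ := hW.bounded
  set B := max 3 C with hBdef
  have hB3 : (3 : ℝ) ≤ B := le_max_left _ _
  -- A Borel representative, truncated so that the bound holds at every point; neither operation
  -- changes `W` off a null set.
  set w : ℝ × ℝ → ℝ := fun p => max (-B) (min (hW.measurable.mk _ p) B) with hwdef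
  have hw : Measurable w :=
    measurable_const.max (hW.measurable.measurable_mk.min measurable_const)
  have hB : ∀ p, |w p| ≤ B := fun p =>
    abs_le.2 ⟨le_max_left _ _, max_le (by linarith) (min_le_right _ _)⟩
  have heq : ∀ᵐ p ∂(volume.restrict (domain T)), W p.1 p.2 = w p := by
    filter_upwards [hC, hW.measurable.ae_eq_mk] with p h1 h2
    have h3 := abs_le.1 (h1.trans (le_max_right 3 C))
    rw [hwdef]
    simp only
    rw [← h2, min_eq_left h3.2, max_eq_right h3.1]
  have hE : EntropyIneq T w := by
    intro k φ hφ hpos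
    refine (hW.entropy k φ hφ hpos).trans_eq ?_
    congr 1
    refine integral_congr_ae ?_
    filter_upwards [heq] with p hp
    rw [hp, deriv_flux_left, kflux]
  filter_upwards [heq, ae_eq_Zm hT hw hB hB3 hE, ae_restrict_mem (measurableSet_domain T)]
    with p h1 h2 hp
  rw [h1, h2, Zm_eq hp.1.1 hp.2, Zs]

end TwoState

end

theorem theorem3p2 :
    -- the function `M`, hence `Z`, is well defined for all times
    (∀ t : ℝ, 0 ≤ t → ∀ m ∈ Icc (-1 : ℝ) 1, m ≠ 0 →
      ∃! M : ℝ, TwoState.IsSignedRoot t m M) ∧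
    -- on every time interval, `Z` is an entropy solution, and the only one up to null sets
    (∀ T : ℝ, 0 < T →
      TwoState.IsEntropySolution TwoState.flux (fun m => 2 * m) T TwoState.Zstar ∧
      ∀ W : ℝ → ℝ → ℝ,
        TwoState.IsEntropySolution TwoState.flux (fun m => 2 * m) T W →
        ∀ᵐ p ∂(volume.restrict (TwoState.domain T)), W p.1 p.2 = TwoState.Zstar p.1 p.2) ∧
    -- `Z` jumps across `m = 0` at every time `t > 1/2`, from a negative to the opposite positive
    -- value, and is continuous everywhere else
    (∀ t : ℝ, 1 / 2 < t → ∃ z : ℝ, 0 < z ∧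
      Tendsto (fun m => TwoState.Zstar t m) (𝓝[>] 0) (𝓝 z) ∧
      Tendsto (fun m => TwoState.Zstar t m) (𝓝[<] 0) (𝓝 (-z))) ∧
    ContinuousOn (fun p : ℝ × ℝ => TwoState.Zstar p.1 p.2)
      {p : ℝ × ℝ | 0 ≤ p.1 ∧ p.2 ∈ Icc (-1 : ℝ) 1 ∧ ¬ (p.2 = 0 ∧ 1 / 2 < p.1)} :=
  ⟨fun _ ht _ hm hm0 => TwoState.existsUnique_isSignedRoot ht hm hm0,
    fun _ hT => ⟨TwoState.isEntropySolution_Zstar hT, fun _ hW => hW.ae_eq_Zstar hT⟩,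
    fun t ht => ⟨TwoState.Zplus t, TwoState.Zplus_pos ht,
      TwoState.tendsto_Zstar_right (by linarith), TwoState.tendsto_Zstar_left (by linarith)⟩,
    TwoState.continuousOn_Zstar⟩
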